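/- Let $M$ be a smooth (Hausdorff, second countable, finite-dimensional) manifold, let $A\to M$ be a Lie algebroid with anchor $\rho$ and Lie algebroid differential $\mathbf d_A$ on $\Omega^\bullet(A)=\Gamma(\wedge^\bullet A^*)$, and let $\underline E=\bigoplus_{z\in\mathbb Z}E_z[z]$ be a graded real vector bundle of finite rank over $M$ (each $E_z$ is a smooth vector bundle of finite rank, and $E_z=0$ for all but finitely many $z$). Elements of $\Omega^s(A,E_z)=\Gamma(\wedge^sA^*\otimes E_z)$ have total degree $s+z$, and elements of $\Omega^i(A,\operatorname{Hom}(E_z,E_j))$ have total degree $i+j-z$. For a vector bundle $E\to M$ with a linear $A$-connection $\nabla$, let $\mathbf d_\nabla$ be its covariant exterior derivative on $\Omega^\bullet(A,E)$, and let $R_\nabla^l\in\Omega^{2l}(A,\operatorname{End}E)$ be the unique form such that $\mathbf d_\nabla^{2l}$ is the operator $\eta\mapsto R_\nabla^l\wedge\eta$. The classical $A$-Pontryagin characters of $E$ are $\sigma^l_A(E)=[\operatorname{tr}(R_\nabla^l)]\in H^{2l}(A)$, $l\ge1$. A connection up to homotopy of $A$ on $\underline E$ is an $\mathbb R$-linear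 operator $\mathcal D$ on $\Omega(A,\underline E)$ which raises the total degree by $1$ and satisfies $\mathcal D(\omega\wedge\eta)=\mathbf d_A\omega\wedge\eta+(-1)^{|\omega|}\omega\wedge\mathcal D\eta$ for $\omega\in\Omega^\bullet(A)$. Let $R_{\mathcal D}^l\in\Omega(A,\underline{\operatorname{End}}(\underline E))_{2l}$ be the unique form whose associated $\Omega^\bullet(A)$-linear operator is $\mathcal D^{2l}$; here the operator associated with $K\in\Omega^i(A,\operatorname{Hom}(E_z,E_j))$ sends $\eta\in\Omega^s(A,E_z)$ to $(-1)^{(j-z)s}K\wedge\eta$ and vanishes on $\Omega^\bullet(A,E_y)$ for $y\neq z$. The graded trace $\operatorname{gtr}$ is $(-1)^z\operatorname{tr}$ on $\Omega^\bullet(A,\operatorname{End}(E_z))$ and $0$ on $\Omega^\bullet(A,\operatorname{Hom}(E_z,E_j))$ for $j\ne z$. The $A$-Pontryagin characters of $\underline E$ are $\sigma_A^l(\underline E)=[\operatorname{gtr}(R_{\mathcal D}^l)]\in H^{2l}(A)$, $l\ge1$. Then, for every $l\geq 1$, connections $\nabla$ on the $E_z$ and $\mathcal D$ on $\underline E$ exist,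 the forms $R_\nabla^l$ and $R_{\mathcal D}^l$ exist and are unique, the forms $\operatorname{tr}(R_\nabla^l)$ and $\operatorname{gtr}(R_{\mathcal D}^l)$ are $\mathbf d_A$-closed, the classes $\sigma_A^l(E_z)$ and $\sigma_A^l(\underline E)$ do not depend on the choice of $\nabla$ and $\mathcal D$, and \[ \sigma_A^l(\underline E)=\sum_{z\in\mathbb Z}(-1)^z\,\sigma_A^l(E_z)\quad\in H^{2l}(A). \] -/

import Mathlib

open scoped Manifold ContDiff DirectSum TensorProduct

noncomputable section

open Bundle Function Fin

universe u v

section Bundles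

variable {EM : Type*} [NormedAddCommGroup EM] [NormedSpace ℝ EM] {H : Type*} [TopologicalSpace H]
  (I : ModelWithCorners ℝ EM H) (M : Type*) [TopologicalSpace M] [ChartedSpace H M]

/-- The algebra `C^∞(M)` of smooth real functions. -/
abbrev SmoothFun : Type _ := C^∞⟮I, M; 𝓘(ℝ, ℝ), ℝ⟯

/-- A smooth real vector bundle of finite rank over `M`: fibres `E x`, model fibre `F`. The last
two fields hold for every vector bundle; they are recorded only as instances for Mathlib's
hom-bundles. -/
structure SmoothVB where
  F : Type u
  E : M → Type v
  [normedF : NormedAddCommGroup F]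
  [spaceF : NormedSpace ℝ F]
  [finF : FiniteDimensional ℝ F]
  [topTotal : TopologicalSpace (TotalSpace F E)]
  [topE : ∀ x, TopologicalSpace (E x)]
  [groupE : ∀ x, AddCommGroup (E x)]
  [moduleE : ∀ x, Module ℝ (E x)]
  [fiberBundle : FiberBundle F E]
  [vectorBundle : VectorBundle ℝ F E]
  [smooth : ContMDiffVectorBundle ∞ F E I]
  [topGroupE : ∀ x, IsTopologicalAddGroup (E x)]
  [contSMulE : ∀ x, ContinuousSMul ℝ (E x)]

attribute [instance] SmoothVB.normedF SmoothVB.spaceF SmoothVB.finF SmoothVB.topTotal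
  SmoothVB.topE SmoothVB.groupE SmoothVB.moduleE SmoothVB.fiberBundle SmoothVB.vectorBundle
  SmoothVB.smooth SmoothVB.topGroupE SmoothVB.contSMulE

variable {I M}

namespace SmoothVB

/-- The space `Γ(E)` of smooth sections. -/
abbrev Sec (E : SmoothVB I M) : Type _ := Cₛ^∞⟮I; E.F, E.E⟯

/-- `Γ(E)` is a module over `C^∞(M)`, by pointwise multiplication. -/
instance instModuleSec (E : SmoothVB I M) : Module (SmoothFun I M) E.Sec where
  smul f s := ⟨fun x => f x • s x, f.contMDiff.smul_section s.contMDiff⟩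
  one_smul s := by ext x; exact one_smul ℝ (s x)
  mul_smul f g s := by ext x; exact mul_smul (f x) (g x) (s x)
  smul_zero f := by ext x; exact smul_zero (f x)
  smul_add f s t := by ext x; exact smul_add (f x) (s x) (t x)
  add_smul f g s := by ext x; exact add_smul (f x) (g x) (s x)
  zero_smul s := by ext x; exact zero_smul ℝ (s x)

theorem smul_sec_apply (E : SmoothVB I M) (f : SmoothFun I M) (s : E.Sec) (x : M) :
    (f • s) x = f x • s x := rfl

instance instIsScalarTowerSec (E : SmoothVB I M) : IsScalarTower ℝ (SmoothFun I M) E.Sec where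
  smul_assoc c f s := by ext x; exact mul_smul c (f x) (s x)

/-- The bundle `Hom(E, E')`. -/
def hom (E : SmoothVB I M) (E' : SmoothVB I M) : SmoothVB I M where
  F := E.F →L[ℝ] E'.F
  E := fun x => E.E x →L[ℝ] E'.E x

/-- The evaluation pairing `Γ(Hom(E, E')) × Γ(E) → Γ(E')`. -/
def homEval (E : SmoothVB I M) (E' : SmoothVB I M) :
    (E.hom E').Sec →ₗ[SmoothFun I M] E.Sec →ₗ[SmoothFun I M] E'.Sec :=
  LinearMap.mk₂ (SmoothFun I M)
    (fun φ s => ⟨fun x => (show E.E x →L[ℝ] E'.E x from φ x) (s x),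
      ContMDiff.clm_bundle_apply (F₁ := E.F) (F₂ := E'.F) (E₁ := E.E) (E₂ := E'.E)
        (b := fun x : M => x) φ.contMDiff s.contMDiff⟩)
    (fun φ ψ s => by ext x; rfl)
    (fun f φ s => by ext x; rfl)
    (fun φ s t => by ext x; exact map_add (show E.E x →L[ℝ] E'.E x from φ x) (s x) (t x))
    (fun f φ s => by ext x; exact map_smul (show E.E x →L[ℝ] E'.E x from φ x) (f x) (s x))

/-- The fibrewise trace `tr : Γ(End(E)) → C^∞(M)`. -/
def trace (E : SmoothVB I M) : (E.hom E).Sec →ₗ[SmoothFun I M] SmoothFun I M where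
  toFun φ := ⟨fun x => LinearMap.trace ℝ (E.E x) (show E.E x →L[ℝ] E.E x from φ x), by
    intro x₀
    have h := ((contMDiffAt_hom_bundle (F₁ := E.F) (F₂ := E.F) (E₁ := E.E) (E₂ := E.E) _).1
      (φ.contMDiff x₀)).2
    have htr : ContMDiff 𝓘(ℝ, E.F →L[ℝ] E.F) 𝓘(ℝ, ℝ) ∞ (fun T : E.F →L[ℝ] E.F =>
        LinearMap.trace ℝ E.F (T : E.F →ₗ[ℝ] E.F)) :=
      (LinearMap.toContinuousLinearMap ((LinearMap.trace ℝ E.F).comp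
        (ContinuousLinearMap.coeLM ℝ))).contMDiff
    refine (htr.contMDiffAt.comp x₀ h).congr_of_eventuallyEq ?_
    filter_upwards [(trivializationAt E.F E.E x₀).open_baseSet.mem_nhds
      (FiberBundle.mem_baseSet_trivializationAt' x₀)] with x hx
    let e := (trivializationAt E.F E.E x₀).continuousLinearEquivAt ℝ x hx
    have hc : ContinuousLinearMap.inCoordinates E.F E.E E.F E.E x₀ x x₀ x
        (show E.E x →L[ℝ] E.E x from φ x) =
        (e : E.E x →L[ℝ] E.F) ∘L (show E.E x →L[ℝ] E.E x from φ x) ∘L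
          (e.symm : E.F →L[ℝ] E.E x) :=
      ContinuousLinearMap.inCoordinates_eq hx hx
    change _ = LinearMap.trace ℝ E.F (ContinuousLinearMap.inCoordinates E.F E.E E.F E.E x₀ x x₀ x
        (show E.E x →L[ℝ] E.E x from φ x) : E.F →ₗ[ℝ] E.F)
    rw [hc]
    exact (LinearMap.trace_conj' _ e.toLinearEquiv).symm⟩
  map_add' φ ψ := by
    ext x
    exact map_add (LinearMap.trace ℝ (E.E x)) _ _
  map_smul' f φ := by
    ext x
    exact map_smul (LinearMap.trace ℝ (E.E x)) (f x) _

variable (I M) in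
/-- The tangent bundle. -/
def tangent [FiniteDimensional ℝ EM] [IsManifold I ∞ M] : SmoothVB I M :=
  haveI : IsManifold I 1 M := .of_le (n := ∞) (by simp)
  { F := EM, E := TangentSpace I }

end SmoothVB

/-- The derivative `X(f)` of a smooth function along a smooth vector field. -/
def vectorFieldDeriv [FiniteDimensional ℝ EM] [IsManifold I ∞ M]
    (X : (SmoothVB.tangent I M).Sec) (f : SmoothFun I M) : SmoothFun I M :=
  ⟨fun x => mfderiv I 𝓘(ℝ, ℝ) f x (show TangentSpace I x from X x), by
    have hf : ContMDiff I.tangent 𝓘(ℝ, ℝ).tangent ∞ (tangentMap I 𝓘(ℝ, ℝ) f) :=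
      f.contMDiff.contMDiff_tangentMap le_rfl
    exact (contMDiff_snd_tangentBundle_modelSpace ℝ 𝓘(ℝ, ℝ)).comp (hf.comp X.contMDiff)⟩

end Bundles

section Algebra

variable (R L N : Type*) [CommRing R] [Algebra ℝ R] [LieRing L] [Module R L] [LieRingModule L R]
  [LieRinehartRing R L] [LieAlgebra ℝ L] [LieRinehartAlgebra ℝ R L]
  [AddCommGroup N] [Module R N] [Module ℝ N] [IsScalarTower ℝ R N]

/-- An `L`-connection on the `R`-module `N`: an `R`-linear assignment `a ↦ ∇ₐ` with
`∇ₐ(f e) = f ∇ₐ e + a(f) e`. -/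
structure LRConnection where
  cov : L →ₗ[R] N →ₗ[ℝ] N
  leibniz : ∀ (a : L) (f : R) (e : N), cov a (f • e) = f • cov a e + ⁅a, f⁆ • e

/-- The canonical flat connection `∇ₐ f = a(f)` on `R`. -/
def LRConnection.flat : LRConnection R L R where
  cov := LinearMap.mk₂' R ℝ (fun a f => ⁅a, f⁆)
    (fun a b f => add_lie a b f) (fun r a f => LieRinehartRing.lie_smul_eq_mul r f a)
    (fun a f g => lie_add a f g) (fun c a f => lie_smul c a f)
  leibniz a f e := by
    change ⁅a, f * e⁆ = f * ⁅a, e⁆ + ⁅a, f⁆ * e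
    exact LieRinehartRing.leibniz_mul_right a f e

variable {R L N}

namespace LRConnection

variable (D : LRConnection R L N)

/-- The bracket part `∑_{i<j} (-1)^{i+j} θ([v_i, v_j], v_0, …, v̂_i, …, v̂_j, …)` of the Koszul
formula. The pair `(i, j)` with `i ≤ j` in the sum stands for the positions `i < j + 1`, whence the
global sign. -/
def bracketPart : {k : ℕ} → (L [⋀^Fin k]→ₗ[R] N) → (Fin (k + 1) → L) → N
  | 0, _, _ => 0
  | m + 1, θ, v => -∑ i : Fin (m + 1), ∑ j ∈ Finset.Ici i, (-1 : ℤ) ^ (i + j : ℕ) •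
      θ (Matrix.vecCons ⁅v i.castSucc, v j.succ⁆ (j.removeNth (i.castSucc.removeNth v)))

/-- The Koszul formula
`∑_i (-1)^i ∇_{v_i} (θ(v_0, …, v̂_i, …)) + ∑_{i<j} (-1)^{i+j} θ([v_i, v_j], …, v̂_i, …, v̂_j, …)`. -/
def koszul {k : ℕ} (θ : L [⋀^Fin k]→ₗ[R] N) (v : Fin (k + 1) → L) : N :=
  ∑ i : Fin (k + 1), (-1 : ℤ) ^ (i : ℕ) • D.cov (v i) (θ (i.removeNth v)) + bracketPart θ v

/-- `θ` as a form over `ℝ`. -/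
def realForm {k : ℕ} (θ : L [⋀^Fin k]→ₗ[R] N) : L [⋀^Fin k]→ₗ[ℝ] N :=
  { θ.toMultilinearMap.restrictScalars ℝ with
    map_eq_zero_of_eq' := fun v _ _ h hij => θ.map_eq_zero_of_eq v h hij }

theorem realForm_apply {k : ℕ} (θ : L [⋀^Fin k]→ₗ[R] N) (v : Fin k → L) :
    realForm θ v = θ v := rfl

/-- The bracket part is an alternating map over `ℝ`. -/
theorem exists_bracketPart {k : ℕ} (θ : L [⋀^Fin k]→ₗ[R] N) :
    ∃ W : L [⋀^Fin (k + 1)]→ₗ[ℝ] N, ∀ v, W v = bracketPart θ v := by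
  cases k with
  | zero => exact ⟨0, fun v => rfl⟩
  | succ m =>
    let g : L →ₗ[ℝ] L →ₗ[ℝ] L [⋀^Fin m]→ₗ[ℝ] N :=
      LinearMap.mk₂ ℝ (fun a b => (realForm θ).curryLeft ⁅a, b⁆)
        (fun a a' b => by rw [add_lie, map_add]) (fun c a b => by rw [smul_lie, map_smul])
        (fun a b b' => by rw [lie_add, map_add]) (fun c a b => by rw [lie_smul, map_smul])
    refine ⟨-((2 : ℝ)⁻¹ • AlternatingMap.alternatizeUncurryFin
      (AlternatingMap.alternatizeUncurryFinLM ∘ₗ g)), fun v => ?_⟩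
    rw [AlternatingMap.neg_apply, AlternatingMap.smul_apply,
      AlternatingMap.alternatizeUncurryFin_alternatizeUncurryFinLM_comp_apply, bracketPart,
      Finset.smul_sum]
    congr 1
    refine Finset.sum_congr rfl fun i _ => ?_
    rw [Finset.smul_sum]
    refine Finset.sum_congr rfl fun j _ => ?_
    rw [smul_comm]
    congr 1
    change (2 : ℝ)⁻¹ • (θ (Matrix.vecCons ⁅v i.castSucc, v j.succ⁆ _)
      - θ (Matrix.vecCons ⁅v j.succ, v i.castSucc⁆ _)) = _
    rw [← lie_skew (v j.succ) (v i.castSucc)]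
    have hneg : ∀ (x : L) (w : Fin m → L), θ (Matrix.vecCons (-x) w) = -θ (Matrix.vecCons x w) := by
      intro x w
      have := ((realForm θ).curryLeft).map_neg x
      exact congrArg (fun t => t w) this
    rw [hneg, sub_neg_eq_add, ← two_smul ℝ, smul_smul]
    norm_num

theorem exists_koszul {k : ℕ} (θ : L [⋀^Fin k]→ₗ[R] N) :
    ∃ W : L [⋀^Fin (k + 1)]→ₗ[ℝ] N, ∀ v, W v = D.koszul θ v := by
  obtain ⟨W, hW⟩ := exists_bracketPart θ
  let g : L →ₗ[ℝ] L [⋀^Fin k]→ₗ[ℝ] N :=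
    { toFun := fun a => (D.cov a).compAlternatingMap (realForm θ)
      map_add' := fun a b => by ext v; simp
      map_smul' := fun c a => by
        ext v
        change D.cov (c • a) (θ v) = c • D.cov a (θ v)
        rw [← algebraMap_smul R c a, map_smul, LinearMap.smul_apply, algebraMap_smul] }
  refine ⟨AlternatingMap.alternatizeUncurryFin g + W, fun v => ?_⟩
  rw [AlternatingMap.add_apply, hW, AlternatingMap.alternatizeUncurryFin_apply]
  rfl

/-- `R`-homogeneity in the first slot. -/
theorem koszul_smul_zero {k : ℕ} (θ : L [⋀^Fin k]→ₗ[R] N) (f : R) (a : L) (w : Fin k → L) :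
    D.koszul θ (cons (f • a) w : Fin (k + 1) → L) = f • D.koszul θ (cons a w : Fin (k + 1) → L) := by
  have hcons : ∀ {m : ℕ} (η : L [⋀^Fin (m + 1)]→ₗ[R] N) (g : R) (x : L) (u : Fin m → L),
      η (cons (g • x) u : Fin (m + 1) → L) = g • η (cons x u : Fin (m + 1) → L) := by
    intro m η g x u
    exact congrArg (fun t => t u) (η.curryLeft.map_smul g x)
  have hcons_add : ∀ {m : ℕ} (η : L [⋀^Fin (m + 1)]→ₗ[R] N) (x y : L) (u : Fin m → L),
      η (cons (x + y) u : Fin (m + 1) → L) =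
        η (cons x u : Fin (m + 1) → L) + η (cons y u : Fin (m + 1) → L) := by
    intro m η x y u
    exact congrArg (fun t => t u) (η.curryLeft.map_add x y)
  have hrem : ∀ {m : ℕ} (x : L) (u : Fin (m + 1) → L) (i : Fin (m + 1)),
      i.succ.removeNth (cons x u : Fin (m + 2) → L) =
        (cons x (i.removeNth u) : Fin (m + 1) → L) := by
    intro m x u i
    ext j
    refine Fin.cases ?_ (fun j => ?_) j <;> simp [Fin.removeNth]
  cases k with
  | zero => simp [koszul, bracketPart, Fin.removeNth_zero]
  | succ m =>
    have h1 : ∀ i : Fin (m + 1), D.cov (w i) (θ (cons (f • a) (i.removeNth w) : Fin (m + 1) → L)) =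
        f • D.cov (w i) (θ (cons a (i.removeNth w) : Fin (m + 1) → L)) +
          ⁅w i, f⁆ • θ (cons a (i.removeNth w) : Fin (m + 1) → L) := by
      intro i
      rw [hcons, D.leibniz]
    have h2 : ∀ i : Fin (m + 1), θ (cons ⁅f • a, w i⁆ (i.removeNth w) : Fin (m + 1) → L) =
        f • θ (cons ⁅a, w i⁆ (i.removeNth w) : Fin (m + 1) → L) -
          ⁅w i, f⁆ • θ (cons a (i.removeNth w) : Fin (m + 1) → L) := by
      intro i
      have h : ⁅f • a, w i⁆ = f • ⁅a, w i⁆ + (-⁅w i, f⁆) • a := by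
        rw [← lie_skew, LieRinehartRing.leibniz_smul_right, ← lie_skew a (w i), smul_neg, neg_smul,
          neg_add]
      rw [h, hcons_add, hcons, hcons, neg_smul, sub_eq_add_neg]
    have h3 : ∀ (i : Fin m) (j : Fin (m + 1)), j ∈ Finset.Ici i.succ →
        θ (Matrix.vecCons ⁅w i.castSucc, w j⁆ (j.removeNth
          (i.castSucc.succ.removeNth (cons (f • a) w : Fin (m + 2) → L)))) =
        f • θ (Matrix.vecCons ⁅w i.castSucc, w j⁆ (j.removeNth
          (i.castSucc.succ.removeNth (cons a w : Fin (m + 2) → L)))) := by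
      intro i j hj
      obtain ⟨j, rfl⟩ : ∃ j', j = succ j' := Fin.exists_succ_eq.2 (by
        rintro rfl
        simp at hj) |>.imp fun _ h => h.symm
      obtain ⟨m, rfl⟩ : ∃ m', m = m' + 1 := ⟨m - 1, by have := i.pos; omega⟩
      rw [hrem, hrem, hrem, hrem]
      have hz : ∀ x : L, (Matrix.vecCons ⁅w i.castSucc, w j.succ⁆
          (cons x (j.removeNth (i.castSucc.removeNth w)) : Fin (m + 1) → L)) =
          update (Matrix.vecCons ⁅w i.castSucc, w j.succ⁆
          (cons 0 (j.removeNth (i.castSucc.removeNth w)) : Fin (m + 1) → L)) 1 x := by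
        intro x
        ext l
        refine Fin.cases ?_ (fun l => ?_) l
        · simp
        · refine Fin.cases ?_ (fun l => ?_) l
          · simp
          · rw [update_of_ne (by simp [Fin.ext_iff])]
            simp
      rw [hz, hz a, θ.map_update_smul]
    have hK : ∀ x : L, D.koszul θ (cons x w : Fin (m + 2) → L) = D.cov x (θ w) +
        ∑ i : Fin (m + 1), (-1 : ℤ) ^ (i + 1 : ℕ) •
          D.cov (w i) (θ (cons x (i.removeNth w) : Fin (m + 1) → L)) -
        (∑ j : Fin (m + 1), (-1 : ℤ) ^ (j : ℕ) •
            θ (cons ⁅x, w j⁆ (j.removeNth w) : Fin (m + 1) → L) +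
          ∑ i : Fin m, ∑ j ∈ Finset.Ici i.succ, (-1 : ℤ) ^ (i + 1 + j : ℕ) •
            θ (Matrix.vecCons ⁅w i.castSucc, w j⁆ (j.removeNth
              (i.castSucc.succ.removeNth (cons x w : Fin (m + 2) → L))))) := by
      intro x
      have hI : Finset.Ici (0 : Fin (m + 1)) = Finset.univ := by ext; simp
      simp only [koszul, bracketPart]
      rw [Fin.sum_univ_succ, Fin.sum_univ_succ (n := m) (f := fun i => ∑ j ∈ Finset.Ici i, _), hI,
        sub_eq_add_neg]
      simp only [hrem, Fin.removeNth_zero, cons_succ, Fin.castSucc_zero, ← Fin.succ_castSucc]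
      simp [Matrix.vecCons]
    rw [hK, hK]
    simp only [h1, h2, D.cov.map_smul, LinearMap.smul_apply]
    rw [Finset.sum_congr rfl fun (i : Fin m) _ => Finset.sum_congr rfl fun (j : Fin (m + 1)) hj =>
      congrArg (fun t => (-1 : ℤ) ^ (i + 1 + j : ℕ) • t) (h3 i j hj)]
    simp only [smul_sub, smul_add, smul_neg, Finset.smul_sum, Finset.sum_add_distrib, Finset.sum_sub_distrib,
      smul_comm f ((-1 : ℤ) ^ _), pow_succ, mul_neg, mul_one, neg_smul, Finset.sum_neg_distrib]
    abel

/-- The covariant exterior derivative `d_∇ : Ω^k → Ω^{k+1}`, given by the Koszul formula. -/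
def d {k : ℕ} : (L [⋀^Fin k]→ₗ[R] N) →ₗ[ℝ] (L [⋀^Fin (k + 1)]→ₗ[R] N) where
  toFun θ :=
    { toFun := D.koszul θ
      map_update_add' := by
        intro hdec v i x y
        obtain ⟨W, hW⟩ := D.exists_koszul θ
        simp only [← hW]
        convert W.map_update_add v i x y
      map_update_smul' := by
        intro hdec v i f x
        obtain rfl : hdec = instDecidableEqFin _ := Subsingleton.elim _ _
        obtain ⟨W, hW⟩ := D.exists_koszul θ
        have key : ∀ y : L, D.koszul θ (update v i y) =
            Equiv.Perm.sign (Equiv.swap 0 i) •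
              D.koszul θ (cons y (tail (v ∘ Equiv.swap 0 i)) : Fin (k + 1) → L) := by
          intro y
          have h := W.map_perm (update v i y) (Equiv.swap 0 i)
          rw [update_comp_equiv, Equiv.symm_swap, Equiv.swap_apply_right] at h
          have h' : update (v ∘ Equiv.swap 0 i) 0 y =
              (cons y (tail (v ∘ Equiv.swap 0 i)) : Fin (k + 1) → L) := by
            rw [← Fin.update_cons_zero ((v ∘ Equiv.swap 0 i) 0), Fin.cons_self_tail]
          rw [← hW, ← hW, ← h', h, smul_smul, Int.units_mul_self, one_smul]
        rw [key, key, koszul_smul_zero, smul_comm]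
      map_eq_zero_of_eq' := by
        intro v i j h hij
        obtain ⟨W, hW⟩ := D.exists_koszul θ
        rw [← hW]
        exact W.map_eq_zero_of_eq v h hij }
  map_add' θ η := by
    ext v
    change D.koszul (θ + η) v = D.koszul θ v + D.koszul η v
    have h : bracketPart (θ + η) v = bracketPart θ v + bracketPart η v := by
      cases k with
      | zero => exact (add_zero 0).symm
      | succ m =>
        simp only [bracketPart, AlternatingMap.add_apply, smul_add, Finset.sum_add_distrib, neg_add]
    simp only [koszul, h, AlternatingMap.add_apply, map_add, smul_add, Finset.sum_add_distrib]
    abel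
  map_smul' c θ := by
    ext v
    change D.koszul (c • θ) v = c • D.koszul θ v
    have h : bracketPart (c • θ) v = c • bracketPart θ v := by
      cases k with
      | zero => exact (smul_zero c).symm
      | succ m =>
        simp only [bracketPart, AlternatingMap.smul_apply, smul_neg, Finset.smul_sum,
          smul_comm c ((-1 : ℤ) ^ _)]
    simp only [koszul, h, AlternatingMap.smul_apply, map_smul, smul_add, Finset.smul_sum,
      smul_comm c ((-1 : ℤ) ^ _)]

/-- `d_∇` on `Ω^•(L, N) = ⨁ₖ Ω^k(L, N)`. -/
def dTotal : (⨁ k : ℕ, L [⋀^Fin k]→ₗ[R] N) →ₗ[ℝ] ⨁ k : ℕ, L [⋀^Fin k]→ₗ[R] N :=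
  DirectSum.toModule ℝ ℕ _ fun k =>
    DirectSum.lof ℝ ℕ (fun k => L [⋀^Fin k]→ₗ[R] N) (k + 1) ∘ₗ D.d

end LRConnection

section Wedge

variable {N₁ N₂ N₃ : Type*}
  [AddCommGroup N₁] [Module R N₁] [Module ℝ N₁] [IsScalarTower ℝ R N₁]
  [AddCommGroup N₂] [Module R N₂] [Module ℝ N₂] [IsScalarTower ℝ R N₂]
  [AddCommGroup N₃] [Module R N₃] [Module ℝ N₃] [IsScalarTower ℝ R N₃]

/-- The wedge product along a pairing `B`, i.e. the sum over `(k,s)`-shuffles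
`(α ∧ β)(a_1, …) = ∑_σ sgn(σ) B(α(a_{σ(1)}, …, a_{σ(k)}), β(a_{σ(k+1)}, …))`. -/
def wedge (B : N₁ →ₗ[R] N₂ →ₗ[R] N₃) (k s : ℕ) :
    (L [⋀^Fin k]→ₗ[R] N₁) →ₗ[ℝ] (L [⋀^Fin s]→ₗ[R] N₂) →ₗ[ℝ] (L [⋀^Fin (k + s)]→ₗ[R] N₃) :=
  LinearMap.mk₂ ℝ
    (fun α β => ((TensorProduct.lift B).compAlternatingMap
      (AlternatingMap.domCoprod' (α ⊗ₜ[R] β))).domDomCongr finSumFinEquiv)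
    (fun α α' β => by ext v; simp [TensorProduct.add_tmul])
    (fun c α β => by
      ext v
      rw [show c • α = algebraMap ℝ R c • α by ext; simp, ← TensorProduct.smul_tmul', map_smul]
      simp)
    (fun α β β' => by ext v; simp [TensorProduct.tmul_add])
    (fun c α β => by
      ext v
      rw [show c • β = algebraMap ℝ R c • β by ext; simp, TensorProduct.tmul_smul, map_smul]
      simp)

/-- The wedge product on total spaces of forms, with the Koszul sign `(-1)^{p s}` on
`Ω^k(L, N₁) × Ω^s(L, N₂)`, where `p` is the degree carried by the coefficients `N₁`. -/
def totalWedge (p : ℤ) (B : N₁ →ₗ[R] N₂ →ₗ[R] N₃) :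
    (⨁ k : ℕ, L [⋀^Fin k]→ₗ[R] N₁) →ₗ[ℝ] (⨁ s : ℕ, L [⋀^Fin s]→ₗ[R] N₂) →ₗ[ℝ]
      ⨁ k : ℕ, L [⋀^Fin k]→ₗ[R] N₃ :=
  DirectSum.toModule ℝ ℕ _ fun k => LinearMap.flip (DirectSum.toModule ℝ ℕ _ fun s =>
    (-1 : ℝ) ^ (p * s) • LinearMap.flip ((wedge B k s).compr₂
      (DirectSum.lof ℝ ℕ (fun k => L [⋀^Fin k]→ₗ[R] N₃) (k + s))))

end Wedge

section Cohomology

variable (R L)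

/-- Closed `k`-forms. -/
def closedForms (k : ℕ) : Submodule ℝ (L [⋀^Fin k]→ₗ[R] R) :=
  LinearMap.ker (LRConnection.flat R L).d

/-- Exact `k`-forms: those `θ` with `θ = d η` in `Ω^•`. -/
def exactForms (k : ℕ) : Submodule ℝ (L [⋀^Fin k]→ₗ[R] R) :=
  (LinearMap.range (LRConnection.flat R L).dTotal).comap
    (DirectSum.lof ℝ ℕ (fun k => L [⋀^Fin k]→ₗ[R] R) k)

/-- `H^k = {closed k-forms} / {exact k-forms}`, as the space of classes of closed forms in
`Ω^k / {exact k-forms}`. -/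
abbrev Cohomology (k : ℕ) : Type _ :=
  (closedForms R L k).map (exactForms R L k).mkQ

variable {R L}

open Classical in
/-- The class in `H^k` of a closed form (and `0` for forms that are not closed). -/
def cohomologyClass {k : ℕ} (θ : L [⋀^Fin k]→ₗ[R] R) : Cohomology R L k :=
  if h : θ ∈ closedForms R L k then
    ⟨(exactForms R L k).mkQ θ, Submodule.mem_map_of_mem h⟩
  else 0

end Cohomology
end Algebra

section Geometry

variable {EM : Type*} [NormedAddCommGroup EM] [NormedSpace ℝ EM] [FiniteDimensional ℝ EM]
  {H : Type*} [TopologicalSpace H] {I : ModelWithCorners ℝ EM H}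
  {M : Type*} [TopologicalSpace M] [ChartedSpace H M] [IsManifold I ∞ M]

/-- A Lie algebroid structure on the vector bundle `A`: a smooth bundle map `ρ : A → TM` (the
anchor) and a Lie bracket on `Γ(A)` such that `[a, f b] = f [a, b] + ρ(a)(f) b` and
`ρ([a, b]) = [ρ(a), ρ(b)]` as derivations. -/
structure LieAlgebroid (A : SmoothVB I M) where
  anchor : (A.hom (SmoothVB.tangent I M)).Sec
  bracket : A.Sec →ₗ[ℝ] A.Sec →ₗ[ℝ] A.Sec
  bracket_self : ∀ a, bracket a a = 0
  jacobi : ∀ a b c, bracket a (bracket b c) = bracket (bracket a b) c + bracket b (bracket a c)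
  leibniz : ∀ (a : A.Sec) (f : SmoothFun I M) (b : A.Sec),
    bracket a (f • b) = f • bracket a b + vectorFieldDeriv (SmoothVB.homEval _ _ anchor a) f • b
  anchor_bracket : ∀ (a b : A.Sec) (f : SmoothFun I M),
    vectorFieldDeriv (SmoothVB.homEval _ _ anchor (bracket a b)) f =
      vectorFieldDeriv (SmoothVB.homEval _ _ anchor a)
          (vectorFieldDeriv (SmoothVB.homEval _ _ anchor b) f) -
        vectorFieldDeriv (SmoothVB.homEval _ _ anchor b)
          (vectorFieldDeriv (SmoothVB.homEval _ _ anchor a) f)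

theorem vectorFieldDeriv_add_left (X Y : (SmoothVB.tangent I M).Sec) (f : SmoothFun I M) :
    vectorFieldDeriv (X + Y) f = vectorFieldDeriv X f + vectorFieldDeriv Y f := by
  ext x
  exact map_add (mfderiv I 𝓘(ℝ, ℝ) f x) (show TangentSpace I x from X x)
    (show TangentSpace I x from Y x)

theorem vectorFieldDeriv_smul_left (g : SmoothFun I M) (X : (SmoothVB.tangent I M).Sec)
    (f : SmoothFun I M) : vectorFieldDeriv (g • X) f = g * vectorFieldDeriv X f := by
  ext x
  exact map_smul (mfderiv I 𝓘(ℝ, ℝ) f x) (g x) (show TangentSpace I x from X x)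

theorem vectorFieldDeriv_add_right (X : (SmoothVB.tangent I M).Sec) (f g : SmoothFun I M) :
    vectorFieldDeriv X (f + g) = vectorFieldDeriv X f + vectorFieldDeriv X g := by
  ext x
  have h := mfderiv_add (f.contMDiff.mdifferentiable (by simp) x)
    (g.contMDiff.mdifferentiable (by simp) x)
  exact congrArg (fun T => T (show TangentSpace I x from X x)) h

theorem vectorFieldDeriv_mul_right (X : (SmoothVB.tangent I M).Sec) (f g : SmoothFun I M) :
    vectorFieldDeriv X (f * g) = f * vectorFieldDeriv X g + vectorFieldDeriv X f * g := by
  ext x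
  have h := ((f.contMDiff.mdifferentiable (by simp) x).hasMFDerivAt.mul
    (g.contMDiff.mdifferentiable (by simp) x).hasMFDerivAt).mfderiv
  have h' := congrArg (fun T => T (show TangentSpace I x from X x)) h
  refine h'.trans ?_
  change f x * _ + g x * _ = f x * _ + _ * g x
  rw [mul_comm (g x)]
  rfl

theorem vectorFieldDeriv_smul_right (c : ℝ) (X : (SmoothVB.tangent I M).Sec) (f : SmoothFun I M) :
    vectorFieldDeriv X (c • f) = c • vectorFieldDeriv X f := by
  ext x
  have h := const_smul_mfderiv (f.contMDiff.mdifferentiable (by simp) x) c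
  exact congrArg (fun T => T (show TangentSpace I x from X x)) h

namespace LieAlgebroid

variable {A : SmoothVB I M} (𝒜 : LieAlgebroid A)

/-- `ρ(a)(f)`. -/
def anchorDeriv (a : A.Sec) (f : SmoothFun I M) : SmoothFun I M :=
  vectorFieldDeriv (SmoothVB.homEval _ _ 𝒜.anchor a) f

theorem bracket_add_left (a b c : A.Sec) :
    𝒜.bracket (a + b) c = 𝒜.bracket a c + 𝒜.bracket b c := by
  rw [map_add]; rfl

theorem anchorDeriv_add (a b : A.Sec) (f : SmoothFun I M) :
    𝒜.anchorDeriv (a + b) f = 𝒜.anchorDeriv a f + 𝒜.anchorDeriv b f := by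
  simp only [anchorDeriv, map_add, vectorFieldDeriv_add_left]

theorem anchorDeriv_smul (g : SmoothFun I M) (a : A.Sec) (f : SmoothFun I M) :
    𝒜.anchorDeriv (g • a) f = g * 𝒜.anchorDeriv a f := by
  simp only [anchorDeriv, map_smul, vectorFieldDeriv_smul_left]

theorem anchorDeriv_real_smul (c : ℝ) (a : A.Sec) (f : SmoothFun I M) :
    𝒜.anchorDeriv (c • a) f = c • 𝒜.anchorDeriv a f := by
  rw [← algebraMap_smul (SmoothFun I M) c a, anchorDeriv_smul, Algebra.smul_def]

theorem anchorDeriv_bracket (a b : A.Sec) (f : SmoothFun I M) :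
    𝒜.anchorDeriv a (𝒜.anchorDeriv b f) =
      𝒜.anchorDeriv (𝒜.bracket a b) f + 𝒜.anchorDeriv b (𝒜.anchorDeriv a f) :=
  sub_eq_iff_eq_add.1 (𝒜.anchor_bracket a b f).symm

/-- The Lie algebra `Γ(A)` of sections of the Lie algebroid. -/
def Sec (_𝒜 : LieAlgebroid A) : Type _ := A.Sec

instance : AddCommGroup 𝒜.Sec := inferInstanceAs (AddCommGroup A.Sec)
instance : Module (SmoothFun I M) 𝒜.Sec := inferInstanceAs (Module (SmoothFun I M) A.Sec)
instance : Module ℝ 𝒜.Sec := inferInstanceAs (Module ℝ A.Sec)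
instance : IsScalarTower ℝ (SmoothFun I M) 𝒜.Sec :=
  inferInstanceAs (IsScalarTower ℝ (SmoothFun I M) A.Sec)

instance : LieRing 𝒜.Sec where
  bracket a b := 𝒜.bracket a b
  add_lie a b c := 𝒜.bracket_add_left a b c
  lie_add a b c := map_add (𝒜.bracket a) b c
  lie_self a := 𝒜.bracket_self a
  leibniz_lie a b c := 𝒜.jacobi a b c

instance : LieAlgebra ℝ 𝒜.Sec where
  lie_smul c a b := map_smul (𝒜.bracket a) c b

/-- `Γ(A)` acts on `C^∞(M)` by `⁅a, f⁆ = ρ(a)(f)`. -/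
instance : LieRingModule 𝒜.Sec (SmoothFun I M) where
  bracket a f := 𝒜.anchorDeriv a f
  add_lie a b f := 𝒜.anchorDeriv_add a b f
  lie_add _ f g := vectorFieldDeriv_add_right _ f g
  leibniz_lie a b f := 𝒜.anchorDeriv_bracket a b f

instance : LieModule ℝ 𝒜.Sec (SmoothFun I M) where
  smul_lie c a f := 𝒜.anchorDeriv_real_smul c a f
  lie_smul c _ f := vectorFieldDeriv_smul_right c _ f

instance : LieRinehartRing (SmoothFun I M) 𝒜.Sec where
  lie_smul_eq_mul' f g a := 𝒜.anchorDeriv_smul f a g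
  leibniz_mul_right' _ f g := vectorFieldDeriv_mul_right _ f g
  leibniz_smul_right' a b f := 𝒜.leibniz a f b

instance : LieRinehartAlgebra ℝ (SmoothFun I M) 𝒜.Sec where

/-- `Ω^k(A, N)` for a module `N` of sections: `Γ(∧^k A^* ⊗ E)`, viewed as the alternating
`C^∞(M)`-multilinear maps `Γ(A)^k → Γ(E)`, for `N = Γ(E)`, and `Ω^k(A)` for `N = C^∞(M)`. -/
abbrev Form (N : Type*) [AddCommGroup N] [Module (SmoothFun I M) N] (k : ℕ) : Type _ :=
  𝒜.Sec [⋀^Fin k]→ₗ[SmoothFun I M] N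

/-- `Ω^•(A, N) = ⨁ₖ Ω^k(A, N)`. -/
abbrev Forms (N : Type*) [AddCommGroup N] [Module (SmoothFun I M) N] : Type _ :=
  ⨁ k : ℕ, 𝒜.Form N k

/-- The Lie algebroid cohomology `H^k(A)`. -/
abbrev Coh (k : ℕ) : Type _ := Cohomology (SmoothFun I M) 𝒜.Sec k

/-- `d_A : Ω^k(A) → Ω^{k+1}(A)`. -/
abbrev dA {k : ℕ} : 𝒜.Form (SmoothFun I M) k →ₗ[ℝ] 𝒜.Form (SmoothFun I M) (k + 1) :=
  (LRConnection.flat (SmoothFun I M) 𝒜.Sec).d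

/-- The trace `Ω^•(A, End(E)) → Ω^•(A)`. -/
def formTrace (E : SmoothVB I M) (k : ℕ) :
    𝒜.Form (E.hom E).Sec k →ₗ[ℝ] 𝒜.Form (SmoothFun I M) k where
  toFun K := E.trace.compAlternatingMap K
  map_add' K K' := E.trace.compAlternatingMap_add K K'
  map_smul' c K := by
    ext1 v
    change E.trace (c • K v) = c • E.trace (K v)
    rw [← algebraMap_smul (SmoothFun I M) c, map_smul, algebraMap_smul]

/-! ### Linear connections and classical Pontryagin characters -/

/-- Linear `A`-connections `∇ : Γ(A) × Γ(E) → Γ(E)`. -/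
abbrev Connection (E : SmoothVB I M) : Type _ := LRConnection (SmoothFun I M) 𝒜.Sec E.Sec

variable {𝒜}

namespace Connection

variable {E : SmoothVB I M} (D : 𝒜.Connection E)

/-- `K ∈ Ω^{2l}(A, End(E))` is the `l`-th power of the curvature: `K ∧ · = d_∇^{2l}`. -/
def IsCurvaturePower (l : ℕ) (K : 𝒜.Form (E.hom E).Sec (2 * l)) : Prop :=
  totalWedge 0 (SmoothVB.homEval E E)
    (DirectSum.lof ℝ ℕ (fun k => 𝒜.Form (E.hom E).Sec k) (2 * l) K) =
    (D.dTotal : Module.End ℝ (𝒜.Forms E.Sec)) ^ (2 * l)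

/-- The form `R_∇^l ∈ Ω^{2l}(A, End(E))`. -/
def curvaturePower (l : ℕ) : 𝒜.Form (E.hom E).Sec (2 * l) :=
  Classical.epsilon (D.IsCurvaturePower l)

/-- The form `tr(R_∇^l) ∈ Ω^{2l}(A)`. -/
def traceForm (l : ℕ) : 𝒜.Form (SmoothFun I M) (2 * l) :=
  𝒜.formTrace E (2 * l) (D.curvaturePower l)

/-- The class `[tr(R_∇^l)] ∈ H^{2l}(A)`. -/
def characterClass (l : ℕ) : 𝒜.Coh (2 * l) := cohomologyClass (D.traceForm l)

end Connection

open Classical in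
variable (𝒜) in
/-- The `l`-th `A`-Pontryagin character `σ_A^l(E) = [tr(R_∇^l)] ∈ H^{2l}(A)`, computed with some
linear `A`-connection `∇` on `E`. -/
def pontryaginCharacter (E : SmoothVB I M) (l : ℕ) : 𝒜.Coh (2 * l) :=
  if h : Nonempty (𝒜.Connection E) then Connection.characterClass h.some l else 0

/-! ### Graded vector bundles and connections up to homotopy

A graded vector bundle `⊕_z E_z[z]` is a family `E : ℤ → SmoothVB I M`. -/

variable (𝒜) in
/-- `Ω(A, E) = ⨁_z ⨁_s Ω^s(A, E_z)`. -/
abbrev GForms (E : ℤ → SmoothVB I M) : Type _ := ⨁ z : ℤ, 𝒜.Forms (E z).Sec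

variable (𝒜) in
/-- `Ω(A, End(E)) = ⨁_z ⨁_j ⨁_i Ω^i(A, Hom(E_z, E_j))`. -/
abbrev GEndForms (E : ℤ → SmoothVB I M) : Type _ :=
  ⨁ z : ℤ, ⨁ j : ℤ, 𝒜.Forms ((E z).hom (E j)).Sec

variable {E : ℤ → SmoothVB I M}

/-- `η ∈ Ω(A, E)_n`: elements of `Ω^s(A, E_z)` have total degree `s + z`. -/
def GForms.IsHomogeneous (η : 𝒜.GForms E) (n : ℤ) : Prop :=
  ∀ (z : ℤ) (s : ℕ), η z s ≠ 0 → (s : ℤ) + z = n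

/-- `K ∈ Ω(A, End(E))_n`: elements of `Ω^i(A, Hom(E_z, E_j))` have total degree `i + (j - z)`. -/
def GEndForms.IsHomogeneous (K : 𝒜.GEndForms E) (n : ℤ) : Prop :=
  ∀ (z j : ℤ) (i : ℕ), K z j i ≠ 0 → (i : ℤ) + (j - z) = n

variable (𝒜 E) in
/-- The left multiplication `η ↦ α ∧ η` of `Ω(A, E)` by scalar forms `α ∈ Ω^•(A)`. -/
def gWedge : 𝒜.Forms (SmoothFun I M) →ₗ[ℝ] Module.End ℝ (𝒜.GForms E) where
  toFun α := DirectSum.lmap fun z => totalWedge 0 (LinearMap.lsmul (SmoothFun I M) (E z).Sec) α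
  map_add' α β := by
    ext
    simp
  map_smul' c α := by
    ext
    simp

variable (𝒜 E) in
/-- The operator `K̂` on `Ω(A, E)` defined by `K ∈ Ω(A, End(E))`: for `K ∈ Ω^i(A, Hom(E_z, E_j))` and
`η ∈ Ω^s(A, E_z)` it is `K ∧ η`, with the Koszul sign `(-1)^{(j-z)s}` that makes `K̂` graded
`Ω^•(A)`-linear for the total degree; `K̂` vanishes on the other summands `Ω^s(A, E_y)`. -/
def hat : 𝒜.GEndForms E →ₗ[ℝ] Module.End ℝ (𝒜.GForms E) :=
  DirectSum.toModule ℝ ℤ _ fun z => DirectSum.toModule ℝ ℤ _ fun j =>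
    LinearMap.lcomp ℝ (𝒜.GForms E) (DirectSum.component ℝ ℤ (fun z => 𝒜.Forms (E z).Sec) z) ∘ₗ
      (totalWedge (j - z) (SmoothVB.homEval (E z) (E j))).compr₂
        (DirectSum.lof ℝ ℤ (fun z => 𝒜.Forms (E z).Sec) j)

variable (𝒜 E) in
/-- The graded trace `Ω(A, End(E)) → Ω^•(A)`: `(-1)^z tr` on `Ω^i(A, End(E_z))`, and zero on
`Ω^i(A, Hom(E_z, E_j))` for `j ≠ z`. -/
def gtr : 𝒜.GEndForms E →ₗ[ℝ] 𝒜.Forms (SmoothFun I M) :=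
  DirectSum.toModule ℝ ℤ _ fun z =>
    (-1 : ℝ) ^ z • (DirectSum.lmap fun k => 𝒜.formTrace (E z) k) ∘ₗ
      DirectSum.component ℝ ℤ (fun j => 𝒜.Forms ((E z).hom (E j)).Sec) z

variable (𝒜 E) in
/-- Connections up to homotopy of `A` on `⊕_z E_z[z]`: operators of total degree `1` on `Ω(A, E)`
with `𝒟(α ∧ η) = d_A α ∧ η + (-1)^{|α|} α ∧ 𝒟 η`. -/
structure HomotopyConnection where
  op : Module.End ℝ (𝒜.GForms E)
  degree : ∀ (n : ℤ) (η : 𝒜.GForms E), η.IsHomogeneous n → (op η).IsHomogeneous (n + 1)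
  leibniz : ∀ (k : ℕ) (α : 𝒜.Form (SmoothFun I M) k) (η : 𝒜.GForms E),
    op (𝒜.gWedge E (DirectSum.lof ℝ ℕ (𝒜.Form (SmoothFun I M)) k α) η) =
      𝒜.gWedge E (DirectSum.lof ℝ ℕ (𝒜.Form (SmoothFun I M)) (k + 1) (𝒜.dA α)) η +
        (-1 : ℝ) ^ k • 𝒜.gWedge E (DirectSum.lof ℝ ℕ (𝒜.Form (SmoothFun I M)) k α) (op η)

namespace HomotopyConnection

variable (D : 𝒜.HomotopyConnection E)

/-- `K ∈ Ω(A, End(E))_{2l}` is the `l`-th power of the curvature form: `K̂ = 𝒟^{2l}`. -/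
def IsCurvaturePower (l : ℕ) (K : 𝒜.GEndForms E) : Prop :=
  GEndForms.IsHomogeneous K (2 * l) ∧ 𝒜.hat E K = D.op ^ (2 * l)

/-- The form `R_𝒟^l ∈ Ω(A, End(E))_{2l}`. -/
def curvaturePower (l : ℕ) : 𝒜.GEndForms E := Classical.epsilon (D.IsCurvaturePower l)

/-- The form `gtr(R_𝒟^l) ∈ Ω^{2l}(A)`. -/
def traceForm (l : ℕ) : 𝒜.Form (SmoothFun I M) (2 * l) := 𝒜.gtr E (D.curvaturePower l) (2 * l)

/-- The class `[gtr(R_𝒟^l)] ∈ H^{2l}(A)`. -/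
def characterClass (l : ℕ) : 𝒜.Coh (2 * l) := cohomologyClass (D.traceForm l)

end HomotopyConnection

open Classical in
variable (𝒜) in
/-- The `l`-th `A`-Pontryagin character `σ_A^l(⊕_z E_z[z]) = [gtr(R_𝒟^l)] ∈ H^{2l}(A)`, computed with
some connection up to homotopy `𝒟` of `A` on `⊕_z E_z[z]`. -/
def gradedPontryaginCharacter (E : ℤ → SmoothVB I M) (l : ℕ) : 𝒜.Coh (2 * l) :=
  if h : Nonempty (𝒜.HomotopyConnection E) then HomotopyConnection.characterClass h.some l else 0

end LieAlgebroid

end Geometry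

end

noncomputable section

set_option linter.unusedSectionVars false

open Bundle Function Fin

/-! ### Sums over permutations, split by the position of one argument -/

section PermSums

/-! This is the Chern–Weil argument for superconnections. An operator on `Ω(A, E)` of total degree
`n` that is graded `Ω^•(A)`-linear is `hat` of a unique form (`IsTensorial.exists_hat`,
`hat_injective`), so such operators have a graded trace `str`. The square of a connection up to
homotopy `𝒟` is linear because `d_A² = 0`; hence `R_𝒟^l` exists and `gtr(R_𝒟^l) = str(𝒟^{2l})`.

Two facts carry the rest: `str` vanishes on graded commutators (`str_mul_comm`), and `str [𝒟, T] =
d_A (str T)` (`IsHomotopyConnection.str_commutator`). The second holds for `⊕ d_{∇_z}` because the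
trace intertwines the connection on `End(E_z)` with `d_A`, and extends to every `𝒟` by the first,
since `𝒟 - ⊕ d_{∇_z}` is linear. Taking `T = 𝒟^{2l}` gives closedness.

For independence, join two choices by a segment `𝒟_t = 𝒟 + tB`. The derivative of `𝒟_t^{2l}` is a
sum of terms `𝒟_t^{2i} [𝒟_t, B] 𝒟_t^{2m}`, and cyclicity turns the trace of each into `str [𝒟_t, B
𝒟_t^{2(i+m)}]`, which is exact. Instead of integrating a form, one applies a linear functional that
kills exact forms: the result is a real function of `t` with zero derivative, and such functionals
detect exactness (`cohomologyClass_eq`).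

The formula follows by computing with `⊕ d_{∇_z}`, whose curvature powers are block diagonal
(`sumConnection_op_pow`). Independence for the classical characters is deduced from the graded case
by varying one `∇_z` (`Connection.characterClass_eq`).

The identities between forms rest on the coinduction principle `TotalForms.eq_zero_of_mem`: a form
is zero once its degree `0` part and all its interior products are. The geometry enters through
frames multiplied by cut-off functions, which give tensoriality, traces and the existence of
connections. -/

theorem sum_perm_cons {L N : Type*} [AddCommGroup N] {n : ℕ} (f : (Fin (n + 1) → L) → N) (a : L)
    (u : Fin n → L) :
    ∑ σ : Equiv.Perm (Fin (n + 1)), Equiv.Perm.sign σ • f ((cons a u : Fin (n + 1) → L) ∘ σ) =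
      ∑ j : Fin (n + 1), (-1 : ℤ) ^ (j : ℕ) • ∑ τ : Equiv.Perm (Fin n),
        Equiv.Perm.sign τ • f (j.insertNth a (u ∘ τ)) := by
  have hE : ∀ τ : Equiv.Perm (Fin n), ((cons a u : Fin (n + 1) → L) ∘
      Equiv.Perm.decomposeFin.symm (0, τ)) = (cons a (u ∘ τ) : Fin (n + 1) → L) := by
    intro τ
    ext x
    refine Fin.cases ?_ (fun x => ?_) x <;> simp
  simp only [Finset.smul_sum]
  rw [← Fintype.sum_prod_type']
  symm
  -- A permutation `σ` amounts to the position `j = σ⁻¹ 0` taken by `a` and a permutation `τ` of the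
  -- other arguments. The cycle carrying `j` to `0` has sign `(-1)^j`.
  let F : Fin (n + 1) × Equiv.Perm (Fin n) → Equiv.Perm (Fin (n + 1)) :=
    fun p => Equiv.Perm.decomposeFin.symm (0, p.2) * p.1.cycleRange
  refine Fintype.sum_bijective F ?_ _ _ ?_
  · rw [Fintype.bijective_iff_injective_and_card]
    constructor
    · rintro ⟨j, τ⟩ ⟨j', τ'⟩ h
      have h0 : ∀ (j : Fin (n + 1)) (τ : Equiv.Perm (Fin n)), (F (j, τ)).symm 0 = j := by
        intro j τ
        rw [Equiv.symm_apply_eq]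
        simp [F]
      obtain rfl : j = j' := by rw [← h0 j τ, h, h0]
      have := mul_right_cancel h
      simpa using this
    · simp [Fintype.card_perm, Nat.factorial_succ]
  · rintro ⟨j, τ⟩
    simp only [F, Equiv.Perm.coe_mul, ← Function.comp_assoc, hE, map_mul,
      Fin.sign_cycleRange, Equiv.Perm.decomposeFin.symm_sign, cons_comp_cycleRange]
    simp only [if_true, one_mul, Units.smul_def, smul_smul]
    congr 1
    push_cast
    ring

end PermSums

/-! ### Interior products of wedge products of homogeneous forms -/

section Wedge

variable {R L : Type*} [CommRing R] [Algebra ℝ R] [LieRing L] [Module R L] [LieRingModule L R]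
  [LieRinehartRing R L] [LieAlgebra ℝ L] [LieRinehartAlgebra ℝ R L]
variable {N₁ N₂ N₃ : Type*}
  [AddCommGroup N₁] [Module R N₁] [Module ℝ N₁] [IsScalarTower ℝ R N₁]
  [AddCommGroup N₂] [Module R N₂] [Module ℝ N₂] [IsScalarTower ℝ R N₂]
  [AddCommGroup N₃] [Module R N₃] [Module ℝ N₃] [IsScalarTower ℝ R N₃]

/-- Each shuffle stands for a coset of `S_k × S_s`, of `k! s!` permutations with equal
contributions. The full sum avoids the quotient, and the factor can be cancelled over `ℝ`. -/
theorem factorial_smul_wedge_apply (B : N₁ →ₗ[R] N₂ →ₗ[R] N₃) {k s : ℕ} (α : L [⋀^Fin k]→ₗ[R] N₁)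
    (β : L [⋀^Fin s]→ₗ[R] N₂) (v : Fin (k + s) → L) :
    (k.factorial * s.factorial) • wedge B k s α β v =
      ∑ σ : Equiv.Perm (Fin (k + s)), Equiv.Perm.sign σ •
        B (α fun i => v (σ (castAdd s i))) (β fun j => v (σ (natAdd k j))) := by
  have h := MultilinearMap.domCoprod_alternization_eq α β
  have h2 := congrArg (fun T => (TensorProduct.lift B) (T (v ∘ finSumFinEquiv))) h
  simp only [Fintype.card_fin, MultilinearMap.alternatization_apply, AlternatingMap.smul_apply,
    map_sum, map_nsmul] at h2
  refine Eq.trans ?_ (h2.symm.trans ?_)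
  · rfl
  · refine Fintype.sum_equiv finSumFinEquiv.permCongr _ _ fun σ => ?_
    rw [Equiv.Perm.sign_permCongr]
    simp only [Units.smul_def, map_zsmul]
    congr 1
    simp [MultilinearMap.domCoprod_apply, MultilinearMap.domDomCongr_apply, Function.comp_def]

/-- The equation `h` keeps the total degree a free variable, so that degrees such as `k + 1 + s` can
be matched with `n + 1` by a cast. -/
theorem sum_perm_wedge {k s n : ℕ} (h : k + s = n) (B : N₁ →ₗ[R] N₂ →ₗ[R] N₃)
    (α : L [⋀^Fin k]→ₗ[R] N₁) (β : L [⋀^Fin s]→ₗ[R] N₂) (v : Fin n → L) :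
    ∑ σ : Equiv.Perm (Fin n), Equiv.Perm.sign σ •
        B (α fun i => (v ∘ σ) (Fin.cast h (castAdd s i)))
          (β fun j => (v ∘ σ) (Fin.cast h (natAdd k j))) =
      (k.factorial * s.factorial) • ((wedge B k s α β).domDomCongr (finCongr h)) v := by
  subst h
  exact (factorial_smul_wedge_apply B α β v).symm

/-- If `a` lies at position `p` of the first block, moving it to the front of the arguments of `α`
costs `(-1)^p`, and `β` does not see it. -/
theorem wedge_insertNth_left {k s n : ℕ} (h : k + 1 + s = n + 1) (h' : k + s = n)
    (B : N₁ →ₗ[R] N₂ →ₗ[R] N₃)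
    (α : L [⋀^Fin (k + 1)]→ₗ[R] N₁) (β : L [⋀^Fin s]→ₗ[R] N₂) (a : L) (w : Fin n → L)
    (p : Fin (k + 1)) :
    B (α fun i => ((Fin.cast h (castAdd s p)).insertNth a w : Fin (n + 1) → L)
          (Fin.cast h (castAdd s i)))
        (β fun j => ((Fin.cast h (castAdd s p)).insertNth a w : Fin (n + 1) → L)
          (Fin.cast h (natAdd (k + 1) j))) =
      (-1 : ℤ) ^ (p : ℕ) • B (α.curryLeft a fun i => w (Fin.cast h' (castAdd s i)))
        (β fun j => w (Fin.cast h' (natAdd k j))) := by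
  have h1 : (fun i => ((Fin.cast h (castAdd s p)).insertNth a w : Fin (n + 1) → L)
      (Fin.cast h (castAdd s i))) = p.insertNth a fun i => w (Fin.cast h' (castAdd s i)) := by
    ext i
    refine Fin.succAboveCases p ?_ (fun i => ?_) i
    · simp
    · have : Fin.cast h (castAdd s (p.succAbove i)) =
          (Fin.cast h (castAdd s p)).succAbove (Fin.cast h' (castAdd s i)) := by
        ext
        simp only [Fin.succAbove, Fin.lt_def, Fin.val_cast, Fin.val_castAdd, Fin.val_castSucc]
        split_ifs <;> simp
      rw [this, insertNth_apply_succAbove, insertNth_apply_succAbove]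
  have h2 : (fun j => ((Fin.cast h (castAdd s p)).insertNth a w : Fin (n + 1) → L)
      (Fin.cast h (natAdd (k + 1) j))) = fun j => w (Fin.cast h' (natAdd k j)) := by
    ext j
    have : Fin.cast h (natAdd (k + 1) j) =
        (Fin.cast h (castAdd s p)).succAbove (Fin.cast h' (natAdd k j)) := by
      ext
      have := p.2
      simp only [Fin.succAbove, Fin.lt_def, Fin.val_cast, Fin.val_castAdd, Fin.val_castSucc,
        Fin.val_natAdd]
      rw [if_neg (by omega)]
      simp only [Fin.val_succ, Fin.val_cast, Fin.val_natAdd]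
      omega
    rw [this, insertNth_apply_succAbove]
  rw [h1, h2, α.map_insertNth, map_zsmul]
  rfl

theorem wedge_insertNth_right {k s n : ℕ} (h : k + (s + 1) = n + 1) (h' : k + s = n)
    (B : N₁ →ₗ[R] N₂ →ₗ[R] N₃)
    (α : L [⋀^Fin k]→ₗ[R] N₁) (β : L [⋀^Fin (s + 1)]→ₗ[R] N₂) (a : L) (w : Fin n → L)
    (p : Fin (s + 1)) :
    B (α fun i => ((Fin.cast h (natAdd k p)).insertNth a w : Fin (n + 1) → L)
          (Fin.cast h (castAdd (s + 1) i)))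
        (β fun j => ((Fin.cast h (natAdd k p)).insertNth a w : Fin (n + 1) → L)
          (Fin.cast h (natAdd k j))) =
      (-1 : ℤ) ^ (p : ℕ) • B (α fun i => w (Fin.cast h' (castAdd s i)))
        (β.curryLeft a fun j => w (Fin.cast h' (natAdd k j))) := by
  have h1 : (fun j => ((Fin.cast h (natAdd k p)).insertNth a w : Fin (n + 1) → L)
      (Fin.cast h (natAdd k j))) = p.insertNth a fun j => w (Fin.cast h' (natAdd k j)) := by
    ext i
    refine Fin.succAboveCases p ?_ (fun i => ?_) i
    · simp
    · have : Fin.cast h (natAdd k (p.succAbove i)) =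
          (Fin.cast h (natAdd k p)).succAbove (Fin.cast h' (natAdd k i)) := by
        ext
        simp only [Fin.succAbove, Fin.lt_def, Fin.val_cast, Fin.val_natAdd, Fin.val_castSucc]
        split_ifs <;> simp <;> omega
      rw [this, insertNth_apply_succAbove, insertNth_apply_succAbove]
  have h2 : (fun i => ((Fin.cast h (natAdd k p)).insertNth a w : Fin (n + 1) → L)
      (Fin.cast h (castAdd (s + 1) i))) = fun i => w (Fin.cast h' (castAdd s i)) := by
    ext i
    have : Fin.cast h (castAdd (s + 1) i) =
        (Fin.cast h (natAdd k p)).succAbove (Fin.cast h' (castAdd s i)) := by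
      ext
      have := i.2
      simp only [Fin.succAbove, Fin.lt_def, Fin.val_cast, Fin.val_castAdd, Fin.val_castSucc,
        Fin.val_natAdd]
      rw [if_pos (by omega)]
      simp only [Fin.val_castSucc, Fin.val_cast, Fin.val_castAdd]
    rw [this, insertNth_apply_succAbove]
  rw [h1, h2, β.map_insertNth, map_zsmul]
  rfl

/-- The argument `a` falls into the block of `α` or into that of `β`. The second block starts at
position `k`, whence the exponent `k + p`. -/
theorem factorial_smul_wedge_cons {k s n : ℕ} (h : k + s = n + 1) (B : N₁ →ₗ[R] N₂ →ₗ[R] N₃)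
    (α : L [⋀^Fin k]→ₗ[R] N₁) (β : L [⋀^Fin s]→ₗ[R] N₂) (a : L) (u : Fin n → L) :
    (k.factorial * s.factorial) •
        ((wedge B k s α β).domDomCongr (finCongr h)) (cons a u : Fin (n + 1) → L) =
      ∑ p : Fin k, (-1 : ℤ) ^ (p : ℕ) • ∑ τ : Equiv.Perm (Fin n), Equiv.Perm.sign τ •
        B (α fun i => ((Fin.cast h (castAdd s p)).insertNth a (u ∘ τ) : Fin (n + 1) → L)
            (Fin.cast h (castAdd s i)))
          (β fun j => ((Fin.cast h (castAdd s p)).insertNth a (u ∘ τ) : Fin (n + 1) → L)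
            (Fin.cast h (natAdd k j))) +
      ∑ p : Fin s, (-1 : ℤ) ^ (k + p : ℕ) • ∑ τ : Equiv.Perm (Fin n), Equiv.Perm.sign τ •
        B (α fun i => ((Fin.cast h (natAdd k p)).insertNth a (u ∘ τ) : Fin (n + 1) → L)
            (Fin.cast h (castAdd s i)))
          (β fun j => ((Fin.cast h (natAdd k p)).insertNth a (u ∘ τ) : Fin (n + 1) → L)
            (Fin.cast h (natAdd k j))) := by
  rw [← sum_perm_wedge, sum_perm_cons (fun v => B (α fun i => v (Fin.cast h (castAdd s i)))
    (β fun j => v (Fin.cast h (natAdd k j)))), ← (finCongr h).sum_comp, Fin.sum_univ_add]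
  rfl

/-- The sign of the position cancels the sign of moving `a` to the front, so all `k + 1` positions
contribute equally and turn `k!` into `(k + 1)!`. -/
theorem sum_insertNth_left {k s n : ℕ} (h : k + 1 + s = n + 1) (h' : k + s = n)
    (B : N₁ →ₗ[R] N₂ →ₗ[R] N₃)
    (α : L [⋀^Fin (k + 1)]→ₗ[R] N₁) (β : L [⋀^Fin s]→ₗ[R] N₂) (a : L) (u : Fin n → L) :
    ∑ p : Fin (k + 1), (-1 : ℤ) ^ (p : ℕ) • ∑ τ : Equiv.Perm (Fin n), Equiv.Perm.sign τ •
        B (α fun i => ((Fin.cast h (castAdd s p)).insertNth a (u ∘ τ) : Fin (n + 1) → L)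
            (Fin.cast h (castAdd s i)))
          (β fun j => ((Fin.cast h (castAdd s p)).insertNth a (u ∘ τ) : Fin (n + 1) → L)
            (Fin.cast h (natAdd (k + 1) j))) =
      ((k + 1).factorial * s.factorial) •
        ((wedge B k s (α.curryLeft a) β).domDomCongr (finCongr h')) u := by
  simp only [wedge_insertNth_left h h', smul_comm (_ : ℤˣ) ((-1 : ℤ) ^ _), ← Finset.smul_sum,
    smul_smul]
  rw [sum_perm_wedge]
  simp only [← mul_pow, neg_one_mul, neg_neg, one_pow, one_smul, Finset.sum_const,
    Finset.card_univ, Fintype.card_fin, smul_smul, Nat.factorial_succ, mul_assoc]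

theorem sum_insertNth_right {k s n : ℕ} (h : k + (s + 1) = n + 1) (h' : k + s = n)
    (B : N₁ →ₗ[R] N₂ →ₗ[R] N₃)
    (α : L [⋀^Fin k]→ₗ[R] N₁) (β : L [⋀^Fin (s + 1)]→ₗ[R] N₂) (a : L) (u : Fin n → L) :
    ∑ p : Fin (s + 1), (-1 : ℤ) ^ (k + p : ℕ) • ∑ τ : Equiv.Perm (Fin n), Equiv.Perm.sign τ •
        B (α fun i => ((Fin.cast h (natAdd k p)).insertNth a (u ∘ τ) : Fin (n + 1) → L)
            (Fin.cast h (castAdd (s + 1) i)))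
          (β fun j => ((Fin.cast h (natAdd k p)).insertNth a (u ∘ τ) : Fin (n + 1) → L)
            (Fin.cast h (natAdd k j))) =
      (k.factorial * (s + 1).factorial) • (-1 : ℤ) ^ k •
        ((wedge B k s α (β.curryLeft a)).domDomCongr (finCongr h')) u := by
  simp only [wedge_insertNth_right h h', smul_comm (_ : ℤˣ) ((-1 : ℤ) ^ _), ← Finset.smul_sum,
    smul_smul]
  rw [sum_perm_wedge]
  simp only [pow_add, mul_assoc, ← mul_pow, neg_one_mul, neg_neg, one_pow, mul_one,
    Finset.sum_const, Finset.card_univ, Fintype.card_fin, smul_smul, Nat.factorial_succ]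
  simp only [← natCast_zsmul, smul_smul]
  congr 1
  push_cast
  ring

theorem nsmul_right_injective_of_real {N : Type*} [AddCommGroup N] [Module ℝ N] {n : ℕ}
    (hn : n ≠ 0) {x y : N} (h : n • x = n • y) : x = y := by
  rw [← Nat.cast_smul_eq_nsmul ℝ, ← Nat.cast_smul_eq_nsmul ℝ] at h
  exact smul_right_injective N (Nat.cast_ne_zero.2 hn) h

/-- This lemma and the next two say that the interior product is an antiderivation. Degree `0` is
separate because `curryLeft` needs a form of successor degree; there the missing term is zero. -/
theorem wedge_curryLeft_zero_right {k n : ℕ} (h : k + 1 + 0 = n + 1) (h' : k + 0 = n)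
    (B : N₁ →ₗ[R] N₂ →ₗ[R] N₃)
    (α : L [⋀^Fin (k + 1)]→ₗ[R] N₁) (β : L [⋀^Fin 0]→ₗ[R] N₂) (a : L) :
    ((wedge B (k + 1) 0 α β).domDomCongr (finCongr h)).curryLeft a =
      (wedge B k 0 (α.curryLeft a) β).domDomCongr (finCongr h') := by
  ext u
  refine nsmul_right_injective_of_real (n := (k + 1).factorial * Nat.factorial 0)
    (by positivity) ?_
  refine (factorial_smul_wedge_cons h B α β a u).trans ?_
  rw [sum_insertNth_left h h', Finset.univ_eq_empty, Finset.sum_empty, add_zero]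

theorem wedge_curryLeft_zero_left {s n : ℕ} (h : 0 + (s + 1) = n + 1) (h' : 0 + s = n)
    (B : N₁ →ₗ[R] N₂ →ₗ[R] N₃)
    (α : L [⋀^Fin 0]→ₗ[R] N₁) (β : L [⋀^Fin (s + 1)]→ₗ[R] N₂) (a : L) :
    ((wedge B 0 (s + 1) α β).domDomCongr (finCongr h)).curryLeft a =
      (wedge B 0 s α (β.curryLeft a)).domDomCongr (finCongr h') := by
  ext u
  refine nsmul_right_injective_of_real (n := Nat.factorial 0 * (s + 1).factorial)
    (by positivity) ?_
  refine (factorial_smul_wedge_cons h B α β a u).trans ?_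
  rw [sum_insertNth_right h h', Finset.univ_eq_empty, Finset.sum_empty, zero_add, pow_zero,
    one_smul]

theorem wedge_curryLeft {k s n : ℕ} (h : k + 1 + (s + 1) = n + 1) (h₁ : k + (s + 1) = n)
    (h₂ : k + 1 + s = n) (B : N₁ →ₗ[R] N₂ →ₗ[R] N₃)
    (α : L [⋀^Fin (k + 1)]→ₗ[R] N₁) (β : L [⋀^Fin (s + 1)]→ₗ[R] N₂) (a : L) :
    ((wedge B (k + 1) (s + 1) α β).domDomCongr (finCongr h)).curryLeft a =
      (wedge B k (s + 1) (α.curryLeft a) β).domDomCongr (finCongr h₁) +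
        (-1 : ℤ) ^ (k + 1) •
          (wedge B (k + 1) s α (β.curryLeft a)).domDomCongr (finCongr h₂) := by
  ext u
  refine nsmul_right_injective_of_real (n := (k + 1).factorial * (s + 1).factorial)
    (by positivity) ?_
  refine (factorial_smul_wedge_cons h B α β a u).trans ?_
  rw [sum_insertNth_left h h₁, sum_insertNth_right h h₂, ← smul_add]
  rfl

end Wedge

/-! ### Forms of all degrees: interior products, coinduction, parity -/

section TotalForms

variable (R L N : Type*) [CommRing R] [Algebra ℝ R] [LieRing L] [Module R L] [LieRingModule L R]
  [LieRinehartRing R L] [LieAlgebra ℝ L] [LieRinehartAlgebra ℝ R L]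
  [AddCommGroup N] [Module R N] [Module ℝ N] [IsScalarTower ℝ R N]

/-- The space `⨁ₖ Ω^k(L, N)` of forms of all degrees. -/
abbrev TotalForms : Type _ := ⨁ k : ℕ, L [⋀^Fin k]→ₗ[R] N

variable {R L N}

/-- The inclusion of the `k`-forms. -/
abbrev formOf (k : ℕ) : (L [⋀^Fin k]→ₗ[R] N) →ₗ[ℝ] TotalForms R L N :=
  DirectSum.lof ℝ ℕ (fun k => L [⋀^Fin k]→ₗ[R] N) k

theorem TotalForms.induction {p : TotalForms R L N → Prop} (η : TotalForms R L N)
    (of : ∀ (k : ℕ) (θ : L [⋀^Fin k]→ₗ[R] N), p (formOf k θ))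
    (add : ∀ η ζ, p η → p ζ → p (η + ζ)) : p η := by
  refine DirectSum.induction_on η ?_ of add
  have := of 0 0
  rwa [map_zero] at this

theorem TotalForms.hom_ext {V : Type*} [AddCommGroup V] [Module ℝ V]
    {f g : TotalForms R L N →ₗ[ℝ] V}
    (h : ∀ (k : ℕ) (θ : L [⋀^Fin k]→ₗ[R] N), f (formOf k θ) = g (formOf k θ)) : f = g :=
  DirectSum.linearMap_ext ℝ fun k => LinearMap.ext (h k)

theorem formOf_apply_same (k : ℕ) (θ : L [⋀^Fin k]→ₗ[R] N) : formOf k θ k = θ :=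
  DirectSum.of_eq_same (β := fun k => L [⋀^Fin k]→ₗ[R] N) k θ

theorem formOf_apply_of_ne {k m : ℕ} (h : k ≠ m) (θ : L [⋀^Fin k]→ₗ[R] N) : formOf k θ m = 0 :=
  DirectSum.of_eq_of_ne (β := fun k => L [⋀^Fin k]→ₗ[R] N) _ _ _ h.symm

theorem formOf_cast {n m : ℕ} (h : n = m) (θ : L [⋀^Fin n]→ₗ[R] N) :
    formOf n θ = formOf m (θ.domDomCongr (finCongr h)) := by
  subst h
  rfl

/-- The value of the degree `0` component. -/
def eps : TotalForms R L N →ₗ[ℝ] N where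
  toFun η := η 0 ![]
  map_add' _ _ := rfl
  map_smul' _ _ := rfl

/-- A `0`-form. -/
def zeroForm : N →ₗ[ℝ] TotalForms R L N :=
  formOf 0 ∘ₗ
    { toFun := fun e => AlternatingMap.constOfIsEmpty R L (Fin 0) e
      map_add' := fun _ _ => rfl
      map_smul' := fun _ _ => rfl : N →ₗ[ℝ] L [⋀^Fin 0]→ₗ[R] N }

theorem eps_zeroForm (e : N) : eps (zeroForm e : TotalForms R L N) = e := by
  change formOf 0 (AlternatingMap.constOfIsEmpty R L (Fin 0) e) 0 ![] = e
  rw [formOf_apply_same]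
  rfl

theorem eps_formOf_succ (k : ℕ) (θ : L [⋀^Fin (k + 1)]→ₗ[R] N) : eps (formOf (k + 1) θ) = 0 := by
  change formOf (k + 1) θ 0 ![] = 0
  rw [formOf_apply_of_ne (by omega)]
  rfl

theorem eps_formOf_zero (θ : L [⋀^Fin 0]→ₗ[R] N) : eps (formOf 0 θ) = θ ![] := by
  change formOf 0 θ 0 ![] = _
  rw [formOf_apply_same]

theorem formOf_zero_eq (θ : L [⋀^Fin 0]→ₗ[R] N) : formOf 0 θ = zeroForm (θ ![]) := by
  change _ = formOf 0 _
  congr 1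
  ext v
  rw [Subsingleton.elim v ![]]
  rfl

/-- The interior product with `a`. -/
def ins (a : L) : TotalForms R L N →ₗ[ℝ] TotalForms R L N :=
  DirectSum.toModule ℝ ℕ _ fun k => match k with
    | 0 => 0
    | k + 1 => formOf k ∘ₗ
        { toFun := fun θ => θ.curryLeft a
          map_add' := fun _ _ => rfl
          map_smul' := fun _ _ => rfl }

theorem ins_formOf_zero (a : L) (θ : L [⋀^Fin 0]→ₗ[R] N) : ins a (formOf 0 θ) = 0 :=
  DirectSum.toModule_lof ..

theorem ins_zeroForm (a : L) (e : N) : ins a (zeroForm e : TotalForms R L N) = 0 :=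
  ins_formOf_zero ..

theorem ins_formOf_succ (a : L) {k : ℕ} (θ : L [⋀^Fin (k + 1)]→ₗ[R] N) :
    ins a (formOf (k + 1) θ) = formOf k (θ.curryLeft a) :=
  DirectSum.toModule_lof ..

theorem ins_formOf (a : L) {k m : ℕ} (h : k = m + 1) (θ : L [⋀^Fin k]→ₗ[R] N) :
    ins a (formOf k θ) = formOf m ((θ.domDomCongr (finCongr h)).curryLeft a) := by
  subst h
  exact ins_formOf_succ a θ

theorem ins_apply (a : L) (η : TotalForms R L N) (k : ℕ) :
    ins a η k = (η (k + 1)).curryLeft a := by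
  induction η using TotalForms.induction with
  | of m θ =>
    cases m with
    | zero =>
      rw [ins_formOf_zero, formOf_apply_of_ne (by omega)]
      rfl
    | succ m =>
      rw [ins_formOf_succ]
      rcases eq_or_ne m k with rfl | h
      · rw [formOf_apply_same, formOf_apply_same]
      · rw [formOf_apply_of_ne h, formOf_apply_of_ne (by omega)]
        rfl
  | add η ζ h h' =>
    rw [map_add, DirectSum.add_apply, DirectSum.add_apply, h, h']
    rfl

theorem ins_add (a b : L) (η : TotalForms R L N) : ins (a + b) η = ins a η + ins b η := by
  refine DFinsupp.ext fun k => ?_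
  change ins (a + b) η k = (ins a η + ins b η) k
  rw [DirectSum.add_apply, ins_apply, ins_apply, ins_apply, map_add]

theorem ins_neg (a : L) (η : TotalForms R L N) : ins (-a) η = -ins a η := by
  rw [eq_neg_iff_add_eq_zero, ← ins_add, neg_add_cancel]
  refine DFinsupp.ext fun k => ?_
  change ins 0 η k = 0
  rw [ins_apply, map_zero]

theorem ins_sub (a b : L) (η : TotalForms R L N) : ins (a - b) η = ins a η - ins b η := by
  rw [sub_eq_add_neg, ins_add, ins_neg, sub_eq_add_neg]

/-- Coinduction: a set of forms stable up to linear combinations under all interior products,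
and without degree `0` components, consists of zero. -/
theorem TotalForms.eq_zero_of_mem (G : Set (TotalForms R L N)) (h0 : ∀ η ∈ G, eps η = 0)
    (h1 : ∀ η ∈ G, ∀ a, ins a η ∈ Submodule.span ℝ G) {η : TotalForms R L N} (hη : η ∈ G) :
    η = 0 := by
  -- Both hypotheses are linear, so they pass to the span, which is then stable under interior
  -- products. A value of a form is reached by inserting its arguments one at a time.
  have h0' : ∀ η ∈ Submodule.span ℝ G, eps η = 0 := fun η hη =>
    (Submodule.span_le (p := LinearMap.ker (eps (R := R) (L := L) (N := N)))).2 h0 hη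
  have h1' : ∀ η ∈ Submodule.span ℝ G, ∀ a, ins a η ∈ Submodule.span ℝ G := fun η hη a =>
    (Submodule.span_le (p := (Submodule.span ℝ G).comap (ins a))).2 (fun η hη => h1 η hη a) hη
  have key : ∀ (k : ℕ), ∀ η ∈ Submodule.span ℝ G, ∀ v : Fin k → L, η k v = 0 := by
    intro k
    induction k with
    | zero =>
      intro η hη v
      rw [Subsingleton.elim v ![]]
      exact h0' η hη
    | succ k ih =>
      intro η hη v
      have := ih _ (h1' η hη (v 0)) (tail v)
      rw [ins_apply, AlternatingMap.curryLeft_apply_apply] at this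
      rw [← this]
      congr 1
      exact (Fin.cons_self_tail v).symm
  refine DFinsupp.ext fun k => AlternatingMap.ext fun v => ?_
  exact key k η (Submodule.subset_span hη) v

/-- The parity operator, `(-1)^k` on `k`-forms. -/
def parity : TotalForms R L N →ₗ[ℝ] TotalForms R L N :=
  DirectSum.toModule ℝ ℕ _ fun k => (-1 : ℝ) ^ k • formOf k

theorem parity_formOf (k : ℕ) (θ : L [⋀^Fin k]→ₗ[R] N) :
    parity (formOf k θ) = (-1 : ℝ) ^ k • formOf k θ :=
  DirectSum.toModule_lof ..

theorem parity_zeroForm (e : N) : parity (zeroForm e : TotalForms R L N) = zeroForm e :=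
  (parity_formOf 0 _).trans (by rw [pow_zero, one_smul]; rfl)

theorem parity_parity (η : TotalForms R L N) : parity (parity η) = η := by
  induction η using TotalForms.induction with
  | of k θ =>
    rw [parity_formOf, map_smul, parity_formOf, smul_smul, ← mul_pow]
    simp
  | add η ζ h h' => rw [map_add, map_add, h, h']

theorem eps_parity (η : TotalForms R L N) : eps (parity η) = eps η := by
  induction η using TotalForms.induction with
  | of k θ =>
    rw [parity_formOf, map_smul]
    cases k with
    | zero => simp
    | succ k => rw [eps_formOf_succ, smul_zero]
  | add η ζ h h' => rw [map_add, map_add, map_add, h, h']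

theorem ins_parity (a : L) (η : TotalForms R L N) : ins a (parity η) = -parity (ins a η) := by
  induction η using TotalForms.induction with
  | of k θ =>
    rw [parity_formOf, map_smul]
    cases k with
    | zero => simp [ins_formOf_zero]
    | succ k =>
      rw [ins_formOf_succ, parity_formOf, pow_succ, mul_neg_one]
      exact neg_smul ((-1 : ℝ) ^ k) (formOf k (θ.curryLeft a))
  | add η ζ h h' => rw [map_add, map_add, map_add, map_add, h, h', neg_add]

/-- `parity ^ p`. -/
def koszulSign (p : ℤ) : TotalForms R L N →ₗ[ℝ] TotalForms R L N :=
  if Even p then LinearMap.id else parity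

theorem koszulSign_formOf (p : ℤ) (k : ℕ) (θ : L [⋀^Fin k]→ₗ[R] N) :
    koszulSign p (formOf k θ) = (-1 : ℝ) ^ (p * k) • formOf k θ := by
  unfold koszulSign
  split_ifs with h
  · rw [(h.mul_right _).neg_one_zpow, one_smul]
    rfl
  · rw [parity_formOf, zpow_mul, (Int.not_even_iff_odd.1 h).neg_one_zpow, zpow_natCast]

end TotalForms

/-! ### The wedge product on forms of all degrees -/

section Wedge

variable {R L : Type*} [CommRing R] [Algebra ℝ R] [LieRing L] [Module R L] [LieRingModule L R]
  [LieRinehartRing R L] [LieAlgebra ℝ L] [LieRinehartAlgebra ℝ R L]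
variable {N₁ N₂ N₃ N₁₂ N₂₃ : Type*}
  [AddCommGroup N₁] [Module R N₁] [Module ℝ N₁] [IsScalarTower ℝ R N₁]
  [AddCommGroup N₂] [Module R N₂] [Module ℝ N₂] [IsScalarTower ℝ R N₂]
  [AddCommGroup N₃] [Module R N₃] [Module ℝ N₃] [IsScalarTower ℝ R N₃]
  [AddCommGroup N₁₂] [Module R N₁₂] [Module ℝ N₁₂] [IsScalarTower ℝ R N₁₂]
  [AddCommGroup N₂₃] [Module R N₂₃] [Module ℝ N₂₃] [IsScalarTower ℝ R N₂₃]

theorem totalWedge_formOf (p : ℤ) (B : N₁ →ₗ[R] N₂ →ₗ[R] N₃) {k s : ℕ}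
    (α : L [⋀^Fin k]→ₗ[R] N₁) (β : L [⋀^Fin s]→ₗ[R] N₂) :
    totalWedge p B (formOf k α) (formOf s β) =
      (-1 : ℝ) ^ (p * s) • formOf (k + s) (wedge B k s α β) := by
  simp [totalWedge, formOf, DirectSum.toModule_lof]

/-- The wedge product without sign. -/
abbrev wdg (B : N₁ →ₗ[R] N₂ →ₗ[R] N₃) :
    TotalForms R L N₁ →ₗ[ℝ] TotalForms R L N₂ →ₗ[ℝ] TotalForms R L N₃ :=
  totalWedge 0 B

theorem wdg_formOf (B : N₁ →ₗ[R] N₂ →ₗ[R] N₃) {k s : ℕ}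
    (α : L [⋀^Fin k]→ₗ[R] N₁) (β : L [⋀^Fin s]→ₗ[R] N₂) :
    wdg B (formOf k α) (formOf s β) = formOf (k + s) (wedge B k s α β) := by
  rw [wdg, totalWedge_formOf, zero_mul, zpow_zero, one_smul]

/-- The sign depends only on the degree of the second factor and can be absorbed there, so only the
unsigned product has to be studied. -/
theorem totalWedge_eq_wdg (p : ℤ) (B : N₁ →ₗ[R] N₂ →ₗ[R] N₃) (α : TotalForms R L N₁)
    (β : TotalForms R L N₂) : totalWedge p B α β = wdg B α (koszulSign p β) := by
  induction α using TotalForms.induction with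
  | of k α =>
    induction β using TotalForms.induction with
    | of s β => rw [koszulSign_formOf, map_smul, wdg_formOf, totalWedge_formOf]
    | add η ζ h h' => rw [map_add, map_add, map_add, h, h']
  | add η ζ h h' => rw [map_add, map_add, LinearMap.add_apply, LinearMap.add_apply, h, h']

theorem eps_wdg (B : N₁ →ₗ[R] N₂ →ₗ[R] N₃) (α : TotalForms R L N₁) (β : TotalForms R L N₂) :
    eps (wdg B α β) = B (eps α) (eps β) := by
  induction α using TotalForms.induction with
  | of k α =>
    induction β using TotalForms.induction with
    | of s β =>
      rw [wdg_formOf]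
      cases s with
      | succ s =>
        rw [eps_formOf_succ s β, map_zero]
        exact eps_formOf_succ (k + s) (wedge B k (s + 1) α β)
      | zero =>
        cases k with
        | succ k =>
          rw [eps_formOf_succ k α, map_zero]
          exact eps_formOf_succ k (wedge B (k + 1) 0 α β)
        | zero =>
          rw [eps_formOf_zero, eps_formOf_zero]
          refine (eps_formOf_zero (wedge B 0 0 α β)).trans ?_
          have := factorial_smul_wedge_apply B α β ![]
          simp only [Nat.factorial_zero, mul_one, one_smul] at this
          rw [this]
          rw [Fintype.sum_eq_single (1 : Equiv.Perm (Fin 0)) fun x hx =>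
            (hx (Subsingleton.elim _ _)).elim]
          simp only [Equiv.Perm.sign_one, one_smul]
          congr 2
    | add η ζ h h' => rw [map_add, map_add, map_add, map_add, h, h']
  | add η ζ h h' =>
    rw [map_add, LinearMap.add_apply, map_add, map_add, map_add, LinearMap.add_apply, h, h']

theorem parity_wdg (B : N₁ →ₗ[R] N₂ →ₗ[R] N₃) (α : TotalForms R L N₁) (β : TotalForms R L N₂) :
    parity (wdg B α β) = wdg B (parity α) (parity β) := by
  induction α using TotalForms.induction with
  | of k α =>
    induction β using TotalForms.induction with
    | of s β =>
      rw [wdg_formOf, parity_formOf, parity_formOf, parity_formOf, map_smul, map_smul,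
        LinearMap.smul_apply, wdg_formOf, smul_smul, ← pow_add, add_comm s k]
    | add η ζ h h' => rw [map_add, map_add, map_add, map_add, h, h']
  | add η ζ h h' =>
    rw [map_add, LinearMap.add_apply, map_add, map_add, map_add, LinearMap.add_apply, h, h']

/-- With `eps_wdg` and `parity_wdg` this is the coinductive description of the wedge product; later
arguments about it do not return to permutations. -/
theorem ins_wdg (B : N₁ →ₗ[R] N₂ →ₗ[R] N₃) (a : L) (α : TotalForms R L N₁)
    (β : TotalForms R L N₂) :
    ins a (wdg B α β) = wdg B (ins a α) β + wdg B (parity α) (ins a β) := by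
  induction α using TotalForms.induction with
  | of k α =>
    induction β using TotalForms.induction with
    | of s β =>
      rw [wdg_formOf, parity_formOf, map_smul, LinearMap.smul_apply]
      cases k with
      | zero =>
        rw [ins_formOf_zero, map_zero, LinearMap.zero_apply, zero_add (_ • _), pow_zero, one_smul]
        cases s with
        | zero =>
          rw [ins_formOf_zero a β, map_zero]
          exact ins_formOf_zero _ _
        | succ s =>
          rw [ins_formOf_succ a β, wdg_formOf]
          refine (ins_formOf a (m := 0 + s) rfl _).trans ?_
          rw [wedge_curryLeft_zero_left (n := 0 + s) rfl rfl]
          rfl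
      | succ k =>
        rw [ins_formOf_succ a α]
        cases s with
        | zero =>
          rw [ins_formOf_zero a β, map_zero, smul_zero, add_zero (wdg B _ _), wdg_formOf]
          refine (ins_formOf a (m := k + 0) rfl _).trans ?_
          rw [wedge_curryLeft_zero_right (n := k + 0) rfl rfl]
          rfl
        | succ s =>
          rw [ins_formOf_succ a β, wdg_formOf, wdg_formOf]
          refine (ins_formOf a (m := k + 1 + s) rfl _).trans ?_
          rw [wedge_curryLeft (n := k + 1 + s) rfl (by omega) rfl, map_add, ← formOf_cast]
          congr 1
          have : ((-1 : ℤ) ^ (k + 1)) • wedge B (k + 1) s α (β.curryLeft a) =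
              ((-1 : ℝ) ^ (k + 1)) • wedge B (k + 1) s α (β.curryLeft a) := by
            rw [← Int.cast_smul_eq_zsmul ℝ]
            push_cast
            rfl
          rw [← map_smul, ← this]
          rfl
    | add η ζ h h' =>
      simp only [map_add, h, h']
      abel
  | add η ζ h h' =>
    simp only [map_add, LinearMap.add_apply, h, h']
    abel

end Wedge

/-! ### Associativity, graded commutativity, maps of coefficients -/

section FormAlgebra

variable {R L : Type*} [CommRing R] [Algebra ℝ R] [LieRing L] [Module R L] [LieRingModule L R]
  [LieRinehartRing R L] [LieAlgebra ℝ L] [LieRinehartAlgebra ℝ R L]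
variable {N N' N₁ N₂ N₃ N₁₂ N₂₃ : Type*}
  [AddCommGroup N] [Module R N] [Module ℝ N] [IsScalarTower ℝ R N]
  [AddCommGroup N'] [Module R N'] [Module ℝ N'] [IsScalarTower ℝ R N']
  [AddCommGroup N₁] [Module R N₁] [Module ℝ N₁] [IsScalarTower ℝ R N₁]
  [AddCommGroup N₂] [Module R N₂] [Module ℝ N₂] [IsScalarTower ℝ R N₂]
  [AddCommGroup N₃] [Module R N₃] [Module ℝ N₃] [IsScalarTower ℝ R N₃]
  [AddCommGroup N₁₂] [Module R N₁₂] [Module ℝ N₁₂] [IsScalarTower ℝ R N₁₂]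
  [AddCommGroup N₂₃] [Module R N₂₃] [Module ℝ N₂₃] [IsScalarTower ℝ R N₂₃]

/-- Coinduction on all associators at once: an interior product of an associator is a sum of three
associators, one for each factor it may hit, and in degree `0` the claim is `h`. -/
theorem wdg_assoc {B₁₂ : N₁ →ₗ[R] N₂ →ₗ[R] N₁₂} {B : N₁₂ →ₗ[R] N₃ →ₗ[R] N}
    {B₂₃ : N₂ →ₗ[R] N₃ →ₗ[R] N₂₃} {B' : N₁ →ₗ[R] N₂₃ →ₗ[R] N}
    (h : ∀ x y z, B (B₁₂ x y) z = B' x (B₂₃ y z)) (α : TotalForms R L N₁) (β : TotalForms R L N₂)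
    (γ : TotalForms R L N₃) : wdg B (wdg B₁₂ α β) γ = wdg B' α (wdg B₂₃ β γ) := by
  rw [← sub_eq_zero]
  let X := fun (α : TotalForms R L N₁) (β : TotalForms R L N₂) (γ : TotalForms R L N₃) =>
    wdg B (wdg B₁₂ α β) γ - wdg B' α (wdg B₂₃ β γ)
  refine TotalForms.eq_zero_of_mem {η | ∃ α β γ, X α β γ = η} ?_ ?_ ⟨α, β, γ, rfl⟩
  · rintro _ ⟨α, β, γ, rfl⟩
    simp only [X, map_sub, eps_wdg, h, sub_self]
  · rintro _ ⟨α, β, γ, rfl⟩ a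
    have : ins a (X α β γ) =
        X (ins a α) β γ + X (parity α) (ins a β) γ + X (parity α) (parity β) (ins a γ) := by
      simp only [X, map_sub, ins_wdg, map_add, LinearMap.add_apply, parity_wdg]
      abel
    rw [this]
    exact add_mem (add_mem (Submodule.subset_span ⟨_, _, _, rfl⟩)
      (Submodule.subset_span ⟨_, _, _, rfl⟩)) (Submodule.subset_span ⟨_, _, _, rfl⟩)

/-- Interior products exchange even and odd forms, so the commutation rules for both parities have
to be proved by one simultaneous coinduction. -/
theorem wdg_comm_aux {B : N₁ →ₗ[R] N₂ →ₗ[R] N} {B' : N₂ →ₗ[R] N₁ →ₗ[R] N}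
    (h : ∀ x y, B x y = B' y x) {η : TotalForms R L N}
    (hη : (∃ α β, parity α = α ∧ wdg B α β - wdg B' β α = η) ∨
      ∃ α β, parity α = -α ∧ wdg B α β - wdg B' (parity β) α = η) : η = 0 := by
  refine TotalForms.eq_zero_of_mem {η | (∃ α β, parity α = α ∧ wdg B α β - wdg B' β α = η) ∨
      ∃ α β, parity α = -α ∧ wdg B α β - wdg B' (parity β) α = η} ?_ ?_ hη
  · rintro _ (⟨α, β, -, rfl⟩ | ⟨α, β, -, rfl⟩)
    · simp only [map_sub, eps_wdg, h, sub_self]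
    · simp only [map_sub, eps_wdg, eps_parity, h, sub_self]
  · rintro _ (⟨α, β, hα, rfl⟩ | ⟨α, β, hα, rfl⟩) a
    · have h1 : parity (ins a α) = -ins a α := by
        rw [← neg_eq_iff_eq_neg, ← ins_parity, hα]
      have : ins a (wdg B α β - wdg B' β α) = (wdg B (ins a α) β - wdg B' (parity β) (ins a α)) +
          (wdg B α (ins a β) - wdg B' (ins a β) α) := by
        simp only [map_sub, ins_wdg, hα]
        abel
      rw [this]
      exact add_mem (Submodule.subset_span (Or.inr ⟨_, _, h1, rfl⟩))
        (Submodule.subset_span (Or.inl ⟨_, _, hα, rfl⟩))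
    · have h1 : parity (ins a α) = ins a α := by
        rw [← neg_eq_iff_eq_neg.2 (ins_parity a α), hα, map_neg, neg_neg]
      have : ins a (wdg B α β - wdg B' (parity β) α) =
          (wdg B (ins a α) β - wdg B' β (ins a α)) -
            (wdg B α (ins a β) - wdg B' (parity (ins a β)) α) := by
        simp only [map_sub, ins_wdg, hα, ins_parity, parity_parity, map_neg, LinearMap.neg_apply]
        abel
      rw [this]
      exact sub_mem (Submodule.subset_span (Or.inl ⟨_, _, h1, rfl⟩))
        (Submodule.subset_span (Or.inr ⟨_, _, hα, rfl⟩))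

theorem wdg_comm_of_even {B : N₁ →ₗ[R] N₂ →ₗ[R] N} {B' : N₂ →ₗ[R] N₁ →ₗ[R] N}
    (h : ∀ x y, B x y = B' y x) {α : TotalForms R L N₁} (hα : parity α = α)
    (β : TotalForms R L N₂) : wdg B α β = wdg B' β α :=
  sub_eq_zero.1 (wdg_comm_aux h (Or.inl ⟨α, β, hα, rfl⟩))

theorem wdg_comm_of_odd {B : N₁ →ₗ[R] N₂ →ₗ[R] N} {B' : N₂ →ₗ[R] N₁ →ₗ[R] N}
    (h : ∀ x y, B x y = B' y x) {α : TotalForms R L N₁} (hα : parity α = -α)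
    (β : TotalForms R L N₂) : wdg B α β = wdg B' (parity β) α :=
  sub_eq_zero.1 (wdg_comm_aux h (Or.inr ⟨α, β, hα, rfl⟩))

/-- The action of a linear map of coefficients on forms. -/
def mapForm (f : N →ₗ[R] N') : TotalForms R L N →ₗ[ℝ] TotalForms R L N' :=
  DirectSum.lmap fun k =>
    { toFun := fun θ => f.compAlternatingMap θ
      map_add' := fun θ θ' => f.compAlternatingMap_add θ θ'
      map_smul' := fun c θ => by
        ext v
        change f (c • θ v) = c • f (θ v)
        rw [← algebraMap_smul R c, map_smul, algebraMap_smul] }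

theorem mapForm_formOf (f : N →ₗ[R] N') (k : ℕ) (θ : L [⋀^Fin k]→ₗ[R] N) :
    mapForm f (formOf k θ) = formOf k (f.compAlternatingMap θ) :=
  DirectSum.lmap_lof ..

theorem mapForm_apply (f : N →ₗ[R] N') (η : TotalForms R L N) (k : ℕ) :
    mapForm f η k = f.compAlternatingMap (η k) :=
  DirectSum.lmap_apply ..

theorem mapForm_zeroForm (f : N →ₗ[R] N') (e : N) :
    mapForm f (zeroForm e : TotalForms R L N) = zeroForm (f e) :=
  mapForm_formOf f 0 _

theorem eps_mapForm (f : N →ₗ[R] N') (η : TotalForms R L N) : eps (mapForm f η) = f (eps η) := by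
  change mapForm f η 0 ![] = _
  rw [mapForm_apply]
  rfl

theorem ins_mapForm (f : N →ₗ[R] N') (a : L) (η : TotalForms R L N) :
    ins a (mapForm f η) = mapForm f (ins a η) := by
  refine DFinsupp.ext fun k => ?_
  change ins a (mapForm f η) k = mapForm f (ins a η) k
  rw [ins_apply, mapForm_apply, mapForm_apply, ins_apply]
  rfl

theorem parity_mapForm (f : N →ₗ[R] N') (η : TotalForms R L N) :
    parity (mapForm f η) = mapForm f (parity η) := by
  induction η using TotalForms.induction with
  | of k θ => rw [mapForm_formOf, parity_formOf, parity_formOf, map_smul, mapForm_formOf]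
  | add η ζ h h' => rw [map_add, map_add, map_add, map_add, h, h']

theorem mapForm_wdg {B : N₁ →ₗ[R] N₂ →ₗ[R] N} {B' : N₁₂ →ₗ[R] N₂₃ →ₗ[R] N'} {f : N →ₗ[R] N'}
    {g : N₁ →ₗ[R] N₁₂} {g' : N₂ →ₗ[R] N₂₃} (h : ∀ x y, f (B x y) = B' (g x) (g' y))
    (α : TotalForms R L N₁) (β : TotalForms R L N₂) :
    mapForm f (wdg B α β) = wdg B' (mapForm g α) (mapForm g' β) := by
  rw [← sub_eq_zero]
  let X := fun (α : TotalForms R L N₁) (β : TotalForms R L N₂) =>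
    mapForm f (wdg B α β) - wdg B' (mapForm g α) (mapForm g' β)
  refine TotalForms.eq_zero_of_mem {η | ∃ α β, X α β = η} ?_ ?_ ⟨α, β, rfl⟩
  · rintro _ ⟨α, β, rfl⟩
    simp only [X, map_sub, eps_wdg, eps_mapForm, h, sub_self]
  · rintro _ ⟨α, β, rfl⟩ a
    have : ins a (X α β) = X (ins a α) β + X (parity α) (ins a β) := by
      simp only [X, map_sub, ins_wdg, ins_mapForm, map_add, parity_mapForm]
      abel
    rw [this]
    exact add_mem (Submodule.subset_span ⟨_, _, rfl⟩) (Submodule.subset_span ⟨_, _, rfl⟩)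

theorem mapForm_id : mapForm (LinearMap.id : N →ₗ[R] N) = (LinearMap.id : Module.End ℝ (TotalForms R L N)) :=
  TotalForms.hom_ext fun k θ => by
    rw [mapForm_formOf]
    rfl

theorem wdg_zeroForm (B : N₁ →ₗ[R] N₂ →ₗ[R] N) (α : TotalForms R L N₁) (e : N₂) :
    wdg B α (zeroForm e) = mapForm (B.flip e) α := by
  rw [← sub_eq_zero]
  refine TotalForms.eq_zero_of_mem
    {η | ∃ α, wdg B α (zeroForm e : TotalForms R L N₂) - mapForm (B.flip e) α = η} ?_ ?_ ⟨α, rfl⟩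
  · rintro _ ⟨α, rfl⟩
    simp only [map_sub, eps_wdg, eps_mapForm, eps_zeroForm, LinearMap.flip_apply, sub_self]
  · rintro _ ⟨α, rfl⟩ a
    refine Submodule.subset_span ⟨ins a α, ?_⟩
    simp only [map_sub, ins_wdg, ins_zeroForm, map_zero, add_zero, ins_mapForm]

theorem zeroForm_wdg (B : N₁ →ₗ[R] N₂ →ₗ[R] N) (e : N₁) (β : TotalForms R L N₂) :
    wdg B (zeroForm e) β = mapForm (B e) β := by
  rw [← sub_eq_zero]
  refine TotalForms.eq_zero_of_mem
    {η | ∃ β, wdg B (zeroForm e : TotalForms R L N₁) β - mapForm (B e) β = η} ?_ ?_ ⟨β, rfl⟩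
  · rintro _ ⟨β, rfl⟩
    simp only [map_sub, eps_wdg, eps_mapForm, eps_zeroForm, sub_self]
  · rintro _ ⟨β, rfl⟩ a
    refine Submodule.subset_span ⟨ins a β, ?_⟩
    simp only [map_sub, ins_wdg, ins_zeroForm, map_zero, LinearMap.zero_apply, zero_add,
      ins_mapForm, parity_zeroForm]

end FormAlgebra

/-! ### Cartan calculus: Lie derivatives, the Leibniz rule, `d² = 0` -/

section Cartan

variable {R L : Type*} [CommRing R] [Algebra ℝ R] [LieRing L] [Module R L] [LieRingModule L R]
  [LieRinehartRing R L] [LieAlgebra ℝ L] [LieRinehartAlgebra ℝ R L]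
variable {N N' N₁ N₂ N₃ : Type*}
  [AddCommGroup N] [Module R N] [Module ℝ N] [IsScalarTower ℝ R N]
  [AddCommGroup N'] [Module R N'] [Module ℝ N'] [IsScalarTower ℝ R N']
  [AddCommGroup N₁] [Module R N₁] [Module ℝ N₁] [IsScalarTower ℝ R N₁]
  [AddCommGroup N₂] [Module R N₂] [Module ℝ N₂] [IsScalarTower ℝ R N₂]
  [AddCommGroup N₃] [Module R N₃] [Module ℝ N₃] [IsScalarTower ℝ R N₃]

namespace LRConnection

variable (D : LRConnection R L N)

theorem dTotal_formOf (k : ℕ) (θ : L [⋀^Fin k]→ₗ[R] N) :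
    D.dTotal (formOf k θ) = formOf (k + 1) (D.d θ) :=
  DirectSum.toModule_lof ..

theorem removeNth_succ_cons {m : ℕ} (x : L) (u : Fin (m + 1) → L) (i : Fin (m + 1)) :
    i.succ.removeNth (cons x u : Fin (m + 2) → L) = (cons x (i.removeNth u) : Fin (m + 1) → L) := by
  ext j
  refine Fin.cases ?_ (fun j => ?_) j <;> simp [Fin.removeNth]

/-- Separates the terms of the Koszul formula that differentiate along `x` or bracket with it from
those in which `x` is only an argument of `θ`. -/
theorem koszul_cons {m : ℕ} (θ : L [⋀^Fin (m + 1)]→ₗ[R] N) (x : L) (w : Fin (m + 1) → L) :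
    D.koszul θ (cons x w : Fin (m + 2) → L) = D.cov x (θ w) +
        ∑ i : Fin (m + 1), (-1 : ℤ) ^ (i + 1 : ℕ) •
          D.cov (w i) (θ (cons x (i.removeNth w) : Fin (m + 1) → L)) -
        (∑ j : Fin (m + 1), (-1 : ℤ) ^ (j : ℕ) •
            θ (cons ⁅x, w j⁆ (j.removeNth w) : Fin (m + 1) → L) +
          ∑ i : Fin m, ∑ j ∈ Finset.Ici i.succ, (-1 : ℤ) ^ (i + 1 + j : ℕ) •
            θ (Matrix.vecCons ⁅w i.castSucc, w j⁆ (j.removeNth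
              (i.castSucc.succ.removeNth (cons x w : Fin (m + 2) → L))))) := by
  have hI : Finset.Ici (0 : Fin (m + 1)) = Finset.univ := by ext; simp
  simp only [koszul, bracketPart]
  rw [Fin.sum_univ_succ, Fin.sum_univ_succ (n := m) (f := fun i => ∑ j ∈ Finset.Ici i, _), hI,
    sub_eq_add_neg]
  simp only [removeNth_succ_cons, Fin.removeNth_zero, cons_succ, Fin.castSucc_zero,
    ← Fin.succ_castSucc]
  simp [Matrix.vecCons]

theorem sum_Ici_succ {A : Type*} [AddCommMonoid A] {m : ℕ} (i : Fin m) (f : Fin (m + 1) → A) :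
    ∑ j ∈ Finset.Ici i.succ, f j = ∑ j ∈ Finset.Ici i, f j.succ := by
  have h : ∀ {n : ℕ} (i : Fin n), Finset.Ici i = Finset.univ.filter (i ≤ ·) := by
    intro n i
    ext
    simp
  rw [h, h, Finset.sum_filter, Finset.sum_filter, Fin.sum_univ_succ]
  simp

theorem apply_vecCons_cons {m : ℕ} (θ : L [⋀^Fin (m + 2)]→ₗ[R] N) (x y : L) (u : Fin m → L) :
    θ (Matrix.vecCons y (cons x u : Fin (m + 1) → L)) = -θ (cons x (cons y u : Fin (m + 1) → L)) := by
  have h := θ.map_swap (cons x (cons y u : Fin (m + 1) → L) : Fin (m + 2) → L)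
    (i := 0) (j := 1) (by simp)
  rw [← h]
  congr 1
  ext j
  refine Fin.cases ?_ (fun j => ?_) j
  · simp
  · refine Fin.cases ?_ (fun j => ?_) j
    · simp
    · rw [Function.comp_apply, Equiv.swap_apply_of_ne_of_ne (by simp) (by simp [Fin.ext_iff])]
      simp

/-- The explicit formula for the Lie derivative: in `i_x d + d i_x` every term cancels in which `x`
is only an argument of `θ`. -/
theorem koszul_cons_add_koszul_curryLeft {m : ℕ} (θ : L [⋀^Fin (m + 1)]→ₗ[R] N) (x : L)
    (w : Fin (m + 1) → L) :
    D.koszul θ (cons x w : Fin (m + 2) → L) + D.koszul (θ.curryLeft x) w =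
      D.cov x (θ w) - ∑ j : Fin (m + 1), (-1 : ℤ) ^ (j : ℕ) •
        θ (cons ⁅x, w j⁆ (j.removeNth w) : Fin (m + 1) → L) := by
  rw [koszul_cons, koszul]
  have h1 : ∑ i : Fin (m + 1), (-1 : ℤ) ^ (i + 1 : ℕ) •
      D.cov (w i) (θ (cons x (i.removeNth w) : Fin (m + 1) → L)) =
      -∑ i : Fin (m + 1), (-1 : ℤ) ^ (i : ℕ) • D.cov (w i) (θ.curryLeft x (i.removeNth w)) := by
    rw [← Finset.sum_neg_distrib]
    refine Finset.sum_congr rfl fun i _ => ?_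
    rw [pow_succ, mul_neg_one, neg_smul]
    rfl
  have h2 : ∑ i : Fin m, ∑ j ∈ Finset.Ici i.succ, (-1 : ℤ) ^ (i + 1 + j : ℕ) •
      θ (Matrix.vecCons ⁅w i.castSucc, w j⁆ (j.removeNth
        (i.castSucc.succ.removeNth (cons x w : Fin (m + 2) → L)))) =
      bracketPart (θ.curryLeft x) w := by
    cases m with
    | zero => simp [bracketPart]
    | succ m =>
      rw [bracketPart, ← Finset.sum_neg_distrib]
      refine Finset.sum_congr rfl fun i _ => ?_
      rw [sum_Ici_succ, ← Finset.sum_neg_distrib]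
      refine Finset.sum_congr rfl fun j _ => ?_
      rw [removeNth_succ_cons, removeNth_succ_cons, apply_vecCons_cons, smul_neg]
      congr 1
      -- The index shift by two does not change the sign; the global minus of `bracketPart` is the
      -- sign of exchanging `x` with the bracket.
      rw [Fin.val_succ, show (i : ℕ) + 1 + (j + 1) = i + j + 2 by ring, pow_add]
      norm_num
      rfl
  rw [h1, h2]
  abel

/-- The Lie derivative, defined by Cartan's formula. -/
def lieD (a : L) : Module.End ℝ (TotalForms R L N) :=
  ins a ∘ₗ D.dTotal + D.dTotal ∘ₗ ins a

theorem ins_dTotal (a : L) (η : TotalForms R L N) :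
    ins a (D.dTotal η) = D.lieD a η - D.dTotal (ins a η) := by
  simp [lieD]

theorem eps_dTotal (η : TotalForms R L N) : eps (D.dTotal η) = 0 := by
  induction η using TotalForms.induction with
  | of k θ => rw [dTotal_formOf, eps_formOf_succ]
  | add η ζ h h' => rw [map_add, map_add, h, h', add_zero]

theorem parity_dTotal (η : TotalForms R L N) : parity (D.dTotal η) = -D.dTotal (parity η) := by
  induction η using TotalForms.induction with
  | of k θ =>
    rw [parity_formOf, map_smul, dTotal_formOf, parity_formOf, pow_succ, mul_neg_one]
    exact neg_smul ((-1 : ℝ) ^ k) (formOf (k + 1) (D.d θ))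
  | add η ζ h h' => rw [map_add, map_add, map_add, map_add, h, h', neg_add]

theorem lieD_formOf_zero (a : L) (θ : L [⋀^Fin 0]→ₗ[R] N) :
    D.lieD a (formOf 0 θ) = zeroForm (D.cov a (θ ![])) := by
  have : D.lieD a (formOf 0 θ) = formOf 0 ((D.d θ).curryLeft a) := by
    simp only [lieD, LinearMap.add_apply, LinearMap.comp_apply, dTotal_formOf, ins_formOf_zero,
      map_zero, add_zero]
    exact ins_formOf_succ a (D.d θ)
  rw [this, formOf_zero_eq]
  congr 1
  change D.koszul θ (cons a ![] : Fin 1 → L) = _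
  simp [koszul, bracketPart, Fin.removeNth_zero]

theorem lieD_formOf_succ (a : L) {m : ℕ} (θ : L [⋀^Fin (m + 1)]→ₗ[R] N) :
    D.lieD a (formOf (m + 1) θ) = formOf (m + 1) ((D.d θ).curryLeft a + D.d (θ.curryLeft a)) := by
  simp only [lieD, LinearMap.add_apply, LinearMap.comp_apply, dTotal_formOf, ins_formOf_succ, map_add]

theorem lieD_apply (a : L) {m : ℕ} (θ : L [⋀^Fin (m + 1)]→ₗ[R] N) (w : Fin (m + 1) → L) :
    ((D.d θ).curryLeft a + D.d (θ.curryLeft a)) w =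
      D.cov a (θ w) - ∑ j : Fin (m + 1), (-1 : ℤ) ^ (j : ℕ) •
        θ (cons ⁅a, w j⁆ (j.removeNth w) : Fin (m + 1) → L) :=
  D.koszul_cons_add_koszul_curryLeft θ a w

theorem eps_lieD (a : L) (η : TotalForms R L N) : eps (D.lieD a η) = D.cov a (eps η) := by
  induction η using TotalForms.induction with
  | of k θ =>
    cases k with
    | zero => rw [lieD_formOf_zero, eps_zeroForm, eps_formOf_zero]
    | succ k => rw [lieD_formOf_succ, eps_formOf_succ, eps_formOf_succ, map_zero]
  | add η ζ h h' => rw [map_add, map_add, map_add, map_add, h, h']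

/-- In the explicit formula with first argument `b`, the term `j = 0` is the one containing `⁅a,
b⁆`; the others give the Lie derivative of `ins b η` after one transposition. With `eps_lieD` this
is what the coinductions below need of the Lie derivative. -/
theorem ins_lieD (a b : L) (η : TotalForms R L N) :
    ins b (D.lieD a η) = D.lieD a (ins b η) - ins ⁅a, b⁆ η := by
  induction η using TotalForms.induction with
  | of k θ =>
    cases k with
    | zero => simp [lieD_formOf_zero, ins_zeroForm, ins_formOf_zero]
    | succ k =>
      rw [lieD_formOf_succ, ins_formOf_succ, ins_formOf_succ, ins_formOf_succ]
      cases k with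
      | zero =>
        rw [lieD_formOf_zero, formOf_zero_eq, formOf_zero_eq, ← map_sub]
        congr 1
        refine (D.lieD_apply a θ (cons b ![])).trans ?_
        simp [Fin.removeNth_zero]
      | succ k =>
        rw [lieD_formOf_succ, ← map_sub]
        congr 1
        ext w
        refine (D.lieD_apply a θ (cons b w)).trans ?_
        rw [AlternatingMap.sub_apply, lieD_apply, Fin.sum_univ_succ]
        simp only [removeNth_succ_cons, Fin.removeNth_zero, cons_succ, Fin.val_succ]
        have : ∀ j : Fin (k + 1), θ (cons ⁅a, w j⁆ (cons b (j.removeNth w) : Fin (k + 1) → L)) =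
            -θ (cons b (cons ⁅a, w j⁆ (j.removeNth w) : Fin (k + 1) → L)) := fun j =>
          apply_vecCons_cons θ b ⁅a, w j⁆ (j.removeNth w)
        simp only [this, pow_succ, mul_neg_one, neg_smul, smul_neg, neg_neg]
        simp [Matrix.vecCons]
        abel
  | add η ζ h h' =>
    simp only [map_add, h, h']
    abel

theorem parity_lieD (a : L) (η : TotalForms R L N) :
    parity (D.lieD a η) = D.lieD a (parity η) := by
  simp only [lieD, LinearMap.add_apply, LinearMap.comp_apply, map_add, parity_dTotal, ins_parity,
    map_neg]
  rw [← neg_eq_iff_eq_neg.2 (ins_parity a (D.dTotal η)), parity_dTotal, map_neg, neg_neg]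

variable {D}
variable {D₁ : LRConnection R L N₁} {D₂ : LRConnection R L N₂} {D₃ : LRConnection R L N₃}
  {B : N₁ →ₗ[R] N₂ →ₗ[R] N₃}

/-- This precedes the rule for `dTotal` because interior products of `dTotal` produce Lie
derivatives. The hypothesis `h`, that the pairing is parallel, is the degree `0` case. -/
theorem lieD_wdg (h : ∀ a x y, D₃.cov a (B x y) = B (D₁.cov a x) y + B x (D₂.cov a y))
    (a : L) (α : TotalForms R L N₁) (β : TotalForms R L N₂) :
    D₃.lieD a (wdg B α β) = wdg B (D₁.lieD a α) β + wdg B α (D₂.lieD a β) := by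
  rw [← sub_eq_zero]
  let X := fun (α : TotalForms R L N₁) (β : TotalForms R L N₂) =>
    D₃.lieD a (wdg B α β) - (wdg B (D₁.lieD a α) β + wdg B α (D₂.lieD a β))
  refine TotalForms.eq_zero_of_mem {η | ∃ α β, X α β = η} ?_ ?_ ⟨α, β, rfl⟩
  · rintro _ ⟨α, β, rfl⟩
    simp only [X, map_sub, map_add, eps_wdg, eps_lieD, h, sub_self]
  · rintro _ ⟨α, β, rfl⟩ b
    have : ins b (X α β) = X (ins b α) β + X (parity α) (ins b β) := by
      simp only [X, map_sub, map_add, ins_wdg, ins_lieD, parity_lieD, LinearMap.sub_apply]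
      abel
    rw [this]
    exact add_mem (Submodule.subset_span ⟨_, _, rfl⟩) (Submodule.subset_span ⟨_, _, rfl⟩)

/-- The graded Leibniz rule for connections compatible with a pairing. -/
theorem dTotal_wdg (h : ∀ a x y, D₃.cov a (B x y) = B (D₁.cov a x) y + B x (D₂.cov a y))
    (α : TotalForms R L N₁) (β : TotalForms R L N₂) :
    D₃.dTotal (wdg B α β) = wdg B (D₁.dTotal α) β + wdg B (parity α) (D₂.dTotal β) := by
  rw [← sub_eq_zero]
  let X := fun (α : TotalForms R L N₁) (β : TotalForms R L N₂) =>
    D₃.dTotal (wdg B α β) - (wdg B (D₁.dTotal α) β + wdg B (parity α) (D₂.dTotal β))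
  refine TotalForms.eq_zero_of_mem {η | ∃ α β, X α β = η} ?_ ?_ ⟨α, β, rfl⟩
  · rintro _ ⟨α, β, rfl⟩
    simp only [X, map_sub, map_add, eps_wdg, eps_dTotal, map_zero, LinearMap.zero_apply,
      add_zero, sub_self]
  · rintro _ ⟨α, β, rfl⟩ a
    have : ins a (X α β) = -X (ins a α) β - X (parity α) (ins a β) := by
      simp only [X, map_sub, map_add, ins_wdg, ins_dTotal, lieD_wdg h, parity_dTotal, ins_parity,
        parity_parity, LinearMap.sub_apply, map_neg, LinearMap.neg_apply]
      abel
    rw [this]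
    exact sub_mem (neg_mem (Submodule.subset_span ⟨_, _, rfl⟩)) (Submodule.subset_span ⟨_, _, rfl⟩)

theorem lieD_mapForm {D : LRConnection R L N} {D' : LRConnection R L N'} {f : N →ₗ[R] N'}
    (h : ∀ a x, D'.cov a (f x) = f (D.cov a x)) (a : L) (η : TotalForms R L N) :
    D'.lieD a (mapForm f η) = mapForm f (D.lieD a η) := by
  rw [← sub_eq_zero]
  refine TotalForms.eq_zero_of_mem
    {η | ∃ ζ, D'.lieD a (mapForm f ζ) - mapForm f (D.lieD a ζ) = η} ?_ ?_ ⟨η, rfl⟩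
  · rintro _ ⟨ζ, rfl⟩
    simp only [map_sub, eps_lieD, eps_mapForm, h, sub_self]
  · rintro _ ⟨ζ, rfl⟩ b
    refine Submodule.subset_span ⟨ins b ζ, ?_⟩
    simp only [map_sub, ins_lieD, ins_mapForm]
    abel

theorem dTotal_mapForm {D : LRConnection R L N} {D' : LRConnection R L N'} {f : N →ₗ[R] N'}
    (h : ∀ a x, D'.cov a (f x) = f (D.cov a x)) (η : TotalForms R L N) :
    D'.dTotal (mapForm f η) = mapForm f (D.dTotal η) := by
  rw [← sub_eq_zero]
  refine TotalForms.eq_zero_of_mem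
    {η | ∃ ζ, D'.dTotal (mapForm f ζ) - mapForm f (D.dTotal ζ) = η} ?_ ?_ ⟨η, rfl⟩
  · rintro _ ⟨ζ, rfl⟩
    simp only [map_sub, eps_dTotal, eps_mapForm, map_zero, sub_self]
  · rintro _ ⟨ζ, rfl⟩ b
    rw [← neg_neg (ins b _)]
    refine neg_mem (Submodule.subset_span ⟨ins b ζ, ?_⟩)
    simp only [map_sub, ins_dTotal, ins_mapForm, lieD_mapForm h]
    abel

/-- Flatness is the degree `0` case, and the Jacobi identity in `L` makes the defect stable under
interior products. -/
theorem lieD_commutator (h : ∀ a b x, D.cov a (D.cov b x) - D.cov b (D.cov a x) = D.cov ⁅a, b⁆ x)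
    (a b : L) (η : TotalForms R L N) :
    D.lieD a (D.lieD b η) - D.lieD b (D.lieD a η) - D.lieD ⁅a, b⁆ η = 0 := by
  refine TotalForms.eq_zero_of_mem
    {η | ∃ ζ, D.lieD a (D.lieD b ζ) - D.lieD b (D.lieD a ζ) - D.lieD ⁅a, b⁆ ζ = η} ?_ ?_ ⟨η, rfl⟩
  · rintro _ ⟨ζ, rfl⟩
    simp only [map_sub, eps_lieD, h, sub_self]
  · rintro _ ⟨ζ, rfl⟩ c
    refine Submodule.subset_span ⟨ins c ζ, ?_⟩
    have hJ : ins ⁅⁅a, b⁆, c⁆ ζ = ins ⁅a, ⁅b, c⁆⁆ ζ - ins ⁅b, ⁅a, c⁆⁆ ζ := by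
      rw [← ins_sub, lie_lie]
    simp only [map_sub, ins_lieD, hJ]
    abel

/-- An interior product of this commutator is, up to sign, the same commutator on `ins b ζ` plus the
defect of `lieD_commutator`, which is zero. -/
theorem lieD_dTotal (h : ∀ a b x, D.cov a (D.cov b x) - D.cov b (D.cov a x) = D.cov ⁅a, b⁆ x)
    (a : L) (η : TotalForms R L N) : D.lieD a (D.dTotal η) - D.dTotal (D.lieD a η) = 0 := by
  refine TotalForms.eq_zero_of_mem
    {η | ∃ ζ, D.lieD a (D.dTotal ζ) - D.dTotal (D.lieD a ζ) = η} ?_ ?_ ⟨η, rfl⟩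
  · rintro _ ⟨ζ, rfl⟩
    simp only [map_sub, eps_lieD, eps_dTotal, map_zero, sub_self]
  · rintro _ ⟨ζ, rfl⟩ b
    rw [← neg_neg (ins b _)]
    refine neg_mem (Submodule.subset_span ⟨ins b ζ, ?_⟩)
    have hZ := lieD_commutator h a b ζ
    simp only [map_sub, ins_dTotal, ins_lieD]
    rw [← sub_eq_zero, ← hZ]
    abel

/-- The exterior derivative of a flat connection squares to zero. -/
theorem dTotal_dTotal (h : ∀ a b x, D.cov a (D.cov b x) - D.cov b (D.cov a x) = D.cov ⁅a, b⁆ x)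
    (η : TotalForms R L N) : D.dTotal (D.dTotal η) = 0 := by
  refine TotalForms.eq_zero_of_mem {η | ∃ ζ, D.dTotal (D.dTotal ζ) = η} ?_ ?_ ⟨η, rfl⟩
  · rintro _ ⟨ζ, rfl⟩
    exact eps_dTotal ..
  · rintro _ ⟨ζ, rfl⟩ a
    refine Submodule.subset_span ⟨ins a ζ, ?_⟩
    simp only [ins_dTotal, map_sub]
    rw [sub_eq_zero.1 (lieD_dTotal h a ζ)]
    abel

theorem flat_cov (a : L) (f : R) : (flat R L).cov a f = ⁅a, f⁆ := rfl

theorem flat_dTotal_dTotal (η : TotalForms R L R) :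
    (flat R L).dTotal ((flat R L).dTotal η) = 0 :=
  dTotal_dTotal (fun a b x => by simp only [flat_cov, lie_lie]) η

end LRConnection

end Cartan

/-! ### Cut-off frames, tensoriality, homomorphism bundles and traces -/

section Frames

universe u' v'

variable {EM : Type*} [NormedAddCommGroup EM] [NormedSpace ℝ EM] [FiniteDimensional ℝ EM]
  {H : Type*} [TopologicalSpace H] {I : ModelWithCorners ℝ EM H}
  {M : Type*} [TopologicalSpace M] [ChartedSpace H M] [IsManifold I ∞ M] [T2Space M]

namespace SmoothVB

theorem sec_add_apply (E : SmoothVB I M) (s t : E.Sec) (x : M) : (s + t) x = s x + t x := rfl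

/-- Evaluation of sections at a point. -/
def evalAt (E : SmoothVB I M) (x : M) : E.Sec →ₗ[ℝ] E.E x where
  toFun s := s x
  map_add' _ _ := rfl
  map_smul' _ _ := rfl

theorem sec_sum_apply (E : SmoothVB I M) {ι : Type*} (S : Finset ι) (s : ι → E.Sec) (x : M) :
    (∑ i ∈ S, s i) x = ∑ i ∈ S, s i x :=
  map_sum (E.evalAt x) s S

theorem exists_cutoff (x : M) {U : Set M} (hU : U ∈ nhds x) :
    ∃ χ : SmoothFun I M, tsupport χ ⊆ U ∧ χ =ᶠ[nhds x] 1 := by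
  obtain ⟨f, -, hf⟩ := (SmoothBumpFunction.nhds_basis_tsupport (I := I) (c := x)).mem_iff.1 hU
  exact ⟨⟨f, f.contMDiff⟩, hf, f.eventuallyEq_one⟩

variable (E : SmoothVB I M)

/-- The preferred trivialization of `E` at `x₀`. -/
abbrev triv (x₀ : M) := trivializationAt E.F E.E x₀

/-- A basis of the model fibre. -/
abbrev basis : Module.Basis (Fin (Module.finrank ℝ E.F)) ℝ E.F := Module.finBasis ℝ E.F

/-- The local frame at `x₀`, cut off by `χ`. -/
def frameSec {x₀ : M} {χ : SmoothFun I M} (h : tsupport χ ⊆ (E.triv x₀).baseSet)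
    (i : Fin (Module.finrank ℝ E.F)) : E.Sec where
  toFun := (χ : M → ℝ) • (E.triv x₀).localFrame E.basis i
  contMDiff_toFun := ContMDiffOn.smul_section_of_tsupport χ.contMDiff.contMDiffOn
    (E.triv x₀).open_baseSet h ((E.triv x₀).contMDiffOn_localFrame_baseSet ∞ E.basis i)

/-- The local coframe at `x₀`, cut off by `χ`. -/
def frameCoef {x₀ : M} {χ : SmoothFun I M} (h : tsupport χ ⊆ (E.triv x₀).baseSet)
    (i : Fin (Module.finrank ℝ E.F)) : E.Sec →ₗ[SmoothFun I M] SmoothFun I M where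
  toFun s := ⟨fun x => χ x * (E.triv x₀).localFrameCoeff I E.basis i x (s x), by
    refine contMDiff_of_tsupport fun x hx => ?_
    have hx' : x ∈ (E.triv x₀).baseSet := h (closure_mono (support_subset_iff'.2 fun y hy => by
      rw [notMem_support.1 hy, zero_mul]) hx)
    exact (χ.contMDiff x).mul (contMDiffAt_localFrameCoeff E.basis hx' (s.contMDiff x) i)⟩
  map_add' s t := by
    ext x
    change χ x * _ = χ x * _ + χ x * _
    rw [← mul_add, ← map_add]
    rfl
  map_smul' f s := by
    ext x
    change χ x * (E.triv x₀).localFrameCoeff I E.basis i x (f x • s x) = f x * (χ x * _)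
    rw [map_smul, smul_eq_mul, mul_left_comm]

theorem localFrameCoeff_eq_repr {x₀ x : M} (hx : x ∈ (E.triv x₀).baseSet)
    (i : Fin (Module.finrank ℝ E.F)) (v : E.E x) :
    (E.triv x₀).localFrameCoeff I E.basis i x v = ((E.triv x₀).basisAt E.basis hx).repr v i := by
  classical
  simpa only [Function.update_self] using
    (E.triv x₀).localFrameCoeff_apply_of_mem_baseSet (I := I) E.basis hx (Function.update 0 x v) i

theorem frameSec_apply {x₀ : M} {χ : SmoothFun I M} (h : tsupport χ ⊆ (E.triv x₀).baseSet)
    (i : Fin (Module.finrank ℝ E.F)) (x : M) :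
    E.frameSec h i x = χ x • (E.triv x₀).localFrame E.basis i x := rfl

theorem frameCoef_apply {x₀ : M} {χ : SmoothFun I M} (h : tsupport χ ⊆ (E.triv x₀).baseSet)
    (i : Fin (Module.finrank ℝ E.F)) (s : E.Sec) (x : M) :
    E.frameCoef h i s x = χ x * (E.triv x₀).localFrameCoeff I E.basis i x (s x) := rfl

theorem mem_baseSet_of_ne_zero {x₀ : M} {χ : SmoothFun I M} (h : tsupport χ ⊆ (E.triv x₀).baseSet)
    {x : M} (hx : χ x ≠ 0) : x ∈ (E.triv x₀).baseSet :=
  h (subset_tsupport χ hx)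

/-- Frame and coframe are each multiplied by `χ` to become global, so the expansion recovers `χ² s`
and not `s`. The same square appears in all uses of these frames. -/
theorem sum_frameCoef_smul_frameSec {x₀ : M} {χ : SmoothFun I M}
    (h : tsupport χ ⊆ (E.triv x₀).baseSet) (s : E.Sec) :
    ∑ i, E.frameCoef h i s • E.frameSec h i = (χ * χ) • s := by
  ext x
  rw [sec_sum_apply]
  change ∑ i, (χ x * _) • χ x • _ = (χ x * χ x) • s x
  by_cases hx : χ x = 0
  · simp [hx]
  · conv_rhs => rw [(E.triv x₀).eq_sum_localFrameCoeff_smul (s := s) (I := I) (b := E.basis)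
      (E.mem_baseSet_of_ne_zero h hx), Finset.smul_sum]
    refine Finset.sum_congr rfl fun i _ => ?_
    rw [smul_smul, smul_smul]
    congr 1
    ring

theorem frameCoef_frameSec {x₀ : M} {χ : SmoothFun I M}
    (h : tsupport χ ⊆ (E.triv x₀).baseSet) (i j : Fin (Module.finrank ℝ E.F)) :
    E.frameCoef h i (E.frameSec h j) = if i = j then χ * χ else 0 := by
  ext x
  rw [frameCoef_apply, frameSec_apply, map_smul]
  by_cases hx : χ x = 0
  · rw [hx, zero_mul]
    split_ifs
    · exact (show χ x * χ x = 0 by rw [hx, zero_mul]).symm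
    · rfl
  · have hx' := E.mem_baseSet_of_ne_zero h hx
    rw [(E.triv x₀).localFrameCoeff_apply_of_mem_baseSet E.basis hx',
      (E.triv x₀).localFrame_apply_of_mem_baseSet E.basis hx', Module.Basis.repr_self,
      Finsupp.single_apply]
    by_cases hij : i = j
    · subst hij
      simp
    · rw [if_neg hij, if_neg (Ne.symm hij)]
      simp

theorem exists_frame (x : M) : ∃ (χ : SmoothFun I M), tsupport χ ⊆ (E.triv x).baseSet ∧
    χ =ᶠ[nhds x] 1 :=
  exists_cutoff x ((E.triv x).open_baseSet.mem_nhds (FiberBundle.mem_baseSet_trivializationAt' x))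

theorem exists_sec (x : M) (v : E.E x) : ∃ s : E.Sec, s x = v := by
  obtain ⟨χ, h, h1⟩ := E.exists_frame x
  refine ⟨∑ i, ((E.triv x).localFrameCoeff I E.basis i x v) • E.frameSec h i, ?_⟩
  rw [sec_sum_apply]
  have hx : x ∈ (E.triv x).baseSet := FiberBundle.mem_baseSet_trivializationAt' x
  classical
  have := (E.triv x).eq_sum_localFrameCoeff_smul (I := I) (b := E.basis) hx
    (s := Function.update 0 x v)
  rw [Function.update_self] at this
  conv_rhs => rw [this]
  refine Finset.sum_congr rfl fun i _ => ?_
  refine congrArg (fun t : E.E x => (E.triv x).localFrameCoeff I E.basis i x v • t) ?_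
  rw [frameSec_apply, h1.eq_of_nhds, Pi.one_apply, one_smul]

/-- The value of a section of `Hom(E, E')` at a point, as a linear map. -/
def homFib {E E' : SmoothVB I M} (φ : (E.hom E').Sec) (x : M) : E.E x →L[ℝ] E'.E x := φ x

theorem homEval_apply (E E' : SmoothVB I M) (φ : (E.hom E').Sec) (s : E.Sec) (x : M) :
    E.homEval E' φ s x = homFib φ x (s x) := rfl

theorem trace_apply (φ : (E.hom E).Sec) (x : M) :
    E.trace φ x = LinearMap.trace ℝ (E.E x) (homFib φ x : E.E x →ₗ[ℝ] E.E x) := rfl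

theorem homEval_injective (E E' : SmoothVB I M) : Injective (E.homEval E') := by
  intro φ ψ h
  ext x
  refine ContinuousLinearMap.ext (M₁ := E.E x) (M₂ := E'.E x) fun v => ?_
  obtain ⟨s, rfl⟩ := E.exists_sec x v
  have := congrArg (fun T => (T s) x) h
  exact this

variable {E} {E' : SmoothVB I M}

/-- A `C^∞(M)`-linear map of sections, evaluated with the help of a cut off frame. -/
theorem linearMap_apply_eq_sum (T : E.Sec →ₗ[SmoothFun I M] E'.Sec) {x₀ : M} {χ : SmoothFun I M}
    (h : tsupport χ ⊆ (E.triv x₀).baseSet) (s : E.Sec) {x : M} (hx : χ x = 1) :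
    T s x = ∑ i, (E.triv x₀).localFrameCoeff I E.basis i x (s x) • T (E.frameSec h i) x := by
  have h1 : T ((χ * χ) • s) x = T s x := by
    rw [map_smul]
    change (χ x * χ x) • T s x = T s x
    rw [hx, one_mul, one_smul]
  rw [← h1, ← E.sum_frameCoef_smul_frameSec h, map_sum, sec_sum_apply]
  refine Finset.sum_congr rfl fun i _ => ?_
  rw [map_smul, smul_sec_apply, frameCoef_apply, hx, one_mul]

/-- Tensoriality: in a frame whose cut-off is `1` at `x`, only the coefficients of `s x` enter. This
makes `fiberMap` independent of the chosen extension of a vector. -/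
theorem linearMap_congr (T : E.Sec →ₗ[SmoothFun I M] E'.Sec) {s t : E.Sec} {x : M}
    (hst : s x = t x) : T s x = T t x := by
  obtain ⟨χ, h, h1⟩ := E.exists_frame x
  rw [linearMap_apply_eq_sum T h s h1.eq_of_nhds, linearMap_apply_eq_sum T h t h1.eq_of_nhds, hst]

/-- The fibre of a `C^∞(M)`-linear map of sections. -/
def fiberMap (T : E.Sec →ₗ[SmoothFun I M] E'.Sec) (x : M) : E.E x →L[ℝ] E'.E x :=
  haveI : T2Space (E.E x) := FiberBundle.t2Space E.F E.E x
  haveI : FiniteDimensional ℝ (E.E x) := VectorBundle.finiteDimensional ℝ E.F E.E x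
  LinearMap.toContinuousLinearMap
    { toFun := fun v => T (E.exists_sec x v).choose x
      map_add' := fun v w => by
        rw [← sec_add_apply, ← map_add]
        refine linearMap_congr T ?_
        rw [sec_add_apply, (E.exists_sec x _).choose_spec, (E.exists_sec x _).choose_spec,
          (E.exists_sec x _).choose_spec]
      map_smul' := fun c v => by
        change _ = (algebraMap ℝ (SmoothFun I M) c • T (E.exists_sec x v).choose) x
        rw [← map_smul]
        refine linearMap_congr T ?_
        rw [(E.exists_sec x _).choose_spec, smul_sec_apply, (E.exists_sec x _).choose_spec]
        rfl }

theorem fiberMap_apply (T : E.Sec →ₗ[SmoothFun I M] E'.Sec) (x : M) (s : E.Sec) :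
    fiberMap T x (s x) = T s x :=
  linearMap_congr T (E.exists_sec x (s x)).choose_spec

/-- The section of `Hom(E, E')` defined by a `C^∞(M)`-linear map of sections. -/
def homOfLinear (T : E.Sec →ₗ[SmoothFun I M] E'.Sec) : (E.hom E').Sec where
  toFun x := (fiberMap T x : E.E x →L[ℝ] E'.E x)
  contMDiff_toFun := by
    intro x₀
    refine (contMDiffAt_hom_bundle (F₁ := E.F) (F₂ := E'.F) (E₁ := E.E) (E₂ := E'.E)
      (fun x => TotalSpace.mk' (E.F →L[ℝ] E'.F) x (fiberMap T x))).2 ⟨contMDiffAt_id, ?_⟩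
    obtain ⟨χ, h, h1⟩ := E.exists_frame x₀
    -- `C` assembles a linear map from its columns. In the trivializations at `x₀` the columns are
    -- the coordinates of `T (E.frameSec h i)`, which are smooth; near `x₀` the cut-off is `1`, so
    -- they are the images of the true frame.
    let C : (Fin (Module.finrank ℝ E.F) → E'.F) →L[ℝ] (E.F →L[ℝ] E'.F) :=
      LinearMap.toContinuousLinearMap (LinearMap.toContinuousLinearMap.toLinearMap ∘ₗ
        (E.basis.constr ℝ (M' := E'.F)).toLinearMap)
    have hs : ContMDiffAt I 𝓘(ℝ, Fin (Module.finrank ℝ E.F) → E'.F) ∞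
        (fun x i => ((E'.triv x₀) ⟨x, T (E.frameSec h i) x⟩).2) x₀ :=
      contMDiffAt_pi_space.2 fun i =>
        (Trivialization.contMDiffAt_section_iff (e := E'.triv x₀)
          (FiberBundle.mem_baseSet_trivializationAt' x₀)).1 ((T (E.frameSec h i)).contMDiff x₀)
    refine (C.contMDiff.contMDiffAt.comp x₀ hs).congr_of_eventuallyEq ?_
    filter_upwards [h1, (E.triv x₀).open_baseSet.mem_nhds
      (FiberBundle.mem_baseSet_trivializationAt' x₀), (E'.triv x₀).open_baseSet.mem_nhds
      (FiberBundle.mem_baseSet_trivializationAt' x₀)] with x hx hx1 hx2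
    change ContinuousLinearMap.inCoordinates E.F E.E E'.F E'.E x₀ x x₀ x (fiberMap T x) = _
    rw [ContinuousLinearMap.inCoordinates_eq hx1 hx2]
    refine ContinuousLinearMap.coe_injective (E.basis.ext fun i => ?_)
    have hf : E.frameSec h i x =
        ((E.triv x₀).continuousLinearEquivAt ℝ x hx1).symm (E.basis i) := by
      rw [frameSec_apply, hx, Pi.one_apply, one_smul,
        (E.triv x₀).localFrame_apply_of_mem_baseSet E.basis hx1]
      rfl
    change (E'.triv x₀).continuousLinearEquivAt ℝ x hx2 (fiberMap T x
      (((E.triv x₀).continuousLinearEquivAt ℝ x hx1).symm (E.basis i))) = _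
    rw [← hf, fiberMap_apply]
    change _ = (E.basis.constr ℝ (M' := E'.F)) _ (E.basis i)
    rw [Module.Basis.constr_basis]
    rfl

theorem homEval_homOfLinear (T : E.Sec →ₗ[SmoothFun I M] E'.Sec) :
    E.homEval E' (homOfLinear T) = T := by
  ext s x
  exact fiberMap_apply T x s

theorem homEval_bijective (E E' : SmoothVB I M) : Bijective (E.homEval E') :=
  ⟨homEval_injective E E', fun T => ⟨homOfLinear T, homEval_homOfLinear T⟩⟩

/-- `Γ(Hom(E, E')) = Hom(Γ(E), Γ(E'))`. -/
def homEquiv (E E' : SmoothVB I M) :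
    (E.hom E').Sec ≃ₗ[SmoothFun I M] (E.Sec →ₗ[SmoothFun I M] E'.Sec) :=
  LinearEquiv.ofBijective (E.homEval E') (homEval_bijective E E')

/-- Composition `Γ(Hom(E', E'')) × Γ(Hom(E, E')) → Γ(Hom(E, E''))`. -/
def homComp (E E' E'' : SmoothVB I M) :
    (E'.hom E'').Sec →ₗ[SmoothFun I M] (E.hom E').Sec →ₗ[SmoothFun I M] (E.hom E'').Sec :=
  LinearMap.mk₂ (SmoothFun I M)
    (fun φ ψ => (homEquiv E E'').symm (E'.homEval E'' φ ∘ₗ E.homEval E' ψ))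
    (fun φ φ' ψ => by rw [map_add, LinearMap.add_comp, map_add])
    (fun f φ ψ => by rw [map_smul, LinearMap.smul_comp, map_smul])
    (fun φ ψ ψ' => by rw [map_add, LinearMap.comp_add, map_add])
    (fun f φ ψ => by rw [map_smul, LinearMap.comp_smul, map_smul])

theorem homEval_homComp {E'' : SmoothVB I M} (φ : (E'.hom E'').Sec) (ψ : (E.hom E').Sec)
    (s : E.Sec) : E.homEval E'' (homComp E E' E'' φ ψ) s = E'.homEval E'' φ (E.homEval E' ψ s) :=
  congrArg (fun T => T s) ((homEquiv E E'').apply_symm_apply (E'.homEval E'' φ ∘ₗ E.homEval E' ψ))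

theorem homFib_homComp {E'' : SmoothVB I M} (φ : (E'.hom E'').Sec) (ψ : (E.hom E').Sec) (x : M) :
    homFib (homComp E E' E'' φ ψ) x = homFib φ x ∘L homFib ψ x := by
  ext v
  obtain ⟨s, rfl⟩ := E.exists_sec x v
  exact congrArg (fun t => t x) (homEval_homComp φ ψ s)

theorem trace_homComp (φ : (E'.hom E).Sec) (ψ : (E.hom E').Sec) :
    E.trace (homComp E E' E φ ψ) = E'.trace (homComp E' E E' ψ φ) := by
  ext x
  rw [trace_apply, trace_apply, homFib_homComp,
    homFib_homComp]
  have : FiniteDimensional ℝ (E.E x) := VectorBundle.finiteDimensional ℝ E.F E.E x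
  have : FiniteDimensional ℝ (E'.E x) := VectorBundle.finiteDimensional ℝ E'.F E'.E x
  exact LinearMap.trace_comp_comm' _ _

/-- The trace in terms of a cut off frame. -/
theorem trace_eq_sum (φ : (E.hom E).Sec) {x₀ : M} {χ : SmoothFun I M}
    (h : tsupport χ ⊆ (E.triv x₀).baseSet) :
    (χ * χ) * E.trace φ = ∑ i, E.frameCoef h i (E.homEval E φ (E.frameSec h i)) := by
  ext x
  change (χ x * χ x) * E.trace φ x = _
  rw [trace_apply]
  have hsum : (∑ i, E.frameCoef h i (E.homEval E φ (E.frameSec h i))) x =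
      ∑ i, E.frameCoef h i (E.homEval E φ (E.frameSec h i)) x :=
    map_sum (ContMDiffMap.evalRingHom x : SmoothFun I M →+* ℝ) _ _
  rw [hsum]
  by_cases hx : χ x = 0
  · simp [frameCoef_apply, hx]
  · have hx' := E.mem_baseSet_of_ne_zero h hx
    rw [LinearMap.trace_eq_matrix_trace ℝ ((E.triv x₀).basisAt E.basis hx'), Matrix.trace,
      Finset.mul_sum]
    refine Finset.sum_congr rfl fun i _ => ?_
    rw [frameCoef_apply, homEval_apply, frameSec_apply, map_smul, map_smul, Matrix.diag_apply,
      LinearMap.toMatrix_apply, (E.triv x₀).localFrame_apply_of_mem_baseSet E.basis hx',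
      E.localFrameCoeff_eq_repr hx', smul_eq_mul, mul_assoc]
    rfl

end SmoothVB

end Frames

/-! ### Traces of covariant derivatives and hom connections, algebraically -/

section Algebra

variable {R L : Type*} [CommRing R] [Algebra ℝ R] [LieRing L] [Module R L] [LieRingModule L R]
  [LieRinehartRing R L] [LieAlgebra ℝ L] [LieRinehartAlgebra ℝ R L]
variable {N N' P : Type*}
  [AddCommGroup N] [Module R N] [Module ℝ N] [IsScalarTower ℝ R N]
  [AddCommGroup N'] [Module R N'] [Module ℝ N'] [IsScalarTower ℝ R N']
  [AddCommGroup P] [Module R P] [Module ℝ P] [IsScalarTower ℝ R P]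

namespace LRConnection

theorem lie_finsetSum {ι : Type*} (S : Finset ι) (a : L) (f : ι → R) :
    ⁅a, ∑ i ∈ S, f i⁆ = ∑ i ∈ S, ⁅a, f i⁆ :=
  map_sum (AddMonoidHom.mk' (fun f : R => ⁅a, f⁆) fun f g => lie_add a f g) f S

/-- The trace, in terms of a frame up to the factor `g`, of the covariant derivative of an
endomorphism. -/
theorem sum_coef_covariant (D : LRConnection R L N) {ι : Type*} [Fintype ι] [DecidableEq ι]
    (e : ι → N) (c : ι → N →ₗ[R] R) (g : R) (hexp : ∀ s, g • s = ∑ i, c i s • e i)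
    (hc : ∀ i j, c i (e j) = if i = j then g else 0) (a : L) (φ : N →ₗ[R] N) :
    g * ∑ i, c i (D.cov a (φ (e i)) - φ (D.cov a (e i))) =
      g * ⁅a, ∑ i, c i (φ (e i))⁆ - ⁅a, g⁆ * ∑ i, c i (φ (e i)) := by
  -- Differentiating the expansion of `g • φ (e i)` creates, by the Leibniz rule, the correction
  -- with `⁅a, g⁆`.
  have h3 : ∀ i, g * c i (D.cov a (φ (e i))) =
      ∑ j, (c j (φ (e i)) * c i (D.cov a (e j)) + ⁅a, c j (φ (e i))⁆ * c i (e j)) -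
      ⁅a, g⁆ * c i (φ (e i)) := by
    intro i
    have h4 := congrArg (fun s => c i (D.cov a s)) (hexp (φ (e i)))
    simp only [D.leibniz, map_add, map_sum, map_smul, smul_eq_mul] at h4
    rw [← h4, add_sub_cancel_right]
  have h5 : ∀ i, g * c i (φ (D.cov a (e i))) =
      ∑ j, c j (D.cov a (e i)) * c i (φ (e j)) := by
    intro i
    have h4 := congrArg (fun s => c i (φ s)) (hexp (D.cov a (e i)))
    simpa only [map_sum, map_smul, smul_eq_mul] using h4
  have h7 : ∑ i, ∑ j, ⁅a, c j (φ (e i))⁆ * c i (e j) = ∑ i, g * ⁅a, c i (φ (e i))⁆ := by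
    refine Finset.sum_congr rfl fun i _ => ?_
    simp only [hc, mul_ite, mul_zero, Finset.sum_ite_eq, Finset.mem_univ, if_true]
    exact mul_comm _ _
  -- The products of the connection matrix with that of `φ`, in the two orders, have the same trace
  -- and cancel in the difference.
  have h8 : ∑ i, ∑ j, c j (D.cov a (e i)) * c i (φ (e j)) =
      ∑ i, ∑ j, c j (φ (e i)) * c i (D.cov a (e j)) := by
    rw [Finset.sum_comm]
    exact Finset.sum_congr rfl fun i _ => Finset.sum_congr rfl fun j _ => mul_comm _ _
  rw [lie_finsetSum, Finset.mul_sum, Finset.mul_sum, Finset.mul_sum]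
  simp only [map_sub, mul_sub, h3, h5]
  rw [Finset.sum_sub_distrib, Finset.sum_sub_distrib]
  simp only [Finset.sum_add_distrib]
  rw [h7, h8]
  abel

/-- The covariant derivative of a linear map. -/
def covLinear (D : LRConnection R L N) (D' : LRConnection R L N') (a : L) (φ : N →ₗ[R] N') :
    N →ₗ[R] N' where
  toFun s := D'.cov a (φ s) - φ (D.cov a s)
  map_add' s t := by
    simp only [map_add]
    abel
  map_smul' f s := by
    simp only [map_smul, D.leibniz, D'.leibniz, map_add, RingHom.id_apply, smul_sub]
    abel

/-- The connection on `Hom(N, N')` induced by two connections. -/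
def hom (D : LRConnection R L N) (D' : LRConnection R L N') (e : P ≃ₗ[R] (N →ₗ[R] N')) :
    LRConnection R L P where
  cov := LinearMap.mk₂' R ℝ (fun a φ => e.symm (covLinear D D' a (e φ)))
    (fun a b φ => by
      rw [← map_add]
      congr 1
      ext1 s
      simp only [covLinear, map_add, LinearMap.add_apply, LinearMap.coe_mk, AddHom.coe_mk]
      abel)
    (fun f a φ => by
      rw [← map_smul]
      congr 1
      ext1 s
      simp only [covLinear, map_smul, LinearMap.smul_apply, LinearMap.coe_mk, AddHom.coe_mk,
        smul_sub])
    (fun a φ ψ => by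
      rw [← map_add]
      congr 1
      ext1 s
      simp only [covLinear, map_add, LinearMap.add_apply, LinearMap.coe_mk, AddHom.coe_mk]
      abel)
    (fun r a φ => by
      have h1 : e (r • φ) = algebraMap ℝ R r • e φ := by rw [← map_smul e, algebraMap_smul]
      rw [← algebraMap_smul R r (e.symm _), ← map_smul e.symm, h1]
      congr 1
      ext1 s
      simp only [covLinear, LinearMap.smul_apply, LinearMap.coe_mk, AddHom.coe_mk, map_smul,
        smul_sub, algebraMap_smul])
  leibniz a f φ := by
    apply e.injective
    rw [map_add e, map_smul e, map_smul e]
    simp only [LinearMap.mk₂'_apply, LinearEquiv.apply_symm_apply]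
    rw [map_smul e]
    ext1 s
    simp only [covLinear, LinearMap.smul_apply, LinearMap.coe_mk, AddHom.coe_mk,
      LinearMap.add_apply, D'.leibniz, smul_sub]
    abel

theorem hom_cov_apply (D : LRConnection R L N) (D' : LRConnection R L N')
    (e : P ≃ₗ[R] (N →ₗ[R] N')) (a : L) (φ : P) (s : N) :
    e ((hom D D' e).cov a φ) s = D'.cov a (e φ s) - e φ (D.cov a s) :=
  congrArg (fun T => T s) (e.apply_symm_apply (covLinear D D' a (e φ)))

end LRConnection

end Algebra

/-! ### Linear connections: compatibility with the trace, and existence -/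

section Connections

variable {EM : Type*} [NormedAddCommGroup EM] [NormedSpace ℝ EM] [FiniteDimensional ℝ EM]
  {H : Type*} [TopologicalSpace H] {I : ModelWithCorners ℝ EM H}
  {M : Type*} [TopologicalSpace M] [ChartedSpace H M] [IsManifold I ∞ M] [T2Space M]
  {A : SmoothVB I M} {𝒜 : LieAlgebroid A} {E : SmoothVB I M}

namespace LieAlgebroid

theorem lie_apply_eq_zero (a : 𝒜.Sec) {f : SmoothFun I M} {c : ℝ} {x : M}
    (hf : f =ᶠ[nhds x] fun _ => c) : (⁅a, f⁆ : SmoothFun I M) x = 0 := by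
  change mfderiv I 𝓘(ℝ, ℝ) f x _ = 0
  rw [hf.mfderiv_eq, mfderiv_const]
  rfl

/-- The trace of the derivative of an endomorphism is the derivative of its trace. -/
theorem trace_covariant (D : 𝒜.Connection E) (a : 𝒜.Sec) (φ ψ : (E.hom E).Sec)
    (hψ : ∀ s, E.homEval E ψ s = D.cov a (E.homEval E φ s) - E.homEval E φ (D.cov a s)) :
    E.trace ψ = ⁅a, E.trace φ⁆ := by
  ext x
  obtain ⟨χ, h, h1⟩ := E.exists_frame x
  -- Since `g` is `1` near `x`, its derivative along `a` vanishes at `x`, and evaluating the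
  -- algebraic identity at `x` removes all factors `g`.
  set g : SmoothFun I M := χ * χ with hg
  have hgx : g x = 1 := by
    change χ x * χ x = 1
    rw [h1.eq_of_nhds, Pi.one_apply, one_mul]
  have hg1 : g =ᶠ[nhds x] fun _ => (1 : ℝ) := by
    filter_upwards [h1] with y hy
    change χ y * χ y = 1
    rw [hy, Pi.one_apply, one_mul]
  have hag : (⁅a, g⁆ : SmoothFun I M) x = 0 := lie_apply_eq_zero a hg1
  have h6 := D.sum_coef_covariant (E.frameSec h) (E.frameCoef h) g
    (fun s => (E.sum_frameCoef_smul_frameSec h s).symm) (E.frameCoef_frameSec h) a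
    (E.homEval E φ)
  simp only [← hψ] at h6
  rw [← SmoothVB.trace_eq_sum φ h, ← SmoothVB.trace_eq_sum ψ h] at h6
  have h9 := congrArg (fun f : SmoothFun I M => f x) h6
  change g x * (g x * E.trace ψ x) = g x * (⁅a, g * E.trace φ⁆ : SmoothFun I M) x -
    (⁅a, g⁆ : SmoothFun I M) x * (g x * E.trace φ x) at h9
  rw [LieRinehartRing.leibniz_mul_right, hgx, hag] at h9
  change 1 * (1 * E.trace ψ x) = 1 * (g x * (⁅a, E.trace φ⁆ : SmoothFun I M) x +
    (⁅a, g⁆ : SmoothFun I M) x * E.trace φ x) - _ at h9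
  rw [hgx, hag] at h9
  linarith

variable (𝒜) in
/-- The connection on the hom bundle induced by two connections. -/
def homConnection {E E' : SmoothVB I M} (D : 𝒜.Connection E) (D' : 𝒜.Connection E') :
    𝒜.Connection (E.hom E') :=
  LRConnection.hom D D' (SmoothVB.homEquiv E E')

theorem homEval_homConnection {E E' : SmoothVB I M} (D : 𝒜.Connection E) (D' : 𝒜.Connection E')
    (a : 𝒜.Sec) (φ : (E.hom E').Sec) (s : E.Sec) :
    E.homEval E' ((𝒜.homConnection D D').cov a φ) s =
      D'.cov a (E.homEval E' φ s) - E.homEval E' φ (D.cov a s) :=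
  LRConnection.hom_cov_apply D D' (SmoothVB.homEquiv E E') a φ s

theorem trace_homConnection (D : 𝒜.Connection E) (a : 𝒜.Sec) (φ : (E.hom E).Sec) :
    (LRConnection.flat (SmoothFun I M) 𝒜.Sec).cov a (E.trace φ) =
      E.trace ((𝒜.homConnection D D).cov a φ) :=
  (trace_covariant D a φ _ (homEval_homConnection D D a φ)).symm

section Existence

variable (𝒜 E) in
/-- The flat connection of a local frame, cut off by `χ`. -/
def cutoffConnection {x₀ : M} {χ : SmoothFun I M} (h : tsupport χ ⊆ (E.triv x₀).baseSet) :
    𝒜.Sec →ₗ[SmoothFun I M] E.Sec →ₗ[ℝ] E.Sec :=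
  LinearMap.mk₂' (SmoothFun I M) ℝ (fun a s => ∑ i, ⁅a, E.frameCoef h i s⁆ • E.frameSec h i)
    (fun a b s => by
      rw [← Finset.sum_add_distrib]
      exact Finset.sum_congr rfl fun i _ => by rw [add_lie, add_smul])
    (fun f a s => by
      rw [Finset.smul_sum]
      exact Finset.sum_congr rfl fun i _ => by
        rw [LieRinehartRing.lie_smul_eq_mul, mul_smul])
    (fun a s t => by
      rw [← Finset.sum_add_distrib]
      exact Finset.sum_congr rfl fun i _ => by rw [map_add, lie_add, add_smul])
    (fun c a s => by
      rw [Finset.smul_sum]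
      refine Finset.sum_congr rfl fun i _ => ?_
      rw [← algebraMap_smul (SmoothFun I M) c s, map_smul, algebraMap_smul, lie_smul, smul_assoc])

/-- The Leibniz rule holds with weight `χ²`, so cut-off connections can be glued with total weight
one. -/
theorem cutoffConnection_smul {x₀ : M} {χ : SmoothFun I M} (h : tsupport χ ⊆ (E.triv x₀).baseSet)
    (a : 𝒜.Sec) (f : SmoothFun I M) (s : E.Sec) :
    𝒜.cutoffConnection E h a (f • s) =
      f • 𝒜.cutoffConnection E h a s + (⁅a, f⁆ * (χ * χ)) • s := by
  rw [mul_smul, ← E.sum_frameCoef_smul_frameSec h]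
  simp only [cutoffConnection, LinearMap.mk₂'_apply, Finset.smul_sum]
  rw [← Finset.sum_add_distrib]
  refine Finset.sum_congr rfl fun i _ => ?_
  rw [map_smul, smul_eq_mul, LieRinehartRing.leibniz_mul_right, add_smul, mul_smul, smul_assoc]

theorem cutoffConnection_apply_eq_zero {x₀ : M} {χ : SmoothFun I M}
    (h : tsupport χ ⊆ (E.triv x₀).baseSet) (a : 𝒜.Sec) (s : E.Sec) {x : M} (hx : χ x = 0) :
    𝒜.cutoffConnection E h a s x = 0 := by
  simp only [cutoffConnection, LinearMap.mk₂'_apply]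
  rw [SmoothVB.sec_sum_apply]
  refine Finset.sum_eq_zero fun i _ => ?_
  rw [SmoothVB.smul_sec_apply, SmoothVB.frameSec_apply, hx, zero_smul, smul_zero]

/-- Local flat connections are glued along a partition of unity `ρ`. Each has weight `ρ_j²`, so the
sum is divided by `G = ∑ ρ_j²`, which has no zeros because the `ρ_j` sum to `1`. -/
theorem nonempty_connection [SigmaCompactSpace M] : Nonempty (𝒜.Connection E) := by
  obtain ⟨ρ, hρ⟩ := SmoothPartitionOfUnity.exists_isSubordinate I isClosed_univ
    (fun x : M => (E.triv x).baseSet) (fun x => (E.triv x).open_baseSet) (fun x _ =>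
      Set.mem_iUnion_of_mem x (FiberBundle.mem_baseSet_trivializationAt' x))
  let T := fun j : M => 𝒜.cutoffConnection E (χ := ρ j) (hρ j)
  let G : M → ℝ := fun x => ∑ᶠ j, ρ j x * ρ j x
  have hsum : ∀ x, G x = ∑ j ∈ ρ.finsupport x, ρ j x * ρ j x := fun x =>
    finsum_eq_sum_of_support_subset _ fun j hj => by
      rw [ρ.coe_finsupport]
      exact left_ne_zero_of_mul hj
  have hG : ContMDiff I 𝓘(ℝ, ℝ) ∞ G := by
    refine contMDiff_finsum (fun j => (ρ j).contMDiff.mul (ρ j).contMDiff) ?_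
    exact ρ.locallyFinite.subset fun j x hx => left_ne_zero_of_mul hx
  have hG0 : ∀ x, G x ≠ 0 := by
    intro x h0
    rw [hsum, Finset.sum_eq_zero_iff_of_nonneg fun j _ => mul_self_nonneg _] at h0
    have h1 := ρ.sum_finsupport x (Set.mem_univ x)
    rw [Finset.sum_eq_zero fun j hj => mul_self_eq_zero.1 (h0 j hj)] at h1
    exact zero_ne_one h1
  have hTsum : ∀ (a : 𝒜.Sec) (s : E.Sec) (x : M),
      ∑ᶠ j, T j a s x = ∑ j ∈ ρ.finsupport x, T j a s x := fun a s x =>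
    finsum_eq_sum_of_support_subset _ fun j hj => by
      rw [ρ.coe_finsupport]
      exact fun h0 => hj (cutoffConnection_apply_eq_zero (hρ j) a s h0)
  let g : SmoothFun I M := ⟨fun x => (G x)⁻¹, fun x => (hG x).inv₀ (hG0 x)⟩
  let C : 𝒜.Sec → E.Sec → E.Sec := fun a s => g • ⟨fun x => ∑ᶠ j, T j a s x,
    ContMDiff.finsum_section_of_locallyFinite (ρ.locallyFinite.subset fun j x hx h0 =>
      hx (cutoffConnection_apply_eq_zero (hρ j) a s h0)) fun j => (T j a s).contMDiff⟩
  have hC : ∀ a s x, C a s x = (G x)⁻¹ • ∑ j ∈ ρ.finsupport x, T j a s x := fun a s x =>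
    congrArg (fun t : E.E x => (G x)⁻¹ • t) (hTsum a s x)
  refine ⟨⟨LinearMap.mk₂' (SmoothFun I M) ℝ C ?_ ?_ ?_ ?_, ?_⟩⟩
  · intro a b s
    ext x
    rw [SmoothVB.sec_add_apply, hC, hC, hC, ← smul_add, ← Finset.sum_add_distrib]
    simp only [map_add, LinearMap.add_apply, SmoothVB.sec_add_apply]
  · intro f a s
    ext x
    change C (f • a) s x = f x • C a s x
    rw [hC, hC, smul_comm (f x), Finset.smul_sum (r := f x)]
    simp only [map_smul, LinearMap.smul_apply, SmoothVB.smul_sec_apply]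
  · intro a s t
    ext x
    rw [SmoothVB.sec_add_apply, hC, hC, hC, ← smul_add, ← Finset.sum_add_distrib]
    simp only [map_add, SmoothVB.sec_add_apply]
  · intro c a s
    ext x
    change C a (c • s) x = c • C a s x
    rw [hC, hC, smul_comm c, Finset.smul_sum (r := c)]
    simp only [map_smul]
    rfl
  · intro a f s
    ext x
    change C a (f • s) x = f x • C a s x + (⁅a, f⁆ : SmoothFun I M) x • s x
    have h1 : ∀ j, T j a (f • s) x =
        f x • T j a s x + ((⁅a, f⁆ : SmoothFun I M) x * (ρ j x * ρ j x)) • s x := fun j =>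
      congrArg (fun t : E.Sec => t x) (cutoffConnection_smul (hρ j) a f s)
    rw [hC, hC]
    simp only [h1]
    rw [Finset.sum_add_distrib, ← Finset.smul_sum, ← Finset.sum_smul, ← Finset.mul_sum, ← hsum,
      smul_add, smul_smul, smul_smul, mul_comm _ (G x), inv_mul_cancel_left₀ (hG0 x), smul_comm,
      smul_smul, mul_comm]

end Existence

end LieAlgebroid

end Connections

/-! ### Koszul signs -/

section Signs

variable {R L : Type*} [CommRing R] [Algebra ℝ R] [LieRing L] [Module R L] [LieRingModule L R]
  [LieRinehartRing R L] [LieAlgebra ℝ L] [LieRinehartAlgebra ℝ R L]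
variable {N N' N₁ N₂ : Type*}
  [AddCommGroup N] [Module R N] [Module ℝ N] [IsScalarTower ℝ R N]
  [AddCommGroup N'] [Module R N'] [Module ℝ N'] [IsScalarTower ℝ R N']
  [AddCommGroup N₁] [Module R N₁] [Module ℝ N₁] [IsScalarTower ℝ R N₁]
  [AddCommGroup N₂] [Module R N₂] [Module ℝ N₂] [IsScalarTower ℝ R N₂]

theorem koszulSign_of_even {p : ℤ} (hp : Even p) (η : TotalForms R L N) : koszulSign p η = η := by
  rw [koszulSign, if_pos hp]
  rfl

theorem koszulSign_of_odd {p : ℤ} (hp : Odd p) (η : TotalForms R L N) :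
    koszulSign p η = parity η := by
  rw [koszulSign, if_neg (Int.not_even_iff_odd.2 hp)]

theorem koszulSign_one (η : TotalForms R L N) : koszulSign 1 η = parity η :=
  koszulSign_of_odd odd_one η

theorem koszulSign_add (p q : ℤ) (η : TotalForms R L N) :
    koszulSign (p + q) η = koszulSign p (koszulSign q η) := by
  rcases Int.even_or_odd p with hp | hp <;> rcases Int.even_or_odd q with hq | hq
  · rw [koszulSign_of_even (hp.add hq), koszulSign_of_even hp, koszulSign_of_even hq]
  · rw [koszulSign_of_odd (hp.add_odd hq), koszulSign_of_even hp, koszulSign_of_odd hq]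
  · rw [koszulSign_of_odd (hp.add_even hq), koszulSign_of_odd hp, koszulSign_of_even hq]
  · rw [koszulSign_of_even (hp.add_odd hq), koszulSign_of_odd hp, koszulSign_of_odd hq,
      parity_parity]

theorem koszulSign_zeroForm (p : ℤ) (e : N) :
    koszulSign p (zeroForm e : TotalForms R L N) = zeroForm e := by
  rcases Int.even_or_odd p with hp | hp
  · rw [koszulSign_of_even hp]
  · rw [koszulSign_of_odd hp, parity_zeroForm]

theorem koszulSign_wdg (p : ℤ) (B : N₁ →ₗ[R] N₂ →ₗ[R] N) (α : TotalForms R L N₁)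
    (β : TotalForms R L N₂) :
    koszulSign p (wdg B α β) = wdg B (koszulSign p α) (koszulSign p β) := by
  rcases Int.even_or_odd p with hp | hp
  · simp only [koszulSign_of_even hp]
  · simp only [koszulSign_of_odd hp, parity_wdg]

theorem koszulSign_dTotal (D : LRConnection R L N) (p : ℤ) (η : TotalForms R L N) :
    koszulSign p (D.dTotal η) = (-1 : ℝ) ^ p • D.dTotal (koszulSign p η) := by
  rcases Int.even_or_odd p with hp | hp
  · simp only [koszulSign_of_even hp, hp.neg_one_zpow, one_smul]
  · rw [koszulSign_of_odd hp, koszulSign_of_odd hp, hp.neg_one_zpow, D.parity_dTotal]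
    exact (neg_one_smul ℝ (D.dTotal (parity η))).symm

theorem parity_formOf_of_even {k : ℕ} (hk : Even k) (θ : L [⋀^Fin k]→ₗ[R] N) :
    parity (formOf k θ) = formOf k θ := by
  rw [parity_formOf, hk.neg_one_pow, one_smul]

theorem parity_formOf_of_odd {k : ℕ} (hk : Odd k) (θ : L [⋀^Fin k]→ₗ[R] N) :
    parity (formOf k θ) = -formOf k θ := by
  rw [parity_formOf, hk.neg_one_pow]
  exact neg_one_smul ℝ (formOf k θ)

theorem wdg_comm_formOf {B : N₁ →ₗ[R] N₂ →ₗ[R] N} {B' : N₂ →ₗ[R] N₁ →ₗ[R] N}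
    (h : ∀ x y, B x y = B' y x) {k : ℕ} (θ : L [⋀^Fin k]→ₗ[R] N₁) (β : TotalForms R L N₂) :
    wdg B (formOf k θ) β = wdg B' (koszulSign k β) (formOf k θ) := by
  rcases Nat.even_or_odd k with hk | hk
  · rw [wdg_comm_of_even h (parity_formOf_of_even hk θ),
      koszulSign_of_even ((Int.even_coe_nat k).2 hk)]
  · rw [wdg_comm_of_odd h (parity_formOf_of_odd hk θ),
      koszulSign_of_odd ((Int.odd_coe_nat k).2 hk)]

theorem totalWedge_zeroForm (p : ℤ) (B : N₁ →ₗ[R] N₂ →ₗ[R] N) (α : TotalForms R L N₁) (e : N₂) :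
    totalWedge p B α (zeroForm e) = mapForm (B.flip e) α := by
  rw [totalWedge_eq_wdg, koszulSign_zeroForm, wdg_zeroForm]

/-- Moving `α` past `θ` costs `k` from graded commutativity of forms and `p` from the sign in
`totalWedge`: wedging with `θ` has parity `k + p`. -/
theorem totalWedge_wdg_left (p : ℤ) (B : N₁ →ₗ[R] N₂ →ₗ[R] N) {k : ℕ} (θ : L [⋀^Fin k]→ₗ[R] N₁)
    (α : TotalForms R L R) (η : TotalForms R L N₂) :
    totalWedge p B (formOf k θ) (wdg (LinearMap.lsmul R N₂) α η) =
      wdg (LinearMap.lsmul R N) (koszulSign (k + p) α) (totalWedge p B (formOf k θ) η) := by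
  rw [totalWedge_eq_wdg p B _ (wdg _ _ _), totalWedge_eq_wdg p B _ η, koszulSign_wdg,
    ← wdg_assoc (B₁₂ := (LinearMap.lsmul R N₁).flip) (B := B)
      (fun x y z => by simp), wdg_comm_formOf (B' := LinearMap.lsmul R N₁) (fun x y => rfl),
    ← koszulSign_add, wdg_assoc (B' := LinearMap.lsmul R N) (B₂₃ := B) (fun x y z => by simp)]

end Signs

/-! ### `Ω^•(A)`-linear operators correspond to forms -/

section Operators

variable {EM : Type*} [NormedAddCommGroup EM] [NormedSpace ℝ EM] [FiniteDimensional ℝ EM]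
  {H : Type*} [TopologicalSpace H] {I : ModelWithCorners ℝ EM H}
  {M : Type*} [TopologicalSpace M] [ChartedSpace H M] [IsManifold I ∞ M] [T2Space M]
  {A : SmoothVB I M} {𝒜 : LieAlgebroid A} {E E' : SmoothVB I M}

namespace LieAlgebroid

/-- Graded `Ω^•(A)`-linear operators, of parity `q`. -/
def IsOmegaLinear (q : ℤ) (T : 𝒜.Forms E.Sec →ₗ[ℝ] 𝒜.Forms E'.Sec) : Prop :=
  ∀ (α : 𝒜.Forms (SmoothFun I M)) (η : 𝒜.Forms E.Sec),
    T (wdg (LinearMap.lsmul (SmoothFun I M) E.Sec) α η) =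
      wdg (LinearMap.lsmul (SmoothFun I M) E'.Sec) (koszulSign q α) (T η)

theorem IsOmegaLinear.map_smul_form {q : ℤ} {T : 𝒜.Forms E.Sec →ₗ[ℝ] 𝒜.Forms E'.Sec}
    (hT : IsOmegaLinear q T) (f : SmoothFun I M) (η : 𝒜.Forms E.Sec) :
    T (mapForm (LinearMap.lsmul (SmoothFun I M) E.Sec f) η) =
      mapForm (LinearMap.lsmul (SmoothFun I M) E'.Sec f) (T η) := by
  rw [← zeroForm_wdg, hT, koszulSign_zeroForm, zeroForm_wdg]

/-- Locally `Ω^•(A, E)` is generated over `Ω^•(A)` by a frame. With cut-offs, `χ² η` is a sum of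
scalar forms times frame sections, hence killed by `T`; as `T` commutes with `χ²`, `T η` vanishes
where `χ = 1`. -/
theorem IsOmegaLinear.eq_zero {q : ℤ} {T : 𝒜.Forms E.Sec →ₗ[ℝ] 𝒜.Forms E'.Sec}
    (hT : IsOmegaLinear q T) (h0 : ∀ e, T (zeroForm e) = 0) : T = 0 := by
  refine LinearMap.ext fun η => DFinsupp.ext fun m => AlternatingMap.ext fun v => ?_
  change T η m v = 0
  ext x
  change T η m v x = 0
  obtain ⟨χ, h, h1⟩ := E.exists_frame x
  have h2 : mapForm (LinearMap.lsmul (SmoothFun I M) E.Sec (χ * χ)) η =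
      ∑ i, wdg (LinearMap.lsmul (SmoothFun I M) E.Sec) (mapForm (E.frameCoef h i) η)
        (zeroForm (E.frameSec h i)) := by
    refine DFinsupp.ext fun k => AlternatingMap.ext fun w => ?_
    have h3 : ∀ i, wdg (LinearMap.lsmul (SmoothFun I M) E.Sec) (mapForm (E.frameCoef h i) η)
        (zeroForm (E.frameSec h i)) k w = E.frameCoef h i (η k w) • E.frameSec h i := by
      intro i
      rw [wdg_zeroForm, mapForm_apply, mapForm_apply]
      rfl
    have h4 : (∑ i, wdg (LinearMap.lsmul (SmoothFun I M) E.Sec) (mapForm (E.frameCoef h i) η)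
        (zeroForm (E.frameSec h i))) k w = ∑ i, E.frameCoef h i (η k w) • E.frameSec h i := by
      refine (map_sum (AddMonoidHom.mk' (fun θ : 𝒜.Forms E.Sec => θ k w) fun _ _ => rfl) _ _).trans ?_
      exact Finset.sum_congr rfl fun i _ => h3 i
    refine Eq.trans ?_ h4.symm
    rw [E.sum_frameCoef_smul_frameSec]
    exact congrArg (fun θ => θ w) (mapForm_apply (LinearMap.lsmul (SmoothFun I M) E.Sec (χ * χ)) η k)
  have h5 := hT.map_smul_form (χ * χ) η
  rw [h2, map_sum, Finset.sum_eq_zero fun i _ => by rw [hT, h0, map_zero]] at h5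
  have h6 : (mapForm (LinearMap.lsmul (SmoothFun I M) E'.Sec (χ * χ)) (T η) : 𝒜.Forms E'.Sec) m v x =
      (χ x * χ x) • T η m v x := by
    rw [mapForm_apply]
    rfl
  rw [← h5, h1.eq_of_nhds, Pi.one_apply, one_mul, one_smul] at h6
  exact h6.symm

theorem IsOmegaLinear.ext {q : ℤ} {S T : 𝒜.Forms E.Sec →ₗ[ℝ] 𝒜.Forms E'.Sec}
    (hS : IsOmegaLinear q S) (hT : IsOmegaLinear q T)
    (h0 : ∀ e, S (zeroForm e) = T (zeroForm e)) : S = T := by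
  refine sub_eq_zero.1 (IsOmegaLinear.eq_zero (q := q) (fun α η => ?_) fun e => ?_)
  · rw [LinearMap.sub_apply, LinearMap.sub_apply, hS, hT, map_sub]
  · rw [LinearMap.sub_apply, h0, sub_self]

theorem isOmegaLinear_totalWedge (p : ℤ) {k : ℕ} (K : 𝒜.Form (E.hom E').Sec k) :
    IsOmegaLinear (k + p) (totalWedge p (E.homEval E') (formOf k K)) :=
  fun α η => totalWedge_wdg_left p (E.homEval E') K α η

/-- The form defined by an `Ω^•(A)`-linear operator. -/
def IsOmegaLinear.form {q : ℤ} {T : 𝒜.Forms E.Sec →ₗ[ℝ] 𝒜.Forms E'.Sec}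
    (hT : IsOmegaLinear q T) (k : ℕ) : 𝒜.Form (E.hom E').Sec k where
  toFun v := (SmoothVB.homEquiv E E').symm
    { toFun := fun e => T (zeroForm e) k v
      map_add' := fun e e' => by
        rw [map_add, map_add]
        rfl
      map_smul' := fun f e => by
        have h := mapForm_zeroForm (R := SmoothFun I M) (L := 𝒜.Sec)
          (LinearMap.lsmul (SmoothFun I M) E.Sec f) e
        rw [LinearMap.lsmul_apply] at h
        rw [← h, hT.map_smul_form, mapForm_apply]
        rfl }
  map_update_add' v i a b := by
    rw [← map_add]
    congr 1
    ext1 e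
    exact (T (zeroForm e) k).map_update_add v i a b
  map_update_smul' v i f a := by
    rw [← map_smul]
    congr 1
    ext1 e
    exact (T (zeroForm e) k).map_update_smul v i f a
  map_eq_zero_of_eq' v i j h hij := by
    rw [← map_zero (SmoothVB.homEquiv E E').symm]
    congr 1
    ext1 e
    exact (T (zeroForm e) k).map_eq_zero_of_eq v h hij

/-- Both sides are linear of the same parity and agree on sections by construction. The condition
`hk` ensures that the degree `k` part of `T` on sections is all of it. -/
theorem IsOmegaLinear.totalWedge_form {q p : ℤ} {k : ℕ} {T : 𝒜.Forms E.Sec →ₗ[ℝ] 𝒜.Forms E'.Sec}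
    (hT : IsOmegaLinear q T) (hq : q = k + p)
    (hk : ∀ e, ∀ m ≠ k, T (zeroForm e) m = 0) :
    totalWedge p (E.homEval E') (formOf k (hT.form k)) = T := by
  subst hq
  refine (isOmegaLinear_totalWedge p _).ext hT fun e => ?_
  rw [totalWedge_zeroForm]
  refine DFinsupp.ext fun m => AlternatingMap.ext fun v => ?_
  refine (congrArg (fun θ => θ v) (mapForm_apply ((E.homEval E').flip e)
    (formOf k (hT.form k)) m)).trans ?_
  by_cases hm : m = k
  · subst hm
    rw [formOf_apply_same]
    exact congrArg (fun S => S e) ((SmoothVB.homEquiv E E').apply_symm_apply _)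
  · rw [formOf_apply_of_ne (Ne.symm hm)]
    exact (map_zero ((E.homEval E').flip e)).trans (congrArg (fun θ => θ v) (hk e m hm)).symm

theorem ext_of_totalWedge_zeroForm {p : ℤ} {K K' : 𝒜.Forms (E.hom E').Sec}
    (h : ∀ e, totalWedge p (E.homEval E') K (zeroForm e) =
      totalWedge p (E.homEval E') K' (zeroForm e)) : K = K' := by
  refine DFinsupp.ext fun m => AlternatingMap.ext fun v => ?_
  apply SmoothVB.homEval_injective E E'
  ext1 e
  have h1 := h e
  rw [totalWedge_zeroForm, totalWedge_zeroForm] at h1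
  have h2 := congrArg (fun θ : 𝒜.Forms E'.Sec => θ m v) h1
  rw [mapForm_apply, mapForm_apply] at h2
  exact h2

end LieAlgebroid

end Operators

/-! ### Direct sums and bookkeeping of degrees -/

section DirectSums

variable {ι : Type*} [DecidableEq ι] {β : ι → Type*} [∀ i, AddCommMonoid (β i)]
  [∀ i, Module ℝ (β i)] {V : Type*} [AddCommMonoid V] [Module ℝ V]

theorem DirectSum.map_mem_of_components (f : (⨁ i, β i) →ₗ[ℝ] V) (p : Submodule ℝ V) (x : ⨁ i, β i)
    (h : ∀ i, f (DirectSum.lof ℝ ι β i (x i)) ∈ p) : f x ∈ p := by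
  classical
  rw [← DirectSum.sum_support_of x, map_sum]
  exact Submodule.sum_mem p fun i _ => h i

theorem DirectSum.lof_apply_of_ne {i j : ι} (h : i ≠ j) (x : β i) :
    DirectSum.lof ℝ ι β i x j = 0 :=
  DirectSum.of_eq_of_ne (β := β) i j x (Ne.symm h)

theorem DirectSum.lof_apply_same (i : ι) (x : β i) : DirectSum.lof ℝ ι β i x i = x :=
  DirectSum.of_eq_same (β := β) i x

/-- A direct sum of real vector spaces is a group; its addition is that of the `DirectSum`
instance by definition. -/
instance DirectSum.addCommGroupOfReal {ι : Type*} (β : ι → Type*) [∀ i, AddCommMonoid (β i)]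
    [∀ i, Module ℝ (β i)] : AddCommGroup (⨁ i, β i) := Module.addCommMonoidToAddCommGroup ℝ

end DirectSums

section Degrees

variable {R L : Type*} [CommRing R] [Algebra ℝ R] [LieRing L] [Module R L] [LieRingModule L R]
  [LieRinehartRing R L] [LieAlgebra ℝ L] [LieRinehartAlgebra ℝ R L]
variable {N N₁ N₂ N₃ N₁₂ : Type*}
  [AddCommGroup N] [Module R N] [Module ℝ N] [IsScalarTower ℝ R N]
  [AddCommGroup N₁] [Module R N₁] [Module ℝ N₁] [IsScalarTower ℝ R N₁]
  [AddCommGroup N₂] [Module R N₂] [Module ℝ N₂] [IsScalarTower ℝ R N₂]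
  [AddCommGroup N₃] [Module R N₃] [Module ℝ N₃] [IsScalarTower ℝ R N₃]
  [AddCommGroup N₁₂] [Module R N₁₂] [Module ℝ N₁₂] [IsScalarTower ℝ R N₁₂]

/-- The outer sign `q` distributes over both inner factors: its share on `η` adds to `p`, its share
on `κ'` stays in the composite form. -/
theorem totalWedge_totalWedge (p q : ℤ) {B : N₁ →ₗ[R] N₂ →ₗ[R] N₃} {B' : N →ₗ[R] N₃ →ₗ[R] N₁₂}
    {N₄ : Type*} [AddCommGroup N₄] [Module R N₄] [Module ℝ N₄] [IsScalarTower ℝ R N₄]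
    {C : N →ₗ[R] N₁ →ₗ[R] N₄} {B'' : N₄ →ₗ[R] N₂ →ₗ[R] N₁₂}
    (h : ∀ x y z, B'' (C x y) z = B' x (B y z)) (κ : TotalForms R L N) (κ' : TotalForms R L N₁)
    (η : TotalForms R L N₂) :
    totalWedge q B' κ (totalWedge p B κ' η) =
      totalWedge (p + q) B'' (wdg C κ (koszulSign q κ')) η := by
  rw [totalWedge_eq_wdg q B', totalWedge_eq_wdg p B, totalWedge_eq_wdg (p + q) B'', koszulSign_wdg,
    wdg_assoc (B' := B') (B₂₃ := B) h, add_comm p q, koszulSign_add]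

theorem LRConnection.dTotal_totalWedge {D₁ : LRConnection R L N₁} {D₂ : LRConnection R L N₂}
    {D₃ : LRConnection R L N} {B : N₁ →ₗ[R] N₂ →ₗ[R] N}
    (h : ∀ a x y, D₃.cov a (B x y) = B (D₁.cov a x) y + B x (D₂.cov a y)) (p : ℤ) {i : ℕ}
    (κ : L [⋀^Fin i]→ₗ[R] N₁) (η : TotalForms R L N₂) :
    D₃.dTotal (totalWedge p B (formOf i κ) η) =
      totalWedge p B (D₁.dTotal (formOf i κ)) η +
        (-1 : ℝ) ^ (i + p) • totalWedge p B (formOf i κ) (D₂.dTotal η) := by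
  rw [totalWedge_eq_wdg p B, totalWedge_eq_wdg p B, totalWedge_eq_wdg p B,
    LRConnection.dTotal_wdg h, koszulSign_dTotal, parity_formOf, map_smul, map_smul,
    LinearMap.smul_apply, smul_smul, zpow_add₀ (by norm_num), mul_assoc, ← zpow_add₀ (by norm_num),
    (Even.add_self p).neg_one_zpow, mul_one, zpow_natCast]

theorem formOf_injective (k : ℕ) :
    Function.Injective (formOf k : (L [⋀^Fin k]→ₗ[R] N) →ₗ[ℝ] TotalForms R L N) := by
  intro θ θ' h
  rw [← formOf_apply_same k θ, h, formOf_apply_same]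

theorem TotalForms.eq_zero_of_eq_add {x y : TotalForms R L N} (h : y = x + y) : x = 0 :=
  right_eq_add.1 h

theorem zeroForm_apply_of_ne (e : N) {s : ℕ} (h : s ≠ 0) :
    (zeroForm e : TotalForms R L N) s = 0 :=
  formOf_apply_of_ne h.symm _

theorem of_formOf_apply_ne_zero {P : Prop} {k s : ℕ} (θ : L [⋀^Fin k]→ₗ[R] N) (h : k = s → P)
    (hs : formOf k θ s ≠ 0) : P :=
  h (by_contra fun hk => hs (formOf_apply_of_ne hk θ))

namespace LRConnection

theorem dTotal_apply_eq_zero (D : LRConnection R L N) (x : TotalForms R L N)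
    {s : ℕ} (h : ∀ s', x s' ≠ 0 → s' + 1 ≠ s) : D.dTotal x s = 0 := by
  refine DirectSum.map_mem_of_components D.dTotal (LinearMap.ker
    (DirectSum.component ℝ ℕ (fun k => L [⋀^Fin k]→ₗ[R] N) s)) x fun s' => ?_
  rw [LinearMap.mem_ker]
  by_cases hx : x s' = 0
  · rw [hx, map_zero, map_zero, map_zero]
  · exact (congrArg (fun θ : TotalForms R L N => θ s) (D.dTotal_formOf s' (x s'))).trans
      (formOf_apply_of_ne (h s' hx) _)

theorem dTotal_pow_zeroForm_apply (D : LRConnection R L N) (n : ℕ) (e : N) (m : ℕ) (hm : m ≠ n) :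
    ((D.dTotal : Module.End ℝ (TotalForms R L N)) ^ n) (zeroForm e) m = 0 := by
  induction n generalizing m with
  | zero => exact formOf_apply_of_ne (Ne.symm hm) _
  | succ n ih =>
    rw [pow_succ']
    refine D.dTotal_apply_eq_zero _ fun s hs h => hm ?_
    rw [← h, not_imp_comm.1 (ih s) hs]

end LRConnection

end Degrees

/-! ### Operators of endomorphism forms and their graded trace -/

section Graded

variable {EM : Type*} [NormedAddCommGroup EM] [NormedSpace ℝ EM] [FiniteDimensional ℝ EM]
  {H : Type*} [TopologicalSpace H] {I : ModelWithCorners ℝ EM H}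
  {M : Type*} [TopologicalSpace M] [ChartedSpace H M] [IsManifold I ∞ M] [T2Space M]
  {A : SmoothVB I M} {𝒜 : LieAlgebroid A} {E : ℤ → SmoothVB I M}

namespace LieAlgebroid

/-- The inclusion of `Ω^•(A, E_z)` in `Ω(A, E)`. -/
abbrev gOf (z : ℤ) : 𝒜.Forms (E z).Sec →ₗ[ℝ] 𝒜.GForms E :=
  DirectSum.lof ℝ ℤ (fun z => 𝒜.Forms (E z).Sec) z

/-- The inclusion of `Ω^•(A, Hom(E_z, E_j))` in `Ω(A, End(E))`. -/
abbrev gEndOf (z j : ℤ) : 𝒜.Forms ((E z).hom (E j)).Sec →ₗ[ℝ] 𝒜.GEndForms E :=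
  DirectSum.lof ℝ ℤ (fun z => ⨁ j : ℤ, 𝒜.Forms ((E z).hom (E j)).Sec) z ∘ₗ
    DirectSum.lof ℝ ℤ (fun j => 𝒜.Forms ((E z).hom (E j)).Sec) j

theorem GForms.hom_ext {V : Type*} [AddCommMonoid V] [Module ℝ V] {f g : 𝒜.GForms E →ₗ[ℝ] V}
    (h : ∀ z η, f (gOf z η) = g (gOf z η)) : f = g :=
  DirectSum.linearMap_ext ℝ fun z => LinearMap.ext (h z)

theorem GEndForms.hom_ext {V : Type*} [AddCommMonoid V] [Module ℝ V] {f g : 𝒜.GEndForms E →ₗ[ℝ] V}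
    (h : ∀ z j κ, f (gEndOf z j κ) = g (gEndOf z j κ)) : f = g :=
  DirectSum.linearMap_ext ℝ fun z => DirectSum.linearMap_ext ℝ fun j => LinearMap.ext (h z j)

theorem gWedge_apply (α : 𝒜.Forms (SmoothFun I M)) (η : 𝒜.GForms E) (z : ℤ) :
    𝒜.gWedge E α η z = wdg (LinearMap.lsmul (SmoothFun I M) (E z).Sec) α (η z) :=
  DirectSum.lmap_apply _ η z

theorem gWedge_gOf (α : 𝒜.Forms (SmoothFun I M)) (z : ℤ) (η : 𝒜.Forms (E z).Sec) :
    𝒜.gWedge E α (gOf z η) = gOf z (wdg (LinearMap.lsmul (SmoothFun I M) (E z).Sec) α η) :=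
  DirectSum.lmap_lof (fun z => totalWedge 0 (LinearMap.lsmul (SmoothFun I M) (E z).Sec) α) z η

theorem hat_gEndOf (z j : ℤ) (κ : 𝒜.Forms ((E z).hom (E j)).Sec) (ζ : 𝒜.GForms E) :
    𝒜.hat E (gEndOf z j κ) ζ = gOf j (totalWedge (j - z) ((E z).homEval (E j)) κ (ζ z)) := by
  rw [hat, LinearMap.comp_apply, DirectSum.toModule_lof, DirectSum.toModule_lof]
  rfl

theorem gEndOf_apply_same (z j : ℤ) (κ : 𝒜.Forms ((E z).hom (E j)).Sec) :
    (gEndOf z j κ : 𝒜.GEndForms E) z j = κ := by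
  rw [LinearMap.comp_apply, DirectSum.lof_apply_same, DirectSum.lof_apply_same]

theorem gEndOf_apply_of_ne_left {z z' : ℤ} (h : z ≠ z') (j j' : ℤ)
    (κ : 𝒜.Forms ((E z).hom (E j)).Sec) : (gEndOf z j κ : 𝒜.GEndForms E) z' j' = 0 := by
  rw [LinearMap.comp_apply, DirectSum.lof_apply_of_ne h]
  rfl

theorem gEndOf_apply_of_ne_right (z : ℤ) {j j' : ℤ} (h : j ≠ j')
    (κ : 𝒜.Forms ((E z).hom (E j)).Sec) : (gEndOf z j κ : 𝒜.GEndForms E) z j' = 0 := by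
  rw [LinearMap.comp_apply, DirectSum.lof_apply_same, DirectSum.lof_apply_of_ne h]

theorem gOf_apply_same (z : ℤ) (η : 𝒜.Forms (E z).Sec) : (gOf z η : 𝒜.GForms E) z = η :=
  DirectSum.lof_apply_same (β := fun z => 𝒜.Forms (E z).Sec) z η

theorem gOf_apply_of_ne {z z' : ℤ} (h : z ≠ z') (η : 𝒜.Forms (E z).Sec) :
    (gOf z η : 𝒜.GForms E) z' = 0 :=
  DirectSum.lof_apply_of_ne (β := fun z => 𝒜.Forms (E z).Sec) h η

/-- The operator as a matrix: its entry from `z` to `j` involves only `K z j`. Injectivity of `hat`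
and the construction of preimages are thereby reduced to single entries. -/
theorem hat_gOf_apply (K : 𝒜.GEndForms E) (z j : ℤ) (η : 𝒜.Forms (E z).Sec) :
    𝒜.hat E K (gOf z η) j = totalWedge (j - z) ((E z).homEval (E j)) (K z j) η := by
  have h : DirectSum.component ℝ ℤ (fun z => 𝒜.Forms (E z).Sec) j ∘ₗ
        LinearMap.applyₗ (gOf z η) ∘ₗ 𝒜.hat E =
      LinearMap.applyₗ η ∘ₗ totalWedge (j - z) ((E z).homEval (E j)) ∘ₗ
        DirectSum.component ℝ ℤ (fun j => 𝒜.Forms ((E z).hom (E j)).Sec) j ∘ₗ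
          DirectSum.component ℝ ℤ (fun z => ⨁ j : ℤ, 𝒜.Forms ((E z).hom (E j)).Sec) z := by
    refine GEndForms.hom_ext fun z' j' κ => ?_
    change 𝒜.hat E (gEndOf z' j' κ) (gOf z η) j =
      totalWedge (j - z) ((E z).homEval (E j)) ((gEndOf z' j' κ : 𝒜.GEndForms E) z j) η
    rw [hat_gEndOf]
    by_cases hz : z' = z
    · subst hz
      rw [gOf_apply_same]
      by_cases hj : j' = j
      · subst hj
        rw [gOf_apply_same, gEndOf_apply_same]
      · rw [gOf_apply_of_ne hj, gEndOf_apply_of_ne_right z' hj, map_zero, LinearMap.zero_apply]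
    · rw [gOf_apply_of_ne (Ne.symm hz), gEndOf_apply_of_ne_left hz, map_zero, map_zero,
        map_zero, LinearMap.zero_apply]
      rfl
  exact LinearMap.congr_fun h K

theorem hat_injective : Function.Injective (𝒜.hat E) := by
  refine fun K K' hK => DFinsupp.ext fun z => DFinsupp.ext fun j => ?_
  refine ext_of_totalWedge_zeroForm (p := j - z) fun e => ?_
  rw [← hat_gOf_apply, ← hat_gOf_apply, hK]

variable (𝒜 E) in
/-- The graded trace of operators: a linear extension of `K̂ ↦ gtr K`. -/
def str : Module.End ℝ (𝒜.GForms E) →ₗ[ℝ] 𝒜.Forms (SmoothFun I M) :=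
  𝒜.gtr E ∘ₗ (LinearMap.exists_leftInverse_of_injective (𝒜.hat E)
    (LinearMap.ker_eq_bot.2 hat_injective)).choose

theorem str_hat (K : 𝒜.GEndForms E) : 𝒜.str E (𝒜.hat E K) = 𝒜.gtr E K :=
  congrArg (𝒜.gtr E) (LinearMap.congr_fun (LinearMap.exists_leftInverse_of_injective (𝒜.hat E)
    (LinearMap.ker_eq_bot.2 hat_injective)).choose_spec K)

theorem gtr_gEndOf_same (z : ℤ) (κ : 𝒜.Forms ((E z).hom (E z)).Sec) :
    𝒜.gtr E (gEndOf z z κ) = (-1 : ℝ) ^ z • mapForm (E z).trace κ := by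
  rw [gtr, LinearMap.comp_apply, DirectSum.toModule_lof]
  change (-1 : ℝ) ^ z • (DirectSum.lmap fun k => 𝒜.formTrace (E z) k)
    (DirectSum.lof ℝ ℤ (fun j => 𝒜.Forms ((E z).hom (E j)).Sec) z κ z) = _
  rw [DirectSum.lof_apply_same]
  rfl

theorem gtr_gEndOf_of_ne {z j : ℤ} (h : j ≠ z) (κ : 𝒜.Forms ((E z).hom (E j)).Sec) :
    𝒜.gtr E (gEndOf z j κ) = 0 := by
  rw [gtr, LinearMap.comp_apply, DirectSum.toModule_lof]
  change (-1 : ℝ) ^ z • (DirectSum.lmap fun k => 𝒜.formTrace (E z) k)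
    (DirectSum.lof ℝ ℤ (fun j => 𝒜.Forms ((E z).hom (E j)).Sec) j κ z) = _
  rw [DirectSum.lof_apply_of_ne h, map_zero, smul_zero]

end LieAlgebroid

end Graded

/-! ### Graded linear operators on graded bundles are given by forms -/

section Tensorial

variable {EM : Type*} [NormedAddCommGroup EM] [NormedSpace ℝ EM] [FiniteDimensional ℝ EM]
  {H : Type*} [TopologicalSpace H] {I : ModelWithCorners ℝ EM H}
  {M : Type*} [TopologicalSpace M] [ChartedSpace H M] [IsManifold I ∞ M] [T2Space M]
  {A : SmoothVB I M} {𝒜 : LieAlgebroid A} {E : ℤ → SmoothVB I M}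

namespace LieAlgebroid

theorem GForms.IsHomogeneous.add {n : ℤ} {η ζ : 𝒜.GForms E} (hη : η.IsHomogeneous n)
    (hζ : ζ.IsHomogeneous n) : GForms.IsHomogeneous (η + ζ) n := by
  intro z s h
  by_contra hn
  have h1 : η z s = 0 := by_contra fun h => hn (hη z s h)
  have h2 : ζ z s = 0 := by_contra fun h => hn (hζ z s h)
  exact h ((congrArg₂ (· + ·) h1 h2).trans (add_zero 0))

theorem GForms.IsHomogeneous.smul {n : ℤ} {η : 𝒜.GForms E} (hη : η.IsHomogeneous n) (c : ℝ) :
    GForms.IsHomogeneous (c • η) n := by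
  intro z s h
  refine hη z s fun h1 => h ?_
  exact (congrArg (c • ·) h1).trans (smul_zero c)

theorem GForms.isHomogeneous_gOf {z n : ℤ} {x : 𝒜.Forms (E z).Sec}
    (h : ∀ s : ℕ, x s ≠ 0 → (s : ℤ) + z = n) : GForms.IsHomogeneous (E := E) (gOf z x) n := by
  intro z' s hs
  by_cases hz : z = z'
  · subst hz
    rw [gOf_apply_same] at hs
    exact h s hs
  · rw [gOf_apply_of_ne hz] at hs
    exact absurd rfl hs

/-- Operators on `Ω(A, E)` of total degree `n` which are graded `Ω^•(A)`-linear. -/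
structure IsTensorial (n : ℤ) (T : Module.End ℝ (𝒜.GForms E)) : Prop where
  degree : ∀ (m : ℤ) (η : 𝒜.GForms E), η.IsHomogeneous m → (T η).IsHomogeneous (m + n)
  map_gWedge : ∀ (α : 𝒜.Forms (SmoothFun I M)) (η : 𝒜.GForms E),
    T (𝒜.gWedge E α η) = 𝒜.gWedge E (koszulSign n α) (T η)

namespace IsTensorial

variable {m n : ℤ} {S T : Module.End ℝ (𝒜.GForms E)}

theorem smul (hT : IsTensorial n T) (c : ℝ) : IsTensorial n (c • T) where
  degree m η h := (hT.degree m η h).smul c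
  map_gWedge α η := by
    rw [LinearMap.smul_apply, LinearMap.smul_apply, hT.map_gWedge, map_smul]

theorem mul (hS : IsTensorial m S) (hT : IsTensorial n T) : IsTensorial (m + n) (S * T) where
  degree k η h := by
    rw [add_comm m n, ← add_assoc]
    exact hS.degree _ _ (hT.degree k η h)
  map_gWedge α η := by
    rw [Module.End.mul_apply, Module.End.mul_apply, hT.map_gWedge, hS.map_gWedge, koszulSign_add]

theorem one : IsTensorial 0 (1 : Module.End ℝ (𝒜.GForms E)) where
  degree k η h := by rwa [add_zero]
  map_gWedge α η := by rw [koszulSign_of_even Even.zero]; rfl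

theorem pow (hT : IsTensorial n T) (k : ℕ) : IsTensorial (k * n) (T ^ k) := by
  induction k with
  | zero => simpa using one
  | succ k ih =>
    rw [pow_succ, Nat.cast_succ, add_mul, one_mul]
    exact ih.mul hT

end IsTensorial

/-- The span of the forms `κ ∈ Ω^i(A, Hom(E_z, E_j))` with `i + (j - z) = n`. -/
def homogeneousSpan (𝒜 : LieAlgebroid A) (E : ℤ → SmoothVB I M) (n : ℤ) :
    Submodule ℝ (𝒜.GEndForms E) :=
  Submodule.span ℝ {K | ∃ (z j : ℤ) (i : ℕ) (κ : 𝒜.Form ((E z).hom (E j)).Sec i),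
    (i : ℤ) + (j - z) = n ∧ K = gEndOf z j (formOf i κ)}

theorem GEndForms.IsHomogeneous.mem_homogeneousSpan {n : ℤ} {K : 𝒜.GEndForms E}
    (hK : K.IsHomogeneous n) : K ∈ homogeneousSpan 𝒜 E n := by
  refine DirectSum.map_mem_of_components LinearMap.id _ K fun z => ?_
  refine DirectSum.map_mem_of_components (LinearMap.id ∘ₗ
    DirectSum.lof ℝ ℤ (fun z => ⨁ j : ℤ, 𝒜.Forms ((E z).hom (E j)).Sec) z) _ (K z) fun j => ?_
  refine DirectSum.map_mem_of_components (gEndOf z j) (homogeneousSpan 𝒜 E n) (K z j) fun i => ?_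
  by_cases h : K z j i = 0
  · rw [h, map_zero, map_zero]
    exact zero_mem _
  · exact Submodule.subset_span ⟨z, j, i, K z j i, hK z j i h, rfl⟩

theorem IsTensorial.isOmegaLinear {n : ℤ} {T : Module.End ℝ (𝒜.GForms E)} (hT : IsTensorial n T)
    (z j : ℤ) : IsOmegaLinear n
      (DirectSum.component ℝ ℤ (fun z => 𝒜.Forms (E z).Sec) j ∘ₗ T ∘ₗ gOf z) := by
  intro α η
  change T (gOf z _) j = wdg _ _ (T (gOf z η) j)
  rw [← gWedge_gOf, hT.map_gWedge, gWedge_apply]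

/-- On a section of `E z` the total degree forces the component in `E j` to have form degree `n + z
- j`. If this is negative, the component is zero on sections and hence everywhere. -/
theorem IsTensorial.exists_component {n : ℤ} {T : Module.End ℝ (𝒜.GForms E)}
    (hT : IsTensorial n T) (z j : ℤ) : ∃ κ : 𝒜.Forms ((E z).hom (E j)).Sec,
      (∀ i : ℕ, κ i ≠ 0 → (i : ℤ) + (j - z) = n) ∧
      ∀ η, totalWedge (j - z) ((E z).homEval (E j)) κ η = T (gOf z η) j := by
  have h0 : ∀ (e : (E z).Sec) (s : ℕ), T (gOf z (zeroForm e)) j s ≠ 0 → (s : ℤ) + j = z + n := by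
    intro e s hs
    refine hT.degree z _ (GForms.isHomogeneous_gOf fun s' hs' => ?_) j s hs
    rcases Nat.eq_zero_or_pos s' with h | h
    · rw [h, Nat.cast_zero, zero_add]
    · exact absurd (zeroForm_apply_of_ne e h.ne') hs'
  by_cases hn : 0 ≤ n + z - j
  · have hk : ((n + z - j).toNat : ℤ) = n + z - j := Int.toNat_of_nonneg hn
    refine ⟨formOf (n + z - j).toNat ((hT.isOmegaLinear z j).form _), fun i =>
      of_formOf_apply_ne_zero _ fun h => ?_, fun η => ?_⟩
    · rw [← h, hk]
      ring
    · refine LinearMap.congr_fun ((hT.isOmegaLinear z j).totalWedge_form (by rw [hk]; ring)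
        fun e s hs => by_contra fun h => hs ?_) η
      have := h0 e s h
      omega
  · refine ⟨0, fun i hi => absurd rfl hi, fun η => ?_⟩
    have h := (hT.isOmegaLinear z j).eq_zero fun e => DFinsupp.ext fun s => by_contra fun h => hn ?_
    · rw [map_zero, LinearMap.zero_apply]
      exact (LinearMap.congr_fun h η).symm
    · have := h0 e s h
      omega

theorem SmoothVB.subsingleton_sec {E : SmoothVB I M} (h : Module.finrank ℝ E.F = 0) :
    Subsingleton E.Sec := by
  have h0 : Subsingleton E.F := Module.finrank_zero_iff.1 h
  refine ⟨fun s t => ?_⟩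
  ext x
  exact ((E.triv x).continuousLinearEquivAt ℝ x
    (FiberBundle.mem_baseSet_trivializationAt' x)).injective (Subsingleton.elim _ _)

theorem forms_eq_zero {N : Type*} [AddCommGroup N] [Module (SmoothFun I M) N] [Module ℝ N]
    [IsScalarTower ℝ (SmoothFun I M) N] (h : ∀ x : N, x = 0)
    (η : 𝒜.Forms N) : η = 0 :=
  DFinsupp.ext fun _ => AlternatingMap.ext fun _ => h _

theorem homSec_eq_zero {E E' : SmoothVB I M}
    (h : ¬ (Module.finrank ℝ E.F ≠ 0 ∧ Module.finrank ℝ E'.F ≠ 0)) (φ : (E.hom E').Sec) :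
    φ = 0 := by
  refine (map_eq_zero_iff _ (SmoothVB.homEval_injective E E')).1 (LinearMap.ext fun s => ?_)
  by_cases hz : Module.finrank ℝ E.F = 0
  · have := SmoothVB.subsingleton_sec hz
    rw [Subsingleton.elim s 0, map_zero, map_zero]
  · have := SmoothVB.subsingleton_sec (E := E') (by tauto)
    exact Subsingleton.elim _ _

theorem forms_hom_eq_zero {z j : ℤ}
    (h : ¬ (Module.finrank ℝ (E z).F ≠ 0 ∧ Module.finrank ℝ (E j).F ≠ 0))
    (κ : 𝒜.Forms ((E z).hom (E j)).Sec) : κ = 0 :=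
  forms_eq_zero (homSec_eq_zero h) κ

/-- Finiteness makes the family of entries an element of the direct sum: entries between bundles one
of which has rank zero vanish by themselves. -/
theorem IsTensorial.exists_hat (hE : {z : ℤ | Module.finrank ℝ (E z).F ≠ 0}.Finite) {n : ℤ}
    {T : Module.End ℝ (𝒜.GForms E)} (hT : IsTensorial n T) :
    ∃ K : 𝒜.GEndForms E, K.IsHomogeneous n ∧ 𝒜.hat E K = T := by
  choose κ hdeg hκ using hT.exists_component
  let K : 𝒜.GEndForms E := DFinsupp.mk hE.toFinset fun z => DFinsupp.mk hE.toFinset fun j => κ z j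
  have hK : ∀ z j, K z j = κ z j := by
    intro z j
    by_cases hz : z ∈ hE.toFinset
    · by_cases hj : j ∈ hE.toFinset
      · have h1 : K z = DFinsupp.mk hE.toFinset fun j => κ z j :=
          DFinsupp.mk_of_mem hz
        rw [h1]
        exact DFinsupp.mk_of_mem hj
      · rw [forms_hom_eq_zero (fun h => hj (by simpa using h.2)) (K z j),
          forms_hom_eq_zero (fun h => hj (by simpa using h.2)) (κ z j)]
    · rw [forms_hom_eq_zero (fun h => hz (by simpa using h.1)) (K z j),
        forms_hom_eq_zero (fun h => hz (by simpa using h.1)) (κ z j)]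
  refine ⟨K, fun z j i h => hdeg z j i (by rwa [hK] at h), GForms.hom_ext fun z η => ?_⟩
  refine DFinsupp.ext fun j => ?_
  exact (hat_gOf_apply K z j η).trans (by rw [hK, hκ])

/-- Reduces an identity linear in `T` to operators of a single homogeneous form; `p` will be the
equalizer of its two sides. -/
theorem IsTensorial.induction (hE : {z : ℤ | Module.finrank ℝ (E z).F ≠ 0}.Finite) {n : ℤ}
    {p : Submodule ℝ (Module.End ℝ (𝒜.GForms E))}
    (h : ∀ (z j : ℤ) (i : ℕ) (κ : 𝒜.Form ((E z).hom (E j)).Sec i), (i : ℤ) + (j - z) = n →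
      𝒜.hat E (gEndOf z j (formOf i κ)) ∈ p)
    {T : Module.End ℝ (𝒜.GForms E)} (hT : IsTensorial n T) : T ∈ p := by
  obtain ⟨K, hK, rfl⟩ := hT.exists_hat hE
  have h1 : homogeneousSpan 𝒜 E n ≤ p.comap (𝒜.hat E) := by
    refine Submodule.span_le.2 ?_
    rintro _ ⟨z, j, i, κ, hi, rfl⟩
    exact h z j i κ hi
  exact h1 hK.mem_homogeneousSpan

end LieAlgebroid

end Tensorial

section Operators

variable {V W : Type*} [AddCommMonoid V] [Module ℝ V] [AddCommMonoid W] [Module ℝ W]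

theorem Module.End.linearMap_zero (f : Module.End ℝ V →ₗ[ℝ] W) : f 0 = 0 := map_zero f

/-- The linear map `T ↦ S T + c T S`. -/
def Module.End.mulAddMul (S : Module.End ℝ V) (c : ℝ) : Module.End ℝ V →ₗ[ℝ] Module.End ℝ V :=
  LinearMap.mulLeft ℝ S + c • LinearMap.mulRight ℝ S

end Operators

/-! ### The graded trace on graded commutators -/

section GradedTrace

variable {EM : Type*} [NormedAddCommGroup EM] [NormedSpace ℝ EM] [FiniteDimensional ℝ EM]
  {H : Type*} [TopologicalSpace H] {I : ModelWithCorners ℝ EM H}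
  {M : Type*} [TopologicalSpace M] [ChartedSpace H M] [IsManifold I ∞ M] [T2Space M]
  {A : SmoothVB I M} {𝒜 : LieAlgebroid A} {E : ℤ → SmoothVB I M}

namespace LieAlgebroid

/-- The wedge product `Ω^•(A, Hom(E', E'')) × Ω^•(A, Hom(E, E')) → Ω^•(A, Hom(E, E''))`. -/
abbrev wdgComp {E E' E'' : SmoothVB I M} (κ : 𝒜.Forms (E'.hom E'').Sec)
    (κ' : 𝒜.Forms (E.hom E').Sec) : 𝒜.Forms (E.hom E'').Sec :=
  wdg (SmoothVB.homComp E E' E'') κ κ'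

theorem hat_mul_hat (z y j : ℤ) (κ : 𝒜.Forms ((E y).hom (E j)).Sec)
    (κ' : 𝒜.Forms ((E z).hom (E y)).Sec) :
    𝒜.hat E (gEndOf y j κ) * 𝒜.hat E (gEndOf z y κ') =
      𝒜.hat E (gEndOf z j (wdgComp κ (koszulSign (j - y) κ'))) := by
  refine LinearMap.ext fun η => ?_
  rw [Module.End.mul_apply, hat_gEndOf, hat_gEndOf, hat_gEndOf, gOf_apply_same,
    totalWedge_totalWedge (B'' := (E z).homEval (E j)) (C := SmoothVB.homComp (E z) (E y) (E j))
      (y - z) (j - y) (fun φ ψ s => SmoothVB.homEval_homComp φ ψ s),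
    sub_add_sub_cancel']

theorem hat_mul_hat_of_ne {z j z' j' : ℤ} (h : j' ≠ z) (κ : 𝒜.Forms ((E z).hom (E j)).Sec)
    (κ' : 𝒜.Forms ((E z').hom (E j')).Sec) :
    𝒜.hat E (gEndOf z j κ) * 𝒜.hat E (gEndOf z' j' κ') = 0 := by
  refine LinearMap.ext fun η => ?_
  rw [Module.End.mul_apply, hat_gEndOf, hat_gEndOf, gOf_apply_of_ne h, map_zero, map_zero]
  rfl

theorem str_hat_mul_hat_of_ne {z j z' j' : ℤ} (h : j' ≠ z) (κ : 𝒜.Forms ((E z).hom (E j)).Sec)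
    (κ' : 𝒜.Forms ((E z').hom (E j')).Sec) :
    𝒜.str E (𝒜.hat E (gEndOf z j κ) * 𝒜.hat E (gEndOf z' j' κ')) = 0 :=
  (congrArg (𝒜.str E) (hat_mul_hat_of_ne h κ κ')).trans (Module.End.linearMap_zero (𝒜.str E))

theorem str_hat_mul_hat (z j : ℤ) (κ : 𝒜.Forms ((E z).hom (E j)).Sec)
    (κ' : 𝒜.Forms ((E j).hom (E z)).Sec) :
    𝒜.str E (𝒜.hat E (gEndOf z j κ) * 𝒜.hat E (gEndOf j z κ')) =
      (-1 : ℝ) ^ j • mapForm (E j).trace (wdgComp κ (koszulSign (j - z) κ')) := by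
  rw [hat_mul_hat, str_hat, gtr_gEndOf_same]

/-- Graded commutativity of the wedge product along the pairing `(φ, ψ) ↦ tr(φψ)`, which is
symmetric by `trace_homComp`. -/
theorem mapForm_trace_wdgComp {E E' : SmoothVB I M} {i i' : ℕ} (κ : 𝒜.Form (E.hom E').Sec i)
    (κ' : 𝒜.Form (E'.hom E).Sec i') :
    mapForm E'.trace (wdgComp (formOf i κ) (formOf i' κ')) =
      (-1 : ℝ) ^ ((i : ℤ) * i') • mapForm E.trace (wdgComp (formOf i' κ') (formOf i κ)) := by
  have h := wdg_comm_formOf (B := (SmoothVB.homComp E' E E').compr₂ E'.trace)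
    (B' := (SmoothVB.homComp E E' E).compr₂ E.trace)
    (fun x y => (SmoothVB.trace_homComp y x).symm) κ (formOf i' κ')
  rw [koszulSign_formOf, map_smul, LinearMap.smul_apply] at h
  have h1 := mapForm_wdg (R := SmoothFun I M) (L := 𝒜.Sec) (B := SmoothVB.homComp E' E E')
    (B' := (SmoothVB.homComp E' E E').compr₂ E'.trace) (f := E'.trace)
    (g := LinearMap.id) (g' := LinearMap.id) (fun _ _ => rfl) (formOf i κ) (formOf i' κ')
  have h2 := mapForm_wdg (R := SmoothFun I M) (L := 𝒜.Sec) (B := SmoothVB.homComp E E' E)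
    (B' := (SmoothVB.homComp E E' E).compr₂ E.trace) (f := E.trace)
    (g := LinearMap.id) (g' := LinearMap.id) (fun _ _ => rfl) (formOf i' κ') (formOf i κ)
  rw [mapForm_id, mapForm_id] at h1 h2
  exact h1.trans (h.trans (congrArg _ h2.symm))

theorem neg_one_zpow_congr {a b : ℤ} (h : Even (a - b)) : (-1 : ℝ) ^ a = (-1 : ℝ) ^ b := by
  rw [← sub_add_cancel a b, zpow_add₀ (by norm_num), h.neg_one_zpow, one_mul]

set_option maxHeartbeats 1000000 in
/-- The graded trace vanishes on graded commutators. -/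
theorem str_mul_comm (hE : {z : ℤ | Module.finrank ℝ (E z).F ≠ 0}.Finite) {m n : ℤ}
    {S T : Module.End ℝ (𝒜.GForms E)} (hS : IsTensorial m S) (hT : IsTensorial n T) :
    𝒜.str E (S * T) = (-1 : ℝ) ^ (m * n) • 𝒜.str E (T * S) := by
  let φ : Module.End ℝ (𝒜.GForms E) →ₗ[ℝ] Module.End ℝ (𝒜.GForms E) →ₗ[ℝ]
      𝒜.Forms (SmoothFun I M) := (LinearMap.mul ℝ _).compr₂ (𝒜.str E)
  let ψ : Module.End ℝ (𝒜.GForms E) →ₗ[ℝ] Module.End ℝ (𝒜.GForms E) →ₗ[ℝ]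
      𝒜.Forms (SmoothFun I M) := (-1 : ℝ) ^ (m * n) • φ.flip
  suffices h : S ∈ LinearMap.eqLocus (φ.flip T) (ψ.flip T) from h
  refine hS.induction hE fun z j i κ hi => ?_
  suffices h : T ∈ LinearMap.eqLocus (φ (𝒜.hat E (gEndOf z j (formOf i κ))))
    (ψ (𝒜.hat E (gEndOf z j (formOf i κ)))) from h
  refine hT.induction hE fun z' j' i' κ' hi' => ?_
  change 𝒜.str E (𝒜.hat E (gEndOf z j (formOf i κ)) * 𝒜.hat E (gEndOf z' j' (formOf i' κ'))) =
    (-1 : ℝ) ^ (m * n) •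
      𝒜.str E (𝒜.hat E (gEndOf z' j' (formOf i' κ')) * 𝒜.hat E (gEndOf z j (formOf i κ)))
  by_cases h1 : j' = z
  · subst h1
    by_cases h2 : z' = j
    · subst h2
      rw [str_hat_mul_hat, str_hat_mul_hat, koszulSign_formOf, koszulSign_formOf, wdgComp,
        wdgComp, map_smul (wdg _ _), map_smul (wdg _ _), map_smul (mapForm _),
        map_smul (mapForm _), mapForm_trace_wdgComp, smul_smul, smul_smul, smul_smul, smul_smul]
      congr 1
      rw [← zpow_add₀ (by norm_num), ← zpow_add₀ (by norm_num), ← zpow_add₀ (by norm_num),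
        ← zpow_add₀ (by norm_num)]
      refine neg_one_zpow_congr ?_
      subst hi hi'
      -- With `d = z' - j'` the exponents on the two sides differ by `d (d + 1) + 2 i d`. The linear
      -- term `d` comes from the factors `(-1)^z` of the graded trace, which are what makes the
      -- difference even.
      obtain ⟨c, hc⟩ := Int.even_mul_succ_self (z' - j')
      exact ⟨c + i * (z' - j'), by linear_combination hc⟩
    · rw [hat_mul_hat, str_hat, gtr_gEndOf_of_ne (Ne.symm h2), str_hat_mul_hat_of_ne (Ne.symm h2),
        smul_zero]
  · rw [str_hat_mul_hat_of_ne h1]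
    by_cases h2 : z' = j
    · subst h2
      rw [hat_mul_hat, str_hat, gtr_gEndOf_of_ne h1, smul_zero]
    · rw [str_hat_mul_hat_of_ne (Ne.symm h2), smul_zero]

/-! ### Connections up to homotopy -/

/-- The properties of the operator of a connection up to homotopy. -/
structure IsHomotopyConnection (T : Module.End ℝ (𝒜.GForms E)) : Prop where
  degree : ∀ (m : ℤ) (η : 𝒜.GForms E), η.IsHomogeneous m → (T η).IsHomogeneous (m + 1)
  map_gWedge : ∀ (α : 𝒜.Forms (SmoothFun I M)) (η : 𝒜.GForms E), T (𝒜.gWedge E α η) =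
    𝒜.gWedge E ((LRConnection.flat (SmoothFun I M) 𝒜.Sec).dTotal α) η +
      𝒜.gWedge E (koszulSign 1 α) (T η)

theorem HomotopyConnection.isHomotopyConnection (D : 𝒜.HomotopyConnection E) :
    IsHomotopyConnection D.op where
  degree := D.degree
  map_gWedge α η := by
    induction α using TotalForms.induction with
    | of k α =>
      rw [D.leibniz, koszulSign_formOf, one_mul, zpow_natCast, map_smul, LinearMap.smul_apply,
        LRConnection.dTotal_formOf]
    | add α β hα hβ =>
      simp only [map_add, LinearMap.add_apply, hα, hβ]
      abel

namespace IsHomotopyConnection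

variable {D D' : Module.End ℝ (𝒜.GForms E)}

theorem add {T : Module.End ℝ (𝒜.GForms E)} (hD : IsHomotopyConnection D) (hT : IsTensorial 1 T) :
    IsHomotopyConnection (D + T) where
  degree m η h := (hD.degree m η h).add (hT.degree m η h)
  map_gWedge α η := by
    rw [LinearMap.add_apply, LinearMap.add_apply, hD.map_gWedge, hT.map_gWedge, map_add, add_assoc]

/-- The terms with `d_A α` cancel, so connections up to homotopy form an affine space over the
tensorial operators of degree `1`. -/
theorem isTensorial_sub (hD : IsHomotopyConnection D) (hD' : IsHomotopyConnection D') :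
    IsTensorial 1 (D + (-1 : ℝ) • D') where
  degree m η h := (hD.degree m η h).add ((hD'.degree m η h).smul _)
  map_gWedge α η := by
    rw [LinearMap.add_apply, LinearMap.smul_apply, hD.map_gWedge, hD'.map_gWedge,
      LinearMap.add_apply, LinearMap.smul_apply, map_add, map_smul]
    module

/-- Graded commutators with a connection up to homotopy. -/
theorem isTensorial_commutator (hD : IsHomotopyConnection D) {n : ℤ}
    {T : Module.End ℝ (𝒜.GForms E)} (hT : IsTensorial n T) :
    IsTensorial (n + 1) (D * T + (-1 : ℝ) ^ (n + 1) • (T * D)) where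
  degree m η h := by
    rw [← add_assoc]
    refine (hD.degree _ _ (hT.degree m η h)).add ?_
    rw [add_right_comm]
    exact (hT.degree _ _ (hD.degree m η h)).smul _
  map_gWedge α η := by
    simp only [LinearMap.add_apply, LinearMap.smul_apply, Module.End.mul_apply, hD.map_gWedge,
      hT.map_gWedge, map_add, ← koszulSign_add, koszulSign_dTotal, map_smul, smul_add, smul_smul]
    have : (-1 : ℝ) ^ (n + 1) * (-1 : ℝ) ^ n = -1 := by
      rw [← zpow_add₀ (by norm_num)]
      exact Odd.neg_one_zpow ⟨n, by ring⟩
    rw [this, add_comm 1 n]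
    module

/-- The two cross terms cancel because parity anticommutes with `d_A`, and the term with `d_A² α` is
zero. -/
theorem isTensorial_sq (hD : IsHomotopyConnection D) : IsTensorial 2 (D * D) where
  degree m η h := by
    have := hD.degree _ _ (hD.degree m η h)
    rwa [add_assoc] at this
  map_gWedge α η := by
    simp only [Module.End.mul_apply, hD.map_gWedge, map_add, ← koszulSign_add, koszulSign_dTotal,
      LRConnection.flat_dTotal_dTotal, map_smul, zpow_one, map_zero, LinearMap.zero_apply,
      LinearMap.smul_apply]
    rw [show (1 : ℤ) + 1 = 2 from rfl]
    module

end IsHomotopyConnection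

/-- The connection up to homotopy `⊕_z d_{∇_z}`. -/
def sumConnection (D : ∀ z, 𝒜.Connection (E z)) : 𝒜.HomotopyConnection E where
  op := DirectSum.lmap fun z => (D z).dTotal
  degree n η h z s hs := by
    rw [DirectSum.lmap_apply] at hs
    by_contra hn
    refine hs ((D z).dTotal_apply_eq_zero (η z) fun s' hs' hi => hn ?_)
    have := h z s' hs'
    subst hi
    push_cast
    linarith
  leibniz k α η := by
    refine DFinsupp.ext fun z => ?_
    have h := LRConnection.dTotal_wdg (D₁ := LRConnection.flat (SmoothFun I M) 𝒜.Sec) (D₂ := D z)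
      (D₃ := D z) (B := LinearMap.lsmul (SmoothFun I M) (E z).Sec)
      (fun a f s => ((D z).leibniz a f s).trans (add_comm _ _)) (formOf k α) (η z)
    rw [LRConnection.dTotal_formOf, parity_formOf, map_smul, LinearMap.smul_apply] at h
    exact h

theorem sumConnection_op_apply (D : ∀ z, 𝒜.Connection (E z)) (η : 𝒜.GForms E) (z : ℤ) :
    (sumConnection D).op η z = (D z).dTotal (η z) :=
  DirectSum.lmap_apply _ η z

theorem sumConnection_op_gOf (D : ∀ z, 𝒜.Connection (E z)) (z : ℤ) (η : 𝒜.Forms (E z).Sec) :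
    (sumConnection D).op (gOf z η) = gOf z ((D z).dTotal η) :=
  DirectSum.lmap_lof (fun z => (D z).dTotal) z η

/-- The signed Leibniz rule for the evaluation pairing: commuting with `⊕ d_{∇_z}` differentiates
the form by the connection on `Hom(E_z, E_j)`. -/
theorem sumConnection_commutator_hat (D : ∀ z, 𝒜.Connection (E z)) (z j : ℤ) {i : ℕ}
    (κ : 𝒜.Form ((E z).hom (E j)).Sec i) :
    (sumConnection D).op * 𝒜.hat E (gEndOf z j (formOf i κ)) + (-1 : ℝ) ^ ((i : ℤ) + (j - z) + 1) •
        (𝒜.hat E (gEndOf z j (formOf i κ)) * (sumConnection D).op) =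
      𝒜.hat E (gEndOf z j ((𝒜.homConnection (D z) (D j)).dTotal (formOf i κ))) := by
  refine LinearMap.ext fun η => ?_
  rw [LinearMap.add_apply, LinearMap.smul_apply, Module.End.mul_apply, Module.End.mul_apply,
    hat_gEndOf, hat_gEndOf, hat_gEndOf, sumConnection_op_gOf, sumConnection_op_apply,
    LRConnection.dTotal_totalWedge (D₁ := 𝒜.homConnection (D z) (D j)) (D₂ := D z) (D₃ := D j)
      (fun a φ s => by rw [homEval_homConnection, sub_add_cancel]),
    zpow_add_one₀ (by norm_num), map_add, map_smul]
  module

/-- Off-diagonal forms stay off-diagonal and have no trace; on diagonal ones the trace carries the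
connection on `End(E_z)` to `d_A`. -/
theorem str_sumConnection_commutator (hE : {z : ℤ | Module.finrank ℝ (E z).F ≠ 0}.Finite)
    (D : ∀ z, 𝒜.Connection (E z)) {n : ℤ} {T : Module.End ℝ (𝒜.GForms E)} (hT : IsTensorial n T) :
    𝒜.str E ((sumConnection D).op * T + (-1 : ℝ) ^ (n + 1) • (T * (sumConnection D).op)) =
      (LRConnection.flat (SmoothFun I M) 𝒜.Sec).dTotal (𝒜.str E T) := by
  let φ : Module.End ℝ (𝒜.GForms E) →ₗ[ℝ] 𝒜.Forms (SmoothFun I M) :=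
    𝒜.str E ∘ₗ Module.End.mulAddMul (sumConnection D).op ((-1 : ℝ) ^ (n + 1))
  suffices h : T ∈ LinearMap.eqLocus φ
    ((LRConnection.flat (SmoothFun I M) 𝒜.Sec).dTotal ∘ₗ 𝒜.str E) from h
  refine hT.induction hE fun z j i κ hi => ?_
  subst hi
  change 𝒜.str E ((sumConnection D).op * 𝒜.hat E (gEndOf z j (formOf i κ)) +
    (-1 : ℝ) ^ ((i : ℤ) + (j - z) + 1) • (𝒜.hat E (gEndOf z j (formOf i κ)) *
      (sumConnection D).op)) = (LRConnection.flat (SmoothFun I M) 𝒜.Sec).dTotal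
        (𝒜.str E (𝒜.hat E (gEndOf z j (formOf i κ))))
  rw [sumConnection_commutator_hat, str_hat, str_hat]
  by_cases h : j = z
  · subst h
    rw [gtr_gEndOf_same, gtr_gEndOf_same, map_smul,
      LRConnection.dTotal_mapForm (D := 𝒜.homConnection (D j) (D j)) (trace_homConnection (D j))]
  · rw [gtr_gEndOf_of_ne h, gtr_gEndOf_of_ne h, map_zero]

/-- `gtr [𝒟, K] = d_A (gtr K)`. -/
theorem IsHomotopyConnection.str_commutator (hE : {z : ℤ | Module.finrank ℝ (E z).F ≠ 0}.Finite)
    {D₀ : ∀ z, 𝒜.Connection (E z)} {D : Module.End ℝ (𝒜.GForms E)} (hD : IsHomotopyConnection D)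
    {n : ℤ} {T : Module.End ℝ (𝒜.GForms E)} (hT : IsTensorial n T) :
    𝒜.str E (D * T + (-1 : ℝ) ^ (n + 1) • (T * D)) =
      (LRConnection.flat (SmoothFun I M) 𝒜.Sec).dTotal (𝒜.str E T) := by
  have hB := hD.isTensorial_sub (sumConnection D₀).isHomotopyConnection
  have h1 := str_sumConnection_commutator hE D₀ hT
  have h2 := str_mul_comm hE hB hT
  generalize (sumConnection D₀).op = S at *
  rw [← h1]
  -- The tensorial operator `D - S` has a traceless graded commutator with `T`, so `D` may be
  -- replaced by the direct sum `S` of linear connections.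
  have h3 : D * T + (-1 : ℝ) ^ (n + 1) • (T * D) = (S * T + (-1 : ℝ) ^ (n + 1) • (T * S)) +
      ((D + (-1 : ℝ) • S) * T + (-1 : ℝ) ^ (n + 1) • (T * (D + (-1 : ℝ) • S))) := by
    refine LinearMap.ext fun η => ?_
    simp only [LinearMap.add_apply, LinearMap.smul_apply, Module.End.mul_apply, map_add, map_smul]
    module
  rw [h3, LinearMap.map_add (𝒜.str E) (_ + _), LinearMap.map_add (𝒜.str E) ((D + _) * T), h2,
    LinearMap.map_smul (𝒜.str E), one_mul, zpow_add_one₀ (by norm_num)]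
  module

end LieAlgebroid

end GradedTrace

/-! ### Powers of an operator along a segment -/

section PowerDerivative

variable {𝔄 : Type*} [Semiring 𝔄] [Algebra ℝ 𝔄]

/-- The derivative at `D` of `D ↦ D^n` in the direction `B`. -/
def powDeriv (D B : 𝔄) : ℕ → 𝔄
  | 0 => 0
  | n + 1 => powDeriv D B n * D + D ^ n * B

/-- The algebra carries no topology, so one differentiates after applying a functional. The
induction varies `μ` in order to absorb right multiplication by `D` and `B`. -/
theorem hasDerivAt_pow_add_smul (D B : 𝔄) (n : ℕ) (μ : 𝔄 →ₗ[ℝ] ℝ) (t : ℝ) :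
    HasDerivAt (fun t : ℝ => μ ((D + t • B) ^ n)) (μ (powDeriv (D + t • B) B n)) t := by
  induction n generalizing μ with
  | zero =>
    simp only [pow_zero, powDeriv, map_zero]
    exact hasDerivAt_const t _
  | succ n ih =>
    have h1 := (ih (μ ∘ₗ LinearMap.mulRight ℝ D)).add
      ((hasDerivAt_id t).mul (ih (μ ∘ₗ LinearMap.mulRight ℝ B)))
    have h2 : (fun t : ℝ => μ ((D + t • B) ^ (n + 1))) = fun t : ℝ =>
        (μ ∘ₗ LinearMap.mulRight ℝ D) ((D + t • B) ^ n) +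
          t * (μ ∘ₗ LinearMap.mulRight ℝ B) ((D + t • B) ^ n) := by
      funext t
      simp only [LinearMap.comp_apply, LinearMap.mulRight_apply]
      rw [pow_succ, mul_add, mul_smul_comm, map_add, map_smul, smul_eq_mul]
    rw [h2]
    refine h1.congr_deriv ?_
    simp only [LinearMap.comp_apply, LinearMap.mulRight_apply, powDeriv, mul_add, map_add,
      mul_smul_comm, map_smul, smul_eq_mul, id]
    ring

/-- Only even powers of `D` are tensorial, so the exponent grows by two. The trailing factor `(D *
D) ^ m` is what allows an induction on `l`. -/
theorem powDeriv_mul (D B : 𝔄) (l m : ℕ) :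
    powDeriv D B (2 * (l + 1)) * (D * D) ^ m = powDeriv D B (2 * l) * (D * D) ^ (m + 1) +
      (D * D) ^ l * ((D * B + B * D) * (D * D) ^ m) := by
  have h : D ^ (2 * l) = (D * D) ^ l := by rw [pow_mul, sq]
  rw [show 2 * (l + 1) = 2 * l + 1 + 1 from rfl, powDeriv, powDeriv, pow_succ, h, pow_succ' _ m]
  simp only [add_mul, mul_add, mul_assoc]
  abel

/-- Since `D` commutes with its square, the right side is the graded commutator of `D` with the odd
operator `B * (D * D) ^ k`. -/
theorem commutator_mul_sq_pow (D B : 𝔄) (k : ℕ) :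
    (D * B + B * D) * (D * D) ^ k = D * (B * (D * D) ^ k) + B * (D * D) ^ k * D := by
  have h : D * (D * D) ^ k = (D * D) ^ k * D :=
    ((Commute.refl D).mul_right (Commute.refl D)).pow_right k
  rw [add_mul, mul_assoc, mul_assoc, mul_assoc, h]

/-- If `μ` vanishes on the derivatives of a power along a segment, it has the same value on the
power at the end points. -/
theorem eq_of_powDeriv_eq_zero (D B : 𝔄) (n : ℕ) (μ : 𝔄 →ₗ[ℝ] ℝ)
    (h : ∀ t : ℝ, μ (powDeriv (D + t • B) B n) = 0) : μ (D ^ n) = μ ((D + B) ^ n) := by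
  have h1 := is_const_of_deriv_eq_zero (fun t => (hasDerivAt_pow_add_smul D B n μ t).differentiableAt)
    (fun t => (hasDerivAt_pow_add_smul D B n μ t).deriv.trans (h t)) 0 1
  simpa using h1

end PowerDerivative

/-- A vector outside a subspace is detected by some linear functional vanishing on the subspace.
Exactness can therefore be tested by real numbers. -/
theorem Submodule.sub_mem_comap_of_functionals {V W : Type*} [AddCommGroup V] [Module ℝ V]
    [AddCommGroup W] [Module ℝ W] (f : V →ₗ[ℝ] W) (p : Submodule ℝ W) {x y : V}
    (h : ∀ μ : W →ₗ[ℝ] ℝ, (∀ w ∈ p, μ w = 0) → μ (f x) = μ (f y)) : x - y ∈ p.comap f := by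
  by_contra hn
  obtain ⟨μ, hμ, hp⟩ := Submodule.exists_le_ker_of_notMem (p := p) (v := f (x - y)) hn
  refine hμ ?_
  rw [map_sub, map_sub, h μ fun w hw => LinearMap.mem_ker.1 (hp hw), sub_self]

/-! ### Cohomology classes and the functionals that separate them -/

section Classes

variable {R L : Type*} [CommRing R] [Algebra ℝ R] [LieRing L] [Module R L] [LieRingModule L R]
  [LieRinehartRing R L] [LieAlgebra ℝ L] [LieRinehartAlgebra ℝ R L]

theorem cohomologyClass_val {k : ℕ} {θ : L [⋀^Fin k]→ₗ[R] R}
    (h : (LRConnection.flat R L).d θ = 0) :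
    (cohomologyClass θ : (L [⋀^Fin k]→ₗ[R] R) ⧸ exactForms R L k) = (exactForms R L k).mkQ θ := by
  rw [cohomologyClass, dif_pos (show θ ∈ closedForms R L k from h)]

theorem cohomologyClass_zero (k : ℕ) : cohomologyClass (0 : L [⋀^Fin k]→ₗ[R] R) = 0 :=
  Subtype.ext ((cohomologyClass_val (map_zero _)).trans (map_zero _))

theorem cohomologyClass_eq {k : ℕ} {θ θ' : L [⋀^Fin k]→ₗ[R] R}
    (h : (LRConnection.flat R L).d θ = 0) (h' : (LRConnection.flat R L).d θ' = 0)
    (hμ : ∀ μ : TotalForms R L R →ₗ[ℝ] ℝ, (∀ η, μ ((LRConnection.flat R L).dTotal η) = 0) →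
      μ (formOf k θ) = μ (formOf k θ')) : cohomologyClass θ = cohomologyClass θ' := by
  refine Subtype.ext ?_
  rw [cohomologyClass_val h, cohomologyClass_val h']
  refine (Submodule.Quotient.eq _).2 ?_
  refine Submodule.sub_mem_comap_of_functionals (formOf k) _ fun μ h => hμ μ fun η => ?_
  exact h _ (LinearMap.mem_range_self _ η)

theorem d_eq_zero_of_dTotal_formOf {k : ℕ} {θ : L [⋀^Fin k]→ₗ[R] R}
    (h : (LRConnection.flat R L).dTotal (formOf k θ) = 0) : (LRConnection.flat R L).d θ = 0 := by
  have h1 := congrArg (fun η : TotalForms R L R => η (k + 1)) h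
  simp only [LRConnection.dTotal_formOf] at h1
  rw [formOf_apply_same] at h1
  exact h1

end Classes

/-! ### Closedness, independence and the alternating sum -/

section Characters

variable {EM : Type*} [NormedAddCommGroup EM] [NormedSpace ℝ EM] [FiniteDimensional ℝ EM]
  {H : Type*} [TopologicalSpace H] {I : ModelWithCorners ℝ EM H}
  {M : Type*} [TopologicalSpace M] [ChartedSpace H M] [IsManifold I ∞ M] [T2Space M]
  {A : SmoothVB I M} {𝒜 : LieAlgebroid A}

namespace LieAlgebroid

namespace Connection

variable {E : SmoothVB I M} (D : 𝒜.Connection E)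

theorem dTotal_wdg_lsmul (α : 𝒜.Forms (SmoothFun I M)) (η : 𝒜.Forms E.Sec) :
    D.dTotal (wdg (LinearMap.lsmul (SmoothFun I M) E.Sec) α η) =
      wdg (LinearMap.lsmul (SmoothFun I M) E.Sec)
        ((LRConnection.flat (SmoothFun I M) 𝒜.Sec).dTotal α) η +
      wdg (LinearMap.lsmul (SmoothFun I M) E.Sec) (koszulSign 1 α) (D.dTotal η) := by
  rw [koszulSign_one]
  exact LRConnection.dTotal_wdg (fun a f s => (D.leibniz a f s).trans (add_comm _ _)) α η

theorem isOmegaLinear_dTotal_sq : IsOmegaLinear 0 (D.dTotal ∘ₗ D.dTotal) := by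
  intro α η
  rw [LinearMap.comp_apply, LinearMap.comp_apply, dTotal_wdg_lsmul, map_add, dTotal_wdg_lsmul,
    dTotal_wdg_lsmul, LRConnection.flat_dTotal_dTotal, map_zero, LinearMap.zero_apply,
    koszulSign_dTotal, map_smul, LinearMap.smul_apply, ← koszulSign_add,
    koszulSign_of_even (by decide : Even ((1 : ℤ) + 1)), koszulSign_of_even Even.zero, zpow_one]
  module

theorem isOmegaLinear_dTotal_pow (l : ℕ) :
    IsOmegaLinear ((2 * l : ℕ) : ℤ) ((D.dTotal : Module.End ℝ (𝒜.Forms E.Sec)) ^ (2 * l)) := by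
  intro α η
  rw [koszulSign_of_even ((Int.even_coe_nat _).2 (even_two_mul l))]
  induction l with
  | zero => rfl
  | succ l ih =>
    have h : ∀ ζ : 𝒜.Forms E.Sec, ((D.dTotal : Module.End ℝ (𝒜.Forms E.Sec)) ^ (2 * (l + 1))) ζ =
        (D.dTotal ∘ₗ D.dTotal) (((D.dTotal : Module.End ℝ (𝒜.Forms E.Sec)) ^ (2 * l)) ζ) := by
      intro ζ
      rw [show 2 * (l + 1) = 2 * l + 1 + 1 from rfl, pow_succ', pow_succ']
      rfl
    rw [h, h, ih, D.isOmegaLinear_dTotal_sq, koszulSign_of_even Even.zero]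

/-- Even powers of `d_∇` are `Ω^•(A)`-linear and map sections to `2l`-forms, whence existence;
values on sections give uniqueness. Thus the choice in `curvaturePower` is the only one possible. -/
theorem isCurvaturePower_iff (l : ℕ) (K : 𝒜.Form (E.hom E).Sec (2 * l)) :
    D.IsCurvaturePower l K ↔ K = D.curvaturePower l := by
  have hex : ∃ K, D.IsCurvaturePower l K :=
    ⟨_, (D.isOmegaLinear_dTotal_pow l).totalWedge_form (add_zero _).symm
      (D.dTotal_pow_zeroForm_apply (2 * l))⟩
  have hK := Classical.epsilon_spec hex
  refine ⟨fun h => ?_, fun h => h ▸ hK⟩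
  exact formOf_injective (2 * l) (ext_of_totalWedge_zeroForm (p := 0) fun e =>
    LinearMap.congr_fun (h.trans hK.symm) (zeroForm e))

theorem totalWedge_curvaturePower (l : ℕ) :
    totalWedge 0 (SmoothVB.homEval E E) (formOf (2 * l) (D.curvaturePower l)) =
      (D.dTotal : Module.End ℝ (𝒜.Forms E.Sec)) ^ (2 * l) :=
  (D.isCurvaturePower_iff l _).2 rfl

/-- The Bianchi identity. -/
theorem dTotal_curvaturePower (l : ℕ) :
    (𝒜.homConnection D D).dTotal (formOf (2 * l) (D.curvaturePower l)) = 0 := by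
  refine ext_of_totalWedge_zeroForm (p := 0) fun e => ?_
  have h := LRConnection.dTotal_totalWedge (D₁ := 𝒜.homConnection D D) (D₂ := D) (D₃ := D)
    (B := E.homEval E) (fun a φ s => by rw [homEval_homConnection, sub_add_cancel]) 0
    (D.curvaturePower l) (zeroForm e)
  rw [totalWedge_curvaturePower, add_zero, ((Int.even_coe_nat _).2 (even_two_mul l)).neg_one_zpow,
    one_smul] at h
  -- As `d_∇` commutes with `d_∇^{2l}`, two terms of the Leibniz rule `h` agree, and the third,
  -- which contains the derivative of the curvature power, must vanish.
  have h1 : D.dTotal (((D.dTotal : Module.End ℝ (𝒜.Forms E.Sec)) ^ (2 * l)) (zeroForm e)) =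
      ((D.dTotal : Module.End ℝ (𝒜.Forms E.Sec)) ^ (2 * l)) (D.dTotal (zeroForm e)) := by
    rw [← Module.End.mul_apply, ← Module.End.mul_apply]
    exact LinearMap.congr_fun (pow_mul_comm' _ _).symm _
  rw [h1] at h
  rw [map_zero, LinearMap.zero_apply]
  exact TotalForms.eq_zero_of_eq_add h

theorem mapForm_trace_curvaturePower (l : ℕ) :
    mapForm E.trace (formOf (2 * l) (D.curvaturePower l)) = formOf (2 * l) (D.traceForm l) :=
  mapForm_formOf _ _ _

theorem dA_traceForm (l : ℕ) : 𝒜.dA (D.traceForm l) = 0 := by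
  refine d_eq_zero_of_dTotal_formOf ?_
  rw [← mapForm_trace_curvaturePower, LRConnection.dTotal_mapForm (D := 𝒜.homConnection D D)
    (trace_homConnection D), dTotal_curvaturePower, map_zero]

theorem traceForm_eq_zero (h : Module.finrank ℝ E.F = 0) (l : ℕ) : D.traceForm l = 0 := by
  have := SmoothVB.subsingleton_sec h
  have h1 : D.curvaturePower l = 0 := AlternatingMap.ext fun v =>
    SmoothVB.homEval_injective E E (LinearMap.ext fun s => Subsingleton.elim _ _)
  rw [traceForm, h1, map_zero]

end Connection

variable {E : ℤ → SmoothVB I M}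

namespace HomotopyConnection

variable (D : 𝒜.HomotopyConnection E)

theorem isTensorial_pow (l : ℕ) : IsTensorial (2 * l) (D.op ^ (2 * l)) := by
  rw [pow_mul, sq, mul_comm]
  exact D.isHomotopyConnection.isTensorial_sq.pow l

theorem isCurvaturePower_iff (hE : {z : ℤ | Module.finrank ℝ (E z).F ≠ 0}.Finite) (l : ℕ) (K : 𝒜.GEndForms E) :
    D.IsCurvaturePower l K ↔ K = D.curvaturePower l := by
  have hK := Classical.epsilon_spec ((D.isTensorial_pow l).exists_hat hE)
  exact ⟨fun h => hat_injective (h.2.trans hK.2.symm), fun h => h ▸ hK⟩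

/-- Diagonal entries have coefficient degree zero, so their form degree is the total degree. Hence
extracting the component of degree `2l` in `traceForm` loses nothing. -/
theorem gtr_mem_range {n : ℕ} {K : 𝒜.GEndForms E} (hK : K.IsHomogeneous n) :
    𝒜.gtr E K ∈ LinearMap.range
      (formOf (R := SmoothFun I M) (L := 𝒜.Sec) (N := SmoothFun I M) n) := by
  suffices h : homogeneousSpan 𝒜 E n ≤ (LinearMap.range
      (formOf (R := SmoothFun I M) (L := 𝒜.Sec) (N := SmoothFun I M) n)).comap (𝒜.gtr E) from
    h hK.mem_homogeneousSpan
  refine Submodule.span_le.2 ?_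
  rintro _ ⟨z, j, i, κ, hi, rfl⟩
  change 𝒜.gtr E (gEndOf z j (formOf i κ)) ∈ LinearMap.range
    (formOf (R := SmoothFun I M) (L := 𝒜.Sec) (N := SmoothFun I M) n)
  by_cases h : j = z
  · subst h
    obtain rfl : i = n := by omega
    rw [gtr_gEndOf_same, mapForm_formOf]
    exact Submodule.smul_mem _ _ (LinearMap.mem_range_self _ _)
  · rw [gtr_gEndOf_of_ne h]
    exact zero_mem _

theorem formOf_traceForm (hE : {z : ℤ | Module.finrank ℝ (E z).F ≠ 0}.Finite) (l : ℕ) :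
    formOf (2 * l) (D.traceForm l) = 𝒜.str E (D.op ^ (2 * l)) := by
  have hK : D.IsCurvaturePower l (D.curvaturePower l) := (D.isCurvaturePower_iff hE l _).2 rfl
  obtain ⟨θ, hθ⟩ := gtr_mem_range (n := 2 * l) (K := D.curvaturePower l) (by exact_mod_cast hK.1)
  rw [traceForm, ← hK.2, str_hat, ← hθ, formOf_apply_same]

end HomotopyConnection

/-- The transgression argument: each step of the induction adds a term whose trace is exact, hence
killed by `μ`. -/
theorem eq_zero_str_powDeriv (hE : {z : ℤ | Module.finrank ℝ (E z).F ≠ 0}.Finite)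
    (D₀ : ∀ z, 𝒜.Connection (E z)) {μ : 𝒜.Forms (SmoothFun I M) →ₗ[ℝ] ℝ}
    (hμ : ∀ η, μ ((LRConnection.flat (SmoothFun I M) 𝒜.Sec).dTotal η) = 0)
    {D B : Module.End ℝ (𝒜.GForms E)} (hD : IsHomotopyConnection D) (hB : IsTensorial 1 B)
    (l m : ℕ) : (μ ∘ₗ 𝒜.str E) (powDeriv D B (2 * l) * (D * D) ^ m) = 0 := by
  induction l generalizing m with
  | zero =>
    rw [mul_zero, powDeriv, zero_mul]
    exact Module.End.linearMap_zero _
  | succ l ih =>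
    rw [powDeriv_mul, LinearMap.map_add (μ ∘ₗ 𝒜.str E), ih, zero_add]
    have hQ : ∀ k : ℕ, IsTensorial (k * 2) ((D * D) ^ k) := hD.isTensorial_sq.pow
    have hu : IsTensorial 2 (D * B + B * D) := by
      have h := hD.isTensorial_commutator hB
      rwa [show (1 : ℤ) + 1 = 2 from rfl, even_two.neg_one_zpow, one_smul] at h
    -- Cyclicity moves the even operator `(D * D) ^ l` to the right without sign, leaving the graded
    -- commutator of `D` with `B * (D * D) ^ (m + l)`.
    have h1 := str_mul_comm hE (hQ l) (hu.mul (hQ m))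
    rw [mul_assoc, (even_two.mul_right _).mul_left (l : ℤ) |>.neg_one_zpow, one_smul, mul_assoc,
      ← pow_add, commutator_mul_sq_pow D B (m + l)] at h1
    have h2 := hD.str_commutator hE (D₀ := D₀) (hB.mul (hQ (m + l)))
    rw [Even.neg_one_zpow ⟨1 + ((m + l : ℕ) : ℤ), by ring⟩, one_smul] at h2
    rw [LinearMap.comp_apply, h1, h2, hμ]

theorem str_pow_eq (hE : {z : ℤ | Module.finrank ℝ (E z).F ≠ 0}.Finite)
    (D₀ : ∀ z, 𝒜.Connection (E z)) {μ : 𝒜.Forms (SmoothFun I M) →ₗ[ℝ] ℝ}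
    (hμ : ∀ η, μ ((LRConnection.flat (SmoothFun I M) 𝒜.Sec).dTotal η) = 0)
    (D D' : 𝒜.HomotopyConnection E) (l : ℕ) :
    μ (𝒜.str E (D.op ^ (2 * l))) = μ (𝒜.str E (D'.op ^ (2 * l))) := by
  have hB := D'.isHomotopyConnection.isTensorial_sub D.isHomotopyConnection
  have h := eq_of_powDeriv_eq_zero D.op (D'.op + (-1 : ℝ) • D.op) (2 * l) (μ ∘ₗ 𝒜.str E) fun t => by
    have h1 := eq_zero_str_powDeriv hE D₀ hμ (D.isHomotopyConnection.add (hB.smul t)) hB l 0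
    rwa [pow_zero, mul_one] at h1
  have h2 : D.op + (D'.op + (-1 : ℝ) • D.op) = D'.op := by
    refine LinearMap.ext fun η => ?_
    rw [LinearMap.add_apply, LinearMap.add_apply, LinearMap.smul_apply]
    module
  rw [h2] at h
  exact h

namespace HomotopyConnection

theorem dA_traceForm (hE : {z : ℤ | Module.finrank ℝ (E z).F ≠ 0}.Finite)
    (D₀ : ∀ z, 𝒜.Connection (E z)) (D : 𝒜.HomotopyConnection E) (l : ℕ) :
    𝒜.dA (D.traceForm l) = 0 := by
  refine d_eq_zero_of_dTotal_formOf ?_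
  rw [D.formOf_traceForm hE, ← D.isHomotopyConnection.str_commutator hE (D₀ := D₀)
    (D.isTensorial_pow l), Odd.neg_one_zpow ⟨l, rfl⟩, ← pow_succ, ← pow_succ']
  -- The power `𝒟^{2l}` is even, so its graded commutator with `𝒟` is the ordinary one, which is
  -- zero.
  have h : D.op ^ (2 * l + 1) + (-1 : ℝ) • D.op ^ (2 * l + 1) = 0 := by
    refine LinearMap.ext fun η => ?_
    rw [LinearMap.add_apply, LinearMap.smul_apply, LinearMap.zero_apply]
    module
  rw [h]
  exact Module.End.linearMap_zero _

theorem characterClass_eq (hE : {z : ℤ | Module.finrank ℝ (E z).F ≠ 0}.Finite)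
    (D₀ : ∀ z, 𝒜.Connection (E z)) (D D' : 𝒜.HomotopyConnection E) (l : ℕ) :
    D.characterClass l = D'.characterClass l := by
  refine cohomologyClass_eq (D.dA_traceForm hE D₀ l) (D'.dA_traceForm hE D₀ l) fun μ hμ => ?_
  rw [D.formOf_traceForm hE, D'.formOf_traceForm hE, str_pow_eq hE D₀ hμ D D']

end HomotopyConnection

theorem sumConnection_op_pow_gOf (D : ∀ z, 𝒜.Connection (E z)) (n : ℕ) (z : ℤ)
    (η : 𝒜.Forms (E z).Sec) : ((sumConnection D).op ^ n) (gOf z η) =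
      gOf z (((D z).dTotal ^ n : Module.End ℝ (𝒜.Forms (E z).Sec)) η) := by
  induction n with
  | zero => rfl
  | succ n ih =>
    rw [pow_succ', pow_succ', Module.End.mul_apply, ih, sumConnection_op_gOf]
    rfl

/-- The operator is block diagonal, and so are its powers. The blocks outside `S` act on zero spaces
and need no term. -/
theorem sumConnection_op_pow (D : ∀ z, 𝒜.Connection (E z)) (l : ℕ) {S : Finset ℤ}
    (hS : ∀ z ∉ S, Module.finrank ℝ (E z).F = 0) :
    (sumConnection D).op ^ (2 * l) =
      𝒜.hat E (∑ z ∈ S, gEndOf z z (formOf (2 * l) ((D z).curvaturePower l))) := by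
  refine GForms.hom_ext fun z η => ?_
  by_cases hz : z ∈ S
  · rw [sumConnection_op_pow_gOf, map_sum, LinearMap.sum_apply, Finset.sum_eq_single_of_mem z hz,
      hat_gEndOf, gOf_apply_same, sub_self, Connection.totalWedge_curvaturePower]
    intro y _ hy
    rw [hat_gEndOf, gOf_apply_of_ne (Ne.symm hy), map_zero, map_zero]
  · have := SmoothVB.subsingleton_sec (hS z hz)
    rw [forms_eq_zero (fun x => Subsingleton.elim x 0) η, map_zero, map_zero, map_zero]

theorem traceForm_sumConnection (hE : {z : ℤ | Module.finrank ℝ (E z).F ≠ 0}.Finite)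
    (D : ∀ z, 𝒜.Connection (E z)) (l : ℕ) {S : Finset ℤ}
    (hS : ∀ z ∉ S, Module.finrank ℝ (E z).F = 0) :
    (sumConnection D).traceForm l = ∑ z ∈ S, (-1 : ℝ) ^ z • (D z).traceForm l := by
  have h : formOf (2 * l) ((sumConnection D).traceForm l) =
      formOf (2 * l) (∑ z ∈ S, (-1 : ℝ) ^ z • (D z).traceForm l) := by
    rw [HomotopyConnection.formOf_traceForm _ hE, sumConnection_op_pow D l hS, str_hat, map_sum,
      map_sum]
    refine Finset.sum_congr rfl fun z _ => ?_
    rw [gtr_gEndOf_same, Connection.mapForm_trace_curvaturePower, map_smul]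
  have h1 := congrArg (fun η : 𝒜.Forms (SmoothFun I M) => η (2 * l)) h
  simp only [] at h1
  rwa [formOf_apply_same, formOf_apply_same] at h1

/-- Put `D` or `D'` in place of the `z`-th member of `D₀`. Graded independence compares the two
direct sums, the summands with `y ≠ z` cancel, and the factor `(-1)^z` is invertible. -/
theorem Connection.characterClass_eq (hE : {z : ℤ | Module.finrank ℝ (E z).F ≠ 0}.Finite)
    (D₀ : ∀ z, 𝒜.Connection (E z)) {z : ℤ} (D D' : 𝒜.Connection (E z)) (l : ℕ) :
    D.characterClass l = D'.characterClass l := by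
  refine cohomologyClass_eq (D.dA_traceForm l) (D'.dA_traceForm l) fun μ hμ => ?_
  -- The index `z` is inserted because `E z` may have rank zero.
  let S := insert z hE.toFinset
  have hz : z ∈ S := Finset.mem_insert_self z _
  have hS : ∀ y ∉ S, Module.finrank ℝ (E y).F = 0 := fun y hy => by
    by_contra h
    exact hy (Finset.mem_insert_of_mem (hE.mem_toFinset.2 h))
  let F : 𝒜.Connection (E z) → ∀ y, 𝒜.Connection (E y) := Function.update D₀ z
  have hF : ∀ X, μ (formOf (2 * l) ((sumConnection (F X)).traceForm l)) =
      (-1 : ℝ) ^ z * μ (formOf (2 * l) (X.traceForm l)) +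
        ∑ y ∈ S.erase z, (-1 : ℝ) ^ y * μ (formOf (2 * l) ((D₀ y).traceForm l)) := by
    intro X
    rw [traceForm_sumConnection hE (F X) l hS, map_sum, map_sum, ← Finset.add_sum_erase S _ hz,
      map_smul, map_smul, smul_eq_mul, show F X z = X from Function.update_self z X D₀]
    congr 1
    refine Finset.sum_congr rfl fun y hy => ?_
    rw [map_smul, map_smul, smul_eq_mul,
      show F X y = D₀ y from Function.update_of_ne (Finset.ne_of_mem_erase hy) X D₀]
  have h := str_pow_eq hE D₀ hμ (sumConnection (F D)) (sumConnection (F D')) l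
  rw [← HomotopyConnection.formOf_traceForm _ hE, ← HomotopyConnection.formOf_traceForm _ hE, hF,
    hF] at h
  exact mul_left_cancel₀ (zpow_ne_zero z (by norm_num)) (add_right_cancel h)

theorem pontryaginCharacter_eq (hE : {z : ℤ | Module.finrank ℝ (E z).F ≠ 0}.Finite)
    (D₀ : ∀ z, 𝒜.Connection (E z)) {z : ℤ} (D : 𝒜.Connection (E z)) (l : ℕ) :
    𝒜.pontryaginCharacter (E z) l = D.characterClass l := by
  rw [pontryaginCharacter, dif_pos ⟨D⟩]
  exact Connection.characterClass_eq hE D₀ _ D l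

theorem gradedPontryaginCharacter_eq (hE : {z : ℤ | Module.finrank ℝ (E z).F ≠ 0}.Finite)
    (D₀ : ∀ z, 𝒜.Connection (E z)) (D : 𝒜.HomotopyConnection E) (l : ℕ) :
    𝒜.gradedPontryaginCharacter E l = D.characterClass l := by
  rw [gradedPontryaginCharacter, dif_pos ⟨D⟩]
  exact HomotopyConnection.characterClass_eq hE D₀ _ D l

theorem characterClass_sumConnection (hE : {z : ℤ | Module.finrank ℝ (E z).F ≠ 0}.Finite)
    (D : ∀ z, 𝒜.Connection (E z)) (l : ℕ) :
    (sumConnection D).characterClass l =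
      ∑ᶠ z : ℤ, (-1 : ℝ) ^ z • (D z).characterClass l := by
  have hS : ∀ y ∉ hE.toFinset, Module.finrank ℝ (E y).F = 0 := fun y hy => by
    by_contra h
    exact hy (hE.mem_toFinset.2 h)
  rw [finsum_eq_sum_of_support_subset (s := hE.toFinset)]
  · refine Subtype.ext ?_
    rw [Submodule.coe_sum, HomotopyConnection.characterClass,
      cohomologyClass_val ((sumConnection D).dA_traceForm hE D l),
      traceForm_sumConnection hE D l hS, map_sum]
    refine Finset.sum_congr rfl fun z _ => ?_
    rw [Submodule.coe_smul, Connection.characterClass,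
      cohomologyClass_val ((D z).dA_traceForm l), map_smul]
  -- Bundles of rank zero have zero trace forms, so the terms of the `finsum` are supported in the
  -- finite set of `hE`.
  · intro z hz
    by_contra h
    refine hz ?_
    change (-1 : ℝ) ^ z • (D z).characterClass l = 0
    rw [Connection.characterClass, (D z).traceForm_eq_zero (hS z h), cohomologyClass_zero,
      smul_zero]

end LieAlgebroid

end Characters

end

theorem mainTheorem10 {EM : Type*} [NormedAddCommGroup EM] [NormedSpace ℝ EM]
    [FiniteDimensional ℝ EM] {M : Type*} [TopologicalSpace M] [ChartedSpace EM M]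
    [IsManifold 𝓘(ℝ, EM) ∞ M] [T2Space M] [SigmaCompactSpace M]
    {A : SmoothVB 𝓘(ℝ, EM) M} (𝒜 : LieAlgebroid A)
    (E : ℤ → SmoothVB 𝓘(ℝ, EM) M) (hE : {z : ℤ | Module.finrank ℝ (E z).F ≠ 0}.Finite)
    (l : ℕ) (hl : 1 ≤ l) :
    -- the alternating sum formula
    𝒜.gradedPontryaginCharacter E l =
        ∑ᶠ z : ℤ, (-1 : ℝ) ^ z • 𝒜.pontryaginCharacter (E z) l ∧
    -- the graded character is well defined, by any connection up to homotopy
    Nonempty (𝒜.HomotopyConnection E) ∧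
    (∀ D : 𝒜.HomotopyConnection E,
      (∀ K : 𝒜.GEndForms E, D.IsCurvaturePower l K ↔ K = D.curvaturePower l) ∧
      𝒜.dA (D.traceForm l) = 0 ∧
      𝒜.gradedPontryaginCharacter E l = D.characterClass l) ∧
    -- the classical characters are well defined, by any linear connections
    (∀ z : ℤ, Nonempty (𝒜.Connection (E z)) ∧
      ∀ D : 𝒜.Connection (E z),
        (∀ K, D.IsCurvaturePower l K ↔ K = D.curvaturePower l) ∧
        𝒜.dA (D.traceForm l) = 0 ∧
        𝒜.pontryaginCharacter (E z) l = D.characterClass l) := by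
  let D₀ : ∀ z, 𝒜.Connection (E z) := fun z => LieAlgebroid.nonempty_connection.some
  refine ⟨?_, ⟨LieAlgebroid.sumConnection D₀⟩, fun D => ⟨D.isCurvaturePower_iff hE l,
    D.dA_traceForm hE D₀ l, LieAlgebroid.gradedPontryaginCharacter_eq hE D₀ D l⟩, fun z =>
    ⟨⟨D₀ z⟩, fun D => ⟨D.isCurvaturePower_iff l, D.dA_traceForm l,
      LieAlgebroid.pontryaginCharacter_eq hE D₀ D l⟩⟩⟩
  rw [LieAlgebroid.gradedPontryaginCharacter_eq hE D₀ (LieAlgebroid.sumConnection D₀),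
    LieAlgebroid.characterClass_sumConnection hE]
  exact finsum_congr fun z => by rw [LieAlgebroid.pontryaginCharacter_eq hE D₀ (D₀ z)]
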